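/- Let $m\ge 1$ be an integer, let $\alpha>0$, and let $t_1>\dots>t_m\ge 0$ be fixed. For $n\ge 1$ let $z_1,\dots,z_n$ be random points in the closed unit disk with joint law $$\frac{1}{n!\,Z_n}\prod_{1\le j<k\le n}|z_k-z_j|^2\prod_{j=1}^n(1-|z_j|^2)^{\alpha-1}\,d^2z_j,\qquad |z_j|\le 1,$$ where $Z_n$ is the normalization constant. Let $\mathrm N(y)=\#\{j:|z_j|<y\}$ and, for $n\ge t_1$, let $r_\ell=(1-t_\ell/n)^{1/2}$, $1\le \ell\le m$. Put $\hat\alpha=\min\{\alpha,1\}$ and $\mathrm Q(a,x)=\frac1{\Gamma(a)}\int_x^{\infty}s^{a-1}e^{-s}\,ds$. For $\vec u=(u_1,\dots,u_m)\in\mathbb R^m$ let $\omega_\ell=(e^{u_\ell}-1)\exp\big(\sum_{j=\ell+1}^m u_j\big)$ and, for $x\in(0,1]$, $$\mathcal H(x)=1+\sum_{\ell=1}^m\omega_\ell\,\mathrm Q(\alpha,t_\ell x),\qquad \mathcal G(x)=\frac{1}{\mathcal H(x)}\frac{x^{\alpha-1}}{\Gamma(\alpha)}\sum_{\ell=1}^m\omega_\ell\,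 t_\ell^\alpha e^{-t_\ell x}\,\frac{1-\alpha-t_\ell x}{2},$$ $$C_1(\vec u)=\int_0^1\ln\mathcal H(x)\,dx,\qquad C_2(\vec u)=\int_0^1\mathcal G(x)\,dx+\frac{\ln\mathcal H(1)-\sum_{j=1}^m u_j}{2}.$$ For $\vec j=(j_1,\dots,j_m)\in\mathbb N^m$ with $j_1+\dots+j_m\ge1$, write $\partial^{\vec j}=\partial_{u_1}^{j_1}\cdots\partial_{u_m}^{j_m}$ and let $\kappa_{\vec j}=\partial^{\vec j}\ln\mathbb E\big[e^{u_1\mathrm N(r_1)+\dots+u_m\mathrm N(r_m)}\big]\big|_{\vec u=\vec 0}$ be the joint cumulant of $\mathrm N(r_1),\dots,\mathrm N(r_m)$. (a) The functions $C_1$, $C_2$ and $\vec u\mapsto\ln\mathbb E[e^{u_1\mathrm N(r_1)+\dots+u_m\mathrm N(r_m)}]$ are smooth near $\vec 0$, and for every fixed $\vec j$ as above, $$\kappa_{\vec j}=\partial^{\vec j}C_1\big|_{\vec u=\vec 0}\;n+\partial^{\vec j}C_2\big|_{\vec u=\vec 0}+\mathcal O\big(n^{-\frac{2\hat\alpha+\alpha}{2+\alpha}}\big),\qquad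 n\to+\infty.$$ In particular, as $n\to+\infty$, for all $1\le\ell\le m$ in the first two formulas and all $1\le \ell<k\le m$ in the third, $$\mathbb E[\mathrm N(r_\ell)]=b_1(t_\ell)n+c_1(t_\ell)+\mathcal O\big(n^{-\frac{2\hat\alpha+\alpha}{2+\alpha}}\big),$$ $$\mathrm{Var}[\mathrm N(r_\ell)]=b_{(1,1)}(t_\ell,t_\ell)n+c_{(1,1)}(t_\ell,t_\ell)+\mathcal O\big(n^{-\frac{2\hat\alpha+\alpha}{2+\alpha}}\big),$$ $$\mathrm{Cov}(\mathrm N(r_\ell),\mathrm N(r_k))=b_{(1,1)}(t_\ell,t_k)n+c_{(1,1)}(t_\ell,t_k)+\mathcal O\big(n^{-\frac{2\hat\alpha+\alpha}{2+\alpha}}\big),$$ where $$b_1(t_\ell)=\int_0^1\mathrm Q(\alpha,t_\ell x)\,dx=\mathrm Q(\alpha,t_\ell)+\alpha\,\frac{1-\mathrm Q(\alpha+1,t_\ell)}{t_\ell}$$ (the second equality for $t_\ell>0$), $$c_1(t_\ell)=\frac{t_\ell^\alpha}{\Gamma(\alpha)}\int_0^1x^{\alpha-1}e^{-t_\ell x}\,\frac{1-\alpha-t_\ell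 x}{2}\,dx+\frac{\mathrm Q(\alpha,t_\ell)-1}{2},$$ and, for $\ell\le k$, $$b_{(1,1)}(t_\ell,t_k)=\int_0^1\mathrm Q(\alpha,t_\ell x)\big(1-\mathrm Q(\alpha,t_k x)\big)\,dx,$$ $$c_{(1,1)}(t_\ell,t_k)=\int_0^1\Big\{(\alpha-1+t_kx)t_k^\alpha e^{-t_kx}\,\mathrm Q(\alpha,t_\ell x)-(\alpha-1+t_\ell x)t_\ell^\alpha e^{-t_\ell x}\big(1-\mathrm Q(\alpha,t_kx)\big)\Big\}\frac{x^{\alpha-1}}{2\,\Gamma(\alpha)}\,dx+\frac12\,\mathrm Q(\alpha,t_\ell)\big(1-\mathrm Q(\alpha,t_k)\big).$$ (b) Assume in addition that $t_m>0$. Then $b_{(1,1)}(t_\ell,t_\ell)>0$ for all $\ell$, and as $n\to+\infty$ the random vector $(\mathcal N_1,\dots,\mathcal N_m)$, $$\mathcal N_\ell=\frac{\mathrm N(r_\ell)-b_1(t_\ell)n}{\sqrt{b_{(1,1)}(t_\ell,t_\ell)\,n}},$$ converges in distribution to a multivariate normal random variable with mean $(0,\dots,0)$ and covariance matrix $\Sigma$,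 where $\Sigma$ is the (positive semidefinite) symmetric matrix given by $$\Sigma_{\ell,k}=\Sigma_{k,\ell}=\frac{b_{(1,1)}(t_\ell,t_k)}{\sqrt{b_{(1,1)}(t_\ell,t_\ell)\,b_{(1,1)}(t_k,t_k)}},\qquad 1\le\ell\le k\le m.$$ -/

import Mathlib

open MeasureTheory ProbabilityTheory Filter Asymptotics
open scoped ContDiff

noncomputable section

namespace HardEdge

/-! ### The point process -/

/-- The one-particle weight `(1 - |w|²)^(α-1)` on the closed unit disk, zero elsewhere. -/
def diskWeight (α : ℝ) (w : ℂ) : ℝ :=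
  if ‖w‖ ≤ 1 then (1 - ‖w‖ ^ 2) ^ (α - 1) else 0

/-- The unnormalised joint density `∏_{j<k} |z_k - z_j|² ∏_j (1 - |z_j|²)^(α-1)`, `|z_j| ≤ 1`. -/
def density (α : ℝ) (n : ℕ) (z : Fin n → ℂ) : ℝ :=
  (∏ j, ∏ k ∈ Finset.Ioi j, ‖z k - z j‖ ^ 2) * ∏ j, diskWeight α (z j)

/-- The unnormalised joint law: the density with respect to Lebesgue measure on `ℂⁿ`. -/
def weight (α : ℝ) (n : ℕ) : Measure (Fin n → ℂ) :=
  (volume : Measure (Fin n → ℂ)).withDensity fun z => ENNReal.ofReal (density α n z)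

/-- The joint law of `z_1, …, z_n`. -/
def law (α : ℝ) (n : ℕ) : Measure (Fin n → ℂ) :=
  (weight α n Set.univ)⁻¹ • weight α n

/-- `N(y) = #{j : |z_j| < y}`. -/
def count {n : ℕ} (y : ℝ) (z : Fin n → ℂ) : ℝ :=
  ((Finset.univ.filter fun j => ‖z j‖ < y).card : ℝ)

/-- The radius `(1 - t/n)^(1/2)`. -/
def radius (t : ℝ) (n : ℕ) : ℝ := √(1 - t / n)

/-! ### The law is a probability measure -/

lemma diskWeight_nonneg (α : ℝ) (w : ℂ) : 0 ≤ diskWeight α w := by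
  unfold diskWeight
  split_ifs with h
  · exact Real.rpow_nonneg (by nlinarith [norm_nonneg w]) _
  · exact le_rfl

lemma measurable_diskWeight (α : ℝ) : Measurable (diskWeight α) :=
  Measurable.ite (measurableSet_le (by fun_prop) measurable_const) (by fun_prop) measurable_const

lemma integrable_diskWeight {α : ℝ} (hα : 0 < α) : Integrable (diskWeight α) := by
  refine (integrable_fun_norm_addHaar (volume : Measure ℂ)
    (f := fun r : ℝ => if r ≤ 1 then (1 - r ^ 2) ^ (α - 1) else 0)).2 ?_
  have h1 : IntegrableOn (fun y : ℝ => y * (1 - y ^ 2) ^ (α - 1)) (Set.Ioc 0 1) := by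
    refine intervalIntegral.integrableOn_deriv_of_nonneg
      (g := fun y : ℝ => -(1 - y ^ 2) ^ α / (2 * α)) ?_ ?_ ?_
    · refine ContinuousOn.div_const (ContinuousOn.neg ?_) _
      exact ContinuousOn.rpow_const (by fun_prop) fun _ _ => Or.inr hα.le
    · intro x hx
      have hx2 : 0 < 1 - x ^ 2 := by nlinarith [hx.1, hx.2]
      have h := (((hasDerivAt_pow 2 x).const_sub 1).rpow_const (p := α)
        (Or.inl hx2.ne')).neg.div_const (2 * α)
      refine HasDerivAt.congr_deriv (f := fun y : ℝ => -(1 - y ^ 2) ^ α / (2 * α)) h ?_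
      field_simp
      norm_num [mul_comm]
    · intro x hx
      have hx2 : 0 < 1 - x ^ 2 := by nlinarith [hx.1, hx.2]
      exact mul_nonneg hx.1.le (Real.rpow_nonneg hx2.le _)
  have h2 : IntegrableOn (Set.indicator (Set.Iic (1 : ℝ))
      fun y : ℝ => y * (1 - y ^ 2) ^ (α - 1)) (Set.Ioi 0) := by
    rw [IntegrableOn, integrable_indicator_iff measurableSet_Iic, IntegrableOn,
      Measure.restrict_restrict measurableSet_Iic, Set.inter_comm, Set.Ioi_inter_Iic]
    exact h1
  refine h2.congr_fun (fun y _ => ?_) measurableSet_Ioi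
  by_cases hy : y ≤ 1 <;> simp [hy]

lemma measurable_density (α : ℝ) (n : ℕ) : Measurable (density α n) := by
  have h := measurable_diskWeight α
  unfold density
  fun_prop

lemma weight_univ_ne_zero (α : ℝ) (n : ℕ) : weight α n Set.univ ≠ 0 := by
  rw [weight, withDensity_apply _ MeasurableSet.univ, Measure.restrict_univ]
  set U : Set (Fin n → ℂ) := (⋂ j, {z | ‖z j‖ < 1}) ∩ ⋂ j, ⋂ k ∈ Finset.Ioi j, {z | z k ≠ z j}
    with hU
  have hUo : IsOpen U := by
    refine IsOpen.inter (isOpen_iInter_of_finite fun j => isOpen_lt (by fun_prop) (by fun_prop))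
      (isOpen_iInter_of_finite fun j => isOpen_biInter_finset fun k _ =>
        isOpen_ne_fun (by fun_prop) (by fun_prop))
  have hUn : U.Nonempty := by
    refine ⟨fun j => (((j : ℕ) / (n + 1 : ℝ) : ℝ) : ℂ), ?_, ?_⟩
    · simp only [Set.mem_iInter, Set.mem_ofPred_eq]
      intro j
      rw [Complex.norm_of_nonneg (by positivity), div_lt_one (by positivity)]
      have : ((j : ℕ) : ℝ) < n := by exact_mod_cast j.2
      linarith
    · simp only [Set.mem_iInter, Set.mem_ofPred_eq, Finset.mem_Ioi]
      intro j k hjk h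
      have h' := Complex.ofReal_injective h
      rw [div_left_inj' (by positivity)] at h'
      have h2 : (k : ℕ) = j := by exact_mod_cast h'
      exact hjk.ne' (Fin.ext h2)
  have hpos : ∀ z ∈ U, 0 < density α n z := by
    rintro z ⟨hz1, hz2⟩
    simp only [Set.mem_iInter, Set.mem_ofPred_eq, Finset.mem_Ioi] at hz1 hz2
    refine mul_pos (Finset.prod_pos fun j _ => Finset.prod_pos fun k hk => ?_)
      (Finset.prod_pos fun j _ => ?_)
    · exact pow_pos (norm_pos_iff.2 (sub_ne_zero.2 (hz2 j k (Finset.mem_Ioi.1 hk)))) 2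
    · rw [diskWeight, if_pos (hz1 j).le]
      exact Real.rpow_pos_of_pos (by nlinarith [hz1 j, norm_nonneg (z j)]) _
  intro h0
  rw [lintegral_eq_zero_iff (measurable_density α n).ennreal_ofReal] at h0
  have hnull : volume U = 0 := by
    refine measure_mono_null (fun z hz => ?_) (ae_iff.1 h0)
    simpa using hpos z hz
  exact (hUo.measure_pos volume hUn).ne' hnull

lemma integrable_density {α : ℝ} (hα : 0 < α) (n : ℕ) : Integrable (density α n) := by
  have hprod : Integrable (fun z : Fin n → ℂ => ∏ j, diskWeight α (z j)) :=
    Integrable.fintype_prod (μ := fun _ : Fin n => (volume : Measure ℂ))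
      (f := fun _ => diskWeight α) fun _ => integrable_diskWeight hα
  refine (hprod.const_mul (∏ j : Fin n, ∏ _k ∈ Finset.Ioi j, (2 : ℝ) ^ 2)).mono'
    (measurable_density α n).aestronglyMeasurable (Eventually.of_forall fun z => ?_)
  have hw : 0 ≤ ∏ j, diskWeight α (z j) := Finset.prod_nonneg fun j _ => diskWeight_nonneg _ _
  have hv : 0 ≤ ∏ j, ∏ k ∈ Finset.Ioi j, ‖z k - z j‖ ^ 2 :=
    Finset.prod_nonneg fun j _ => Finset.prod_nonneg fun k _ => by positivity
  rw [density, Real.norm_of_nonneg (mul_nonneg hv hw)]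
  by_cases hz : ∀ j, ‖z j‖ ≤ 1
  · refine mul_le_mul_of_nonneg_right ?_ hw
    refine Finset.prod_le_prod (fun j _ => Finset.prod_nonneg fun k _ => by positivity)
      fun j _ => Finset.prod_le_prod (fun k _ => by positivity) fun k _ => ?_
    exact pow_le_pow_left₀ (norm_nonneg _)
      ((norm_sub_le _ _).trans (by linarith [hz k, hz j])) 2
  · push Not at hz
    obtain ⟨j, hj⟩ := hz
    have h0 : ∏ j, diskWeight α (z j) = 0 :=
      Finset.prod_eq_zero (Finset.mem_univ j) (if_neg hj.not_ge)
    rw [h0, mul_zero, mul_zero]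

lemma weight_univ_ne_top {α : ℝ} (hα : 0 < α) (n : ℕ) : weight α n Set.univ ≠ ⊤ := by
  rw [weight, withDensity_apply _ MeasurableSet.univ, Measure.restrict_univ]
  exact (integrable_density hα n).lintegral_lt_top.ne

lemma isProbabilityMeasure_law {α : ℝ} (hα : 0 < α) (n : ℕ) :
    IsProbabilityMeasure (law α n) := by
  refine ⟨?_⟩
  rw [law, Measure.smul_apply, smul_eq_mul]
  exact ENNReal.inv_mul_cancel (weight_univ_ne_zero α n) (weight_univ_ne_top hα n)

/-! ### Joint cumulants -/

/-- The mixed partial derivative `∂_{u_1}^{j_1} ⋯ ∂_{u_m}^{j_m} f`. -/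
def mixedPartial {m : ℕ} (j : Fin m → ℕ) (f : (Fin m → ℝ) → ℝ) : (Fin m → ℝ) → ℝ :=
  (List.finRange m).foldr
    (fun ℓ g => (fun (h : (Fin m → ℝ) → ℝ) u => lineDeriv ℝ h u (Pi.single ℓ 1))^[j ℓ] g) f

/-- `u ↦ ln E[exp(u_1 X_1 + ⋯ + u_m X_m)]`. -/
def logMGF {Ω : Type*} [MeasurableSpace Ω] {m : ℕ} (P : Measure Ω) (X : Fin m → Ω → ℝ)
    (u : Fin m → ℝ) : ℝ :=
  Real.log (∫ x, Real.exp (∑ ℓ, u ℓ * X ℓ x) ∂P)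

/-- The joint cumulant `κ_j` of `X_1, …, X_m`. -/
def jointCumulant {Ω : Type*} [MeasurableSpace Ω] {m : ℕ} (P : Measure Ω) (X : Fin m → Ω → ℝ)
    (j : Fin m → ℕ) : ℝ :=
  mixedPartial j (logMGF P X) 0

/-! ### The coefficients -/

/-- The normalised upper incomplete Gamma function `Γ(a, x) / Γ(a)`. -/
def Q (a x : ℝ) : ℝ :=
  (∫ s in Set.Ioi x, s ^ (a - 1) * Real.exp (-s)) / Real.Gamma a

/-- The factor `(e^{u_ℓ} - 1) exp(∑_{j > ℓ} u_j)`. -/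
def omega {m : ℕ} (u : Fin m → ℝ) (ℓ : Fin m) : ℝ :=
  (Real.exp (u ℓ) - 1) * Real.exp (∑ j ∈ Finset.Ioi ℓ, u j)

/-- `ℋ_α(x; t, u)`. -/
def H {m : ℕ} (α : ℝ) (t u : Fin m → ℝ) (x : ℝ) : ℝ :=
  1 + ∑ ℓ, omega u ℓ * Q α (t ℓ * x)

/-- `𝒢_α(x; t, u)`. -/
def G {m : ℕ} (α : ℝ) (t u : Fin m → ℝ) (x : ℝ) : ℝ :=
  1 / H α t u x * (x ^ (α - 1) / Real.Gamma α) *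
    ∑ ℓ, omega u ℓ * t ℓ ^ α * Real.exp (-(t ℓ * x)) * ((1 - α - t ℓ * x) / 2)

/-- The leading coefficient `C₁(u) = ∫₀¹ ln ℋ_α(x; t, u) dx`. -/
def C₁ {m : ℕ} (α : ℝ) (t u : Fin m → ℝ) : ℝ :=
  ∫ x in (0 : ℝ)..1, Real.log (H α t u x)

/-- `C₂(u) = ∫₀¹ 𝒢_α(x; t, u) dx + (ln ℋ_α(1; t, u) - ∑_j u_j) / 2`. -/
def C₂ {m : ℕ} (α : ℝ) (t u : Fin m → ℝ) : ℝ :=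
  (∫ x in (0 : ℝ)..1, G α t u x) + (Real.log (H α t u 1) - ∑ j, u j) / 2

/-- `b_1(s)`. -/
def b₁ (α s : ℝ) : ℝ := ∫ x in (0 : ℝ)..1, Q α (s * x)

/-- `c_1(s)`. -/
def c₁ (α s : ℝ) : ℝ :=
  s ^ α / Real.Gamma α *
      (∫ x in (0 : ℝ)..1, x ^ (α - 1) * Real.exp (-(s * x)) * ((1 - α - s * x) / 2))
    + (Q α s - 1) / 2

/-- `b_{(1,1)}(s, t)`, meant for `s ≥ t`. -/
def b₁₁ (α s t : ℝ) : ℝ := ∫ x in (0 : ℝ)..1, Q α (s * x) * (1 - Q α (t * x))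

/-- `c_{(1,1)}(s, t)`, meant for `s ≥ t`. -/
def c₁₁ (α s t : ℝ) : ℝ :=
  (∫ x in (0 : ℝ)..1,
      ((α - 1 + t * x) * t ^ α * Real.exp (-(t * x)) * Q α (s * x)
        - (α - 1 + s * x) * s ^ α * Real.exp (-(s * x)) * (1 - Q α (t * x)))
      * (x ^ (α - 1) / (2 * Real.Gamma α)))
    + 1 / 2 * Q α s * (1 - Q α t)

/-- The symmetric matrix with entries
`Σ_{ℓ,k} = b_{(1,1)}(t_ℓ, t_k) / √(b_{(1,1)}(t_ℓ, t_ℓ) b_{(1,1)}(t_k, t_k))` for `ℓ ≤ k`. -/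
def limitCov {m : ℕ} (α : ℝ) (t : Fin m → ℝ) : Matrix (Fin m) (Fin m) ℝ :=
  Matrix.of fun ℓ k =>
    b₁₁ α (t (min ℓ k)) (t (max ℓ k)) / √(b₁₁ α (t ℓ) (t ℓ) * b₁₁ α (t k) (t k))

/-- The function `n ↦ n^{-(2 α̂ + α)/(2 + α)}`, with `α̂ = min {α, 1}`. -/
def errorRate (α : ℝ) (n : ℕ) : ℝ := (n : ℝ) ^ (-((2 * min α 1 + α) / (2 + α)))

end HardEdge

end

open HardEdge

namespace HardEdge

/-! ### Integrals of radial products -/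

/-! The density is a squared Vandermonde determinant times a rotation-invariant weight. Expanding
the determinant and integrating over angles leaves only diagonal terms, so expectations of products
`∏ g ‖z j‖` factorise (`integral_law_prod`). Hence the counts have the joint law of counts of
independent moduli whose squares are `Beta(k+1, α)` (`map_countVec_law`), and the `k`-th modulus
lies below the radius with probability `1 - betaTail α k (t/n)`.

The disks are nested, so a single modulus has generating function `1 + ∑ ω_ℓ(u) p_ℓ`
(`exp_sum_mul_eq`), and the log moment generating function is `∑_k logForm (u, p_k)`. Every joint
cumulant is therefore `∑_k K(p_k)`, with `K` a `u`-derivative of `logForm` at `0`. The coefficients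
`C₁` and `C₂` are obtained from `logForm` by operators that commute with `u`-derivatives
(`ParamOperator`, `mixedPartial_eq`). Covariances have the same form with `K(p) = p_ℓ (1 - p_k)`.
Part (a) thus reduces to one expansion of `∑_k K(p_k)` for `C²` functions `K`,
`isBigO_sum_comp_pVec`.

With `j = k + 1` and `x = j/n`, `abs_betaTail_sub_le` gives `p_k = Q(α, t x) + corr(x)/n + O(x^α /
j²)`. The difficulty is the singularity at `x = 0`, where `1 - Q(α, t x)` is of order `x^α`: a
direct Riemann sum estimate leaves an error `∑ x^α / j²`, too large when `α < 1`. The remedy is to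
subtract from `K` its tangent map at `(1, …, 1)`. The remainder vanishes to second order there, so
the integrand is of order `x^(2α)` and the error is `∑ x^(2α) / j²`, which is within the claimed
rate (`abs_sum_sub_integral_le`, `exists_abs_sum_comp_pVec_sub_le`, `sum_rpow_div_sq_le_errorRate`).
The affine part needs only `∑_k p_k`. Since `betaTail` is the distribution function of a negative
binomial variable, that sum has a closed form (`sum_betaTail`) involving the last index alone, at `x
= 1`, away from the singularity; its error is `O(1/n)` (`abs_sum_one_sub_betaTail_sub_le`).

For (b), a linear combination of the counts is a sum of independent uniformly bounded variables.
Third-order Taylor bounds compare its characteristic function with a Gaussian one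
(`norm_charFun_centered_sub_le`), part (a) supplies the limits of the means and variances, and
Lévy's continuity theorem concludes. -/

lemma norm_det_vandermonde_sq {n : ℕ} (z : Fin n → ℂ) :
    ((∏ j, ∏ k ∈ Finset.Ioi j, ‖z k - z j‖ ^ 2 : ℝ) : ℂ) =
      ∑ σ : Equiv.Perm (Fin n), ∑ τ : Equiv.Perm (Fin n),
        ((Equiv.Perm.sign σ : ℤ) : ℂ) * ((Equiv.Perm.sign τ : ℤ) : ℂ) *
          ∏ i, (z i ^ (σ i : ℕ) * (starRingEnd ℂ (z i)) ^ (τ i : ℕ)) := by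
  have h1 : ((∏ j, ∏ k ∈ Finset.Ioi j, ‖z k - z j‖ ^ 2 : ℝ) : ℂ)
      = (Matrix.vandermonde z).det * starRingEnd ℂ (Matrix.vandermonde z).det := by
    rw [Complex.mul_conj, Matrix.det_vandermonde, Complex.normSq_eq_norm_sq]
    simp [norm_prod, Finset.prod_pow]
  have h2 : (Matrix.vandermonde z).det = ∑ σ : Equiv.Perm (Fin n),
      ((Equiv.Perm.sign σ : ℤ) : ℂ) * ∏ i, z i ^ (σ i : ℕ) := by
    rw [← Matrix.det_transpose, Matrix.det_apply']
    simp [Matrix.vandermonde_apply]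
  rw [h1, h2, map_sum, Finset.sum_mul_sum]
  refine Finset.sum_congr rfl fun σ _ => Finset.sum_congr rfl fun τ _ => ?_
  simp only [map_mul, map_prod, map_pow, map_intCast, Finset.prod_mul_distrib]
  ring

/-- Rotating by a unit `c` preserves Lebesgue measure and multiplies the integrand by `c^a * conj
c^b`, so the integral equals itself times a number different from `1`. No integrability is needed,
since both manipulations hold unconditionally. -/
lemma integral_radial_monomial_eq_zero (φ : ℝ → ℂ) {a b : ℕ} (hab : a ≠ b) :
    ∫ z : ℂ, z ^ a * (starRingEnd ℂ z) ^ b * φ ‖z‖ = 0 := by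
  obtain ⟨c, hc⟩ : ∃ c : Circle, (c : ℂ) ^ a * (starRingEnd ℂ c) ^ b ≠ 1 := by
    -- Rotation by one radian: a coincidence `e^{ia} = e^{ib}` with `a ≠ b` would make `π` rational.
    refine ⟨Circle.exp 1, fun h => ?_⟩
    rw [← Circle.coe_inv_eq_conj, ← Circle.coe_pow, ← Circle.coe_pow, ← Circle.coe_mul,
      ← Circle.coe_one, Circle.coe_inj, inv_pow, mul_inv_eq_one, ← Circle.exp_natCast_mul,
      ← Circle.exp_natCast_mul] at h
    simp only [mul_one] at h
    obtain ⟨m, hm⟩ := Circle.exp_eq_exp.1 h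
    have hm0 : m ≠ 0 := by
      rintro rfl
      simp at hm
      exact hab hm
    have hirr := irrational_pi
    refine hirr ⟨((a : ℚ) - b) / (2 * m), ?_⟩
    have : (m : ℝ) ≠ 0 := by exact_mod_cast hm0
    push_cast
    rw [hm]
    field_simp
    ring
  set I := ∫ z : ℂ, z ^ a * (starRingEnd ℂ z) ^ b * φ ‖z‖ with hI
  have h := ((rotation c).measurePreserving).integral_comp
    (rotation c).toHomeomorph.measurableEmbedding
    (fun z : ℂ => z ^ a * (starRingEnd ℂ z) ^ b * φ ‖z‖)
  have h' : ∫ z : ℂ, ((c : ℂ) ^ a * (starRingEnd ℂ c) ^ b) *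
      (z ^ a * (starRingEnd ℂ z) ^ b * φ ‖z‖) = I := by
    rw [hI, ← h]
    refine integral_congr_ae (Eventually.of_forall fun z => ?_)
    simp only [rotation_apply, norm_mul, Circle.norm_coe, one_mul, map_mul, mul_pow]
    ring
  rw [integral_const_mul, ← hI] at h'
  have h3 : ((c : ℂ) ^ a * (starRingEnd ℂ c) ^ b - 1) * I = 0 := by
    rw [sub_mul, h', one_mul, sub_self]
  exact (mul_eq_zero.1 h3).resolve_left (sub_ne_zero.2 hc)

lemma integrable_monomial_diskWeight {α : ℝ} (hα : 0 < α) {g : ℝ → ℂ} (hg : Measurable g) {B : ℝ}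
    (hB : ∀ x, ‖g x‖ ≤ B) (a b : ℕ) :
    Integrable fun z : ℂ =>
      z ^ a * (starRingEnd ℂ z) ^ b * ((diskWeight α z : ℂ) * g ‖z‖) := by
  have hm := measurable_diskWeight α
  refine ((integrable_diskWeight hα).mul_const B).mono' ?_ (Eventually.of_forall fun z => ?_)
  · refine Measurable.aestronglyMeasurable ?_
    have : Measurable fun z : ℂ => starRingEnd ℂ z := Complex.continuous_conj.measurable
    fun_prop
  · have hw := diskWeight_nonneg α z
    rw [norm_mul, norm_mul, norm_mul, norm_pow, norm_pow, RCLike.norm_conj, Complex.norm_real,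
      Real.norm_of_nonneg hw]
    by_cases hz : ‖z‖ ≤ 1
    · have h1 : ‖z‖ ^ a * ‖z‖ ^ b ≤ 1 := mul_le_one₀ (pow_le_one₀ (norm_nonneg _) hz)
        (by positivity) (pow_le_one₀ (norm_nonneg _) hz)
      calc ‖z‖ ^ a * ‖z‖ ^ b * (diskWeight α z * ‖g ‖z‖‖)
          ≤ 1 * (diskWeight α z * B) := by
            gcongr
            exact hB _
        _ = _ := one_mul _
    · rw [diskWeight, if_neg hz]
      simp

/-- Andréief's argument: in the double sum over permutations, orthogonality of distinct monomials
kills every term with `σ ≠ τ`, and the `n!` diagonal terms are all equal. -/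
lemma integral_density_mul_prod {α : ℝ} (hα : 0 < α) (n : ℕ) {g : ℝ → ℂ} (hg : Measurable g)
    {B : ℝ} (hB : ∀ x, ‖g x‖ ≤ B) :
    ∫ z : Fin n → ℂ, (density α n z : ℂ) * ∏ j, g ‖z j‖ =
      (n.factorial : ℂ) *
        ∏ k : Fin n, ∫ w : ℂ, ((‖w‖ ^ (2 * (k : ℕ)) * diskWeight α w : ℝ) : ℂ) * g ‖w‖ := by
  set F : ℕ → ℕ → ℂ → ℂ := fun a b z =>
    z ^ a * (starRingEnd ℂ z) ^ b * ((diskWeight α z : ℂ) * g ‖z‖) with hF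
  have hFi : ∀ a b, Integrable (F a b) := integrable_monomial_diskWeight hα hg hB
  have hF0 : ∀ a b, a ≠ b → ∫ z, F a b z = 0 := by
    intro a b hab
    have := integral_radial_monomial_eq_zero
      (fun r => (((if r ≤ 1 then (1 - r ^ 2) ^ (α - 1) else 0 : ℝ)) : ℂ) * g r) hab
    simpa only [hF, diskWeight] using this
  have hFd : ∀ a, ∫ z, F a a z =
      ∫ w : ℂ, ((‖w‖ ^ (2 * a) * diskWeight α w : ℝ) : ℂ) * g ‖w‖ := by
    intro a
    refine integral_congr_ae (Eventually.of_forall fun z => ?_)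
    simp only [hF]
    rw [← mul_pow, Complex.mul_conj, Complex.normSq_eq_norm_sq]
    push_cast
    ring
  have hexp : ∀ z : Fin n → ℂ, (density α n z : ℂ) * ∏ j, g ‖z j‖ =
      ∑ σ : Equiv.Perm (Fin n), ∑ τ : Equiv.Perm (Fin n),
        ((Equiv.Perm.sign σ : ℤ) : ℂ) * ((Equiv.Perm.sign τ : ℤ) : ℂ) *
          ∏ i, F (σ i) (τ i) (z i) := by
    intro z
    rw [density, Complex.ofReal_mul, norm_det_vandermonde_sq, mul_assoc, Finset.sum_mul]
    refine Finset.sum_congr rfl fun σ _ => ?_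
    rw [Finset.sum_mul]
    refine Finset.sum_congr rfl fun τ _ => ?_
    simp only [hF, Finset.prod_mul_distrib, Complex.ofReal_prod]
    ring
  have hint : ∀ σ τ : Equiv.Perm (Fin n), Integrable fun z : Fin n → ℂ =>
      ((Equiv.Perm.sign σ : ℤ) : ℂ) * ((Equiv.Perm.sign τ : ℤ) : ℂ) *
          ∏ i, F (σ i) (τ i) (z i) := fun σ τ =>
    (Integrable.fintype_prod (μ := fun _ : Fin n => (volume : Measure ℂ))
      (f := fun i => F (σ i) (τ i)) fun i => hFi _ _).const_mul _
  have hval : ∀ σ τ : Equiv.Perm (Fin n), ∫ z : Fin n → ℂ,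
      ((Equiv.Perm.sign σ : ℤ) : ℂ) * ((Equiv.Perm.sign τ : ℤ) : ℂ) *
          ∏ i, F (σ i) (τ i) (z i) = if σ = τ then ∏ k : Fin n, ∫ w, F k k w else 0 := by
    intro σ τ
    rw [integral_const_mul, integral_fintype_prod_volume_eq_prod (fun i => F (σ i) (τ i))]
    split_ifs with h
    · subst h
      rw [Equiv.prod_comp σ fun k : Fin n => ∫ w, F k k w, ← Int.cast_mul,
        ← Units.val_mul, Int.units_mul_self]
      simp
    · obtain ⟨i, hi⟩ : ∃ i, σ i ≠ τ i := by
        by_contra! hcon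
        exact h (Equiv.ext hcon)
      rw [Finset.prod_eq_zero (Finset.mem_univ i), mul_zero]
      exact hF0 _ _ fun hh => hi (Fin.ext hh)
  simp_rw [hexp]
  rw [integral_finsetSum _ fun σ _ => integrable_finsetSum _ fun τ _ => hint σ τ]
  simp_rw [integral_finsetSum _ fun τ _ => hint _ τ, hval]
  simp [hFd, Fintype.card_perm]

/-! ### The radial laws -/

/-- The unnormalised radial law with density `‖w‖^(2 * k) (1 - ‖w‖²)^(α-1)`. -/
noncomputable def radialWeight (α : ℝ) (k : ℕ) : Measure ℂ :=
  volume.withDensity fun w => ENNReal.ofReal (‖w‖ ^ (2 * k) * diskWeight α w)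

/-- The law on `ℂ` whose modulus is distributed as that of the `k`-th independent modulus. -/
noncomputable def radialLaw (α : ℝ) (k : ℕ) : Measure ℂ :=
  (radialWeight α k Set.univ)⁻¹ • radialWeight α k

lemma radialDensity_nonneg (α : ℝ) (k : ℕ) (w : ℂ) : 0 ≤ ‖w‖ ^ (2 * k) * diskWeight α w :=
  mul_nonneg (by positivity) (diskWeight_nonneg _ _)

lemma measurable_radialDensity (α : ℝ) (k : ℕ) :
    Measurable fun w : ℂ => ‖w‖ ^ (2 * k) * diskWeight α w := by
  have := measurable_diskWeight α
  fun_prop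

lemma integrable_radialDensity {α : ℝ} (hα : 0 < α) (k : ℕ) :
    Integrable fun w : ℂ => ‖w‖ ^ (2 * k) * diskWeight α w := by
  refine (integrable_diskWeight hα).mono' (measurable_radialDensity α k).aestronglyMeasurable
    (Eventually.of_forall fun w => ?_)
  rw [Real.norm_of_nonneg (radialDensity_nonneg _ _ _)]
  by_cases hw : ‖w‖ ≤ 1
  · exact mul_le_of_le_one_left (diskWeight_nonneg _ _) (pow_le_one₀ (norm_nonneg _) hw)
  · simp [diskWeight, hw]

lemma radialWeight_univ_ne_zero (α : ℝ) (k : ℕ) : radialWeight α k Set.univ ≠ 0 := by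
  rw [radialWeight, withDensity_apply _ MeasurableSet.univ, Measure.restrict_univ]
  intro h0
  rw [lintegral_eq_zero_iff (measurable_radialDensity α k).ennreal_ofReal] at h0
  have hU : IsOpen {w : ℂ | ‖w‖ < 1 ∧ w ≠ 0} :=
    (isOpen_lt (f := fun w : ℂ => ‖w‖) (g := fun _ => 1) (by fun_prop) (by fun_prop)).inter
      isOpen_ne
  have hne : {w : ℂ | ‖w‖ < 1 ∧ w ≠ 0}.Nonempty := ⟨1 / 2, by norm_num, by norm_num⟩
  refine (hU.measure_pos volume hne).ne' (measure_mono_null (fun w hw => ?_) (ae_iff.1 h0))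
  obtain ⟨hw1, hw0⟩ := hw
  have hp : 0 < ‖w‖ ^ (2 * k) * diskWeight α w := by
    rw [diskWeight, if_pos hw1.le]
    have := norm_pos_iff.2 hw0
    exact mul_pos (by positivity) (Real.rpow_pos_of_pos (by nlinarith) _)
  exact fun h => hp.ne' (le_antisymm (ENNReal.ofReal_eq_zero.1 h) hp.le)

lemma radialWeight_univ_ne_top {α : ℝ} (hα : 0 < α) (k : ℕ) : radialWeight α k Set.univ ≠ ⊤ := by
  rw [radialWeight, withDensity_apply _ MeasurableSet.univ, Measure.restrict_univ]
  exact (integrable_radialDensity hα k).lintegral_lt_top.ne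

lemma isProbabilityMeasure_radialLaw {α : ℝ} (hα : 0 < α) (k : ℕ) :
    IsProbabilityMeasure (radialLaw α k) := by
  refine ⟨?_⟩
  rw [radialLaw, Measure.smul_apply, smul_eq_mul]
  exact ENNReal.inv_mul_cancel (radialWeight_univ_ne_zero α k) (radialWeight_univ_ne_top hα k)

/-- Integration against a normalised density. -/
lemma integral_normalized_withDensity {X : Type*} [MeasurableSpace X] {μ : Measure X} {f : X → ℝ}
    (hf : Measurable f) (hf0 : ∀ x, 0 ≤ f x) (hfi : Integrable f μ) (g : X → ℂ) :
    ∫ x, g x ∂((μ.withDensity fun x => ENNReal.ofReal (f x)) Set.univ)⁻¹ •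
        (μ.withDensity fun x => ENNReal.ofReal (f x)) =
      (∫ x, (f x : ℂ) * g x ∂μ) / ((∫ x, f x ∂μ : ℝ) : ℂ) := by
  rw [integral_smul_measure, withDensity_apply _ MeasurableSet.univ, Measure.restrict_univ,
    integral_withDensity_eq_integral_toReal_smul hf.ennreal_ofReal
      (Eventually.of_forall fun _ => ENNReal.ofReal_lt_top), ENNReal.toReal_inv,
    ← ofReal_integral_eq_lintegral_ofReal hfi (Eventually.of_forall hf0),
    ENNReal.toReal_ofReal (integral_nonneg hf0), Complex.real_smul, div_eq_inv_mul]
  push_cast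
  congr 1
  refine integral_congr_ae (Eventually.of_forall fun x => ?_)
  simp [ENNReal.toReal_ofReal (hf0 x)]

lemma density_nonneg (α : ℝ) (n : ℕ) (z : Fin n → ℂ) : 0 ≤ density α n z :=
  mul_nonneg (Finset.prod_nonneg fun _ _ => Finset.prod_nonneg fun _ _ => by positivity)
    (Finset.prod_nonneg fun _ _ => diskWeight_nonneg _ _)

theorem integral_law_prod {α : ℝ} (hα : 0 < α) (n : ℕ) {g : ℝ → ℂ} (hg : Measurable g)
    {B : ℝ} (hB : ∀ x, ‖g x‖ ≤ B) :
    ∫ z, ∏ j, g ‖z j‖ ∂(law α n) = ∏ k : Fin n, ∫ w, g ‖w‖ ∂(radialLaw α k) := by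
  have h1 := integral_density_mul_prod hα n hg hB
  -- The case `g = 1` evaluates the normalisation constant; the factors `n!` cancel in the quotient.
  have h2 := integral_density_mul_prod hα n (g := fun _ => 1) measurable_const (B := 1) (by simp)
  simp only [Finset.prod_const_one, mul_one] at h2
  simp_rw [integral_complex_ofReal] at h2
  have hL : ∫ z, ∏ j, g ‖z j‖ ∂(law α n) =
      (∫ z, (density α n z : ℂ) * ∏ j, g ‖z j‖) / ((∫ z, density α n z : ℝ) : ℂ) :=
    integral_normalized_withDensity (measurable_density α n) (density_nonneg α n)
      (integrable_density hα n) _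
  have hR : ∀ k : Fin n, ∫ w, g ‖w‖ ∂(radialLaw α k) =
      (∫ w : ℂ, ((‖w‖ ^ (2 * (k : ℕ)) * diskWeight α w : ℝ) : ℂ) * g ‖w‖) /
        ((∫ w : ℂ, ‖w‖ ^ (2 * (k : ℕ)) * diskWeight α w : ℝ) : ℂ) := fun k =>
    integral_normalized_withDensity (measurable_radialDensity α k) (radialDensity_nonneg α k)
      (integrable_radialDensity hα k) _
  rw [hL, h1, h2]
  simp_rw [hR]
  rw [Finset.prod_div_distrib, mul_div_mul_left _ _ (by exact_mod_cast n.factorial_ne_zero)]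

/-! ### Reduction to independent moduli -/

lemma measurable_count {n : ℕ} (y : ℝ) : Measurable (count (n := n) y) := by
  have h : (count y : (Fin n → ℂ) → ℝ) = fun z => ∑ j, if ‖z j‖ < y then (1 : ℝ) else 0 := by
    ext z
    simp [count]
  rw [h]
  refine Finset.measurable_sum _ fun j _ => Measurable.ite ?_ measurable_const measurable_const
  exact measurableSet_lt (by fun_prop) measurable_const

/-- The indicator of `‖w‖ < y`. -/
noncomputable def diskInd (y : ℝ) (w : ℂ) : ℝ := if ‖w‖ < y then 1 else 0

lemma count_eq_sum {n : ℕ} (y : ℝ) (z : Fin n → ℂ) : count y z = ∑ j, diskInd y (z j) := by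
  simp [count, diskInd]

lemma measurable_diskInd (y : ℝ) : Measurable (diskInd y) :=
  Measurable.ite (measurableSet_lt (by fun_prop) measurable_const) measurable_const
    measurable_const

lemma diskInd_nonneg (y : ℝ) (w : ℂ) : 0 ≤ diskInd y w := by
  unfold diskInd
  split_ifs <;> norm_num

lemma diskInd_le_one (y : ℝ) (w : ℂ) : diskInd y w ≤ 1 := by
  unfold diskInd
  split_ifs <;> norm_num

/-- The product law of independent moduli. -/
noncomputable def indepLaw (α : ℝ) (n : ℕ) : Measure (Fin n → ℂ) :=
  Measure.pi fun k : Fin n => radialLaw α k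

lemma isProbabilityMeasure_indepLaw {α : ℝ} (hα : 0 < α) (n : ℕ) :
    IsProbabilityMeasure (indepLaw α n) := by
  have := fun k : Fin n => isProbabilityMeasure_radialLaw hα k
  unfold indepLaw
  infer_instance

/-- The vector of counts as a Euclidean vector. -/
noncomputable def countVec {m : ℕ} (r : Fin m → ℝ) {n : ℕ} (z : Fin n → ℂ) :
    EuclideanSpace ℝ (Fin m) :=
  WithLp.toLp 2 fun ℓ => count (r ℓ) z

lemma measurable_countVec {m : ℕ} (r : Fin m → ℝ) {n : ℕ} :
    Measurable (countVec r (n := n)) := by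
  refine (WithLp.measurable_toLp 2 _).comp (measurable_pi_lambda _ fun ℓ => measurable_count _)

/-- The counts have the same joint law under the point process and for independent moduli. -/
theorem map_countVec_law {α : ℝ} (hα : 0 < α) {m : ℕ} (r : Fin m → ℝ) (n : ℕ) :
    (law α n).map (countVec r) = (indepLaw α n).map (countVec r) := by
  have := isProbabilityMeasure_law hα n
  have := isProbabilityMeasure_indepLaw hα n
  have := fun k : Fin n => isProbabilityMeasure_radialLaw hα k
  refine Measure.ext_of_charFun (funext fun ξ => ?_)
  -- Counts are sums over particles, so the character at `ξ` is a product over particles of one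
  -- bounded radial function, to which the factorisation applies.
  set g : ℝ → ℂ := fun x =>
    Complex.exp ((∑ ℓ, ξ ℓ * (if x < r ℓ then 1 else 0) : ℝ) * Complex.I) with hg
  have hgm : Measurable g := by
    have : ∀ ℓ, Measurable fun x : ℝ => if x < r ℓ then (1 : ℝ) else 0 := fun ℓ =>
      Measurable.ite measurableSet_Iio measurable_const measurable_const
    fun_prop
  have hgB : ∀ x, ‖g x‖ ≤ 1 := fun x => (Complex.norm_exp_ofReal_mul_I _).le
  have hprod : ∀ z : Fin n → ℂ,
      Complex.exp ((inner ℝ (countVec r z) ξ : ℝ) * Complex.I) = ∏ j, g ‖z j‖ := by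
    intro z
    rw [hg, ← Complex.exp_sum, ← Finset.sum_mul, ← Complex.ofReal_sum, Finset.sum_comm]
    congr 3
    simp only [PiLp.inner_apply, countVec, count_eq_sum, diskInd]
    refine Finset.sum_congr rfl fun ℓ _ => ?_
    simp [← Finset.sum_filter, mul_comm]
  rw [charFun_apply, charFun_apply, integral_map (measurable_countVec r).aemeasurable
      (by fun_prop), integral_map (measurable_countVec r).aemeasurable (by fun_prop)]
  simp_rw [hprod]
  rw [integral_law_prod hα n hgm hgB, indepLaw,
    integral_fintype_prod_eq_prod (fun (_ : Fin n) (w : ℂ) => g ‖w‖)]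

lemma integral_comp_countVec_law {α : ℝ} (hα : 0 < α) {m : ℕ} (r : Fin m → ℝ) (n : ℕ)
    {E : Type*} [NormedAddCommGroup E] [NormedSpace ℝ E] {F : EuclideanSpace ℝ (Fin m) → E}
    (hF : StronglyMeasurable F) :
    ∫ z, F (countVec r z) ∂(law α n) = ∫ z, F (countVec r z) ∂(indepLaw α n) := by
  rw [← integral_map (measurable_countVec r).aemeasurable hF.aestronglyMeasurable,
    map_countVec_law hα, integral_map (measurable_countVec r).aemeasurable
      hF.aestronglyMeasurable]

/-! ### Incomplete beta integrals -/

/-- `∫₀^ε s^(α-1) (1-s)^k ds`. -/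
noncomputable def incBeta (α : ℝ) (k : ℕ) (ε : ℝ) : ℝ :=
  ∫ s in (0 : ℝ)..ε, s ^ (α - 1) * (1 - s) ^ k

/-- The probability that a `Beta(k+1, α)` variable exceeds `1 - ε`. -/
noncomputable def betaTail (α : ℝ) (k : ℕ) (ε : ℝ) : ℝ :=
  Real.Gamma (k + 1 + α) / (k.factorial * Real.Gamma α) * incBeta α k ε

/-- The increment `betaTail α (k+1) ε - betaTail α k ε`, shifted by one index. -/
noncomputable def betaMass (α : ℝ) (k : ℕ) (ε : ℝ) : ℝ :=
  (1 - ε) ^ k * ε ^ α * (Real.Gamma (k + α) / (k.factorial * Real.Gamma α))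

lemma intervalIntegrable_rpow_mul {α : ℝ} (hα : 0 < α) {f : ℝ → ℝ} (hf : Continuous f) (a b : ℝ) :
    IntervalIntegrable (fun s : ℝ => s ^ (α - 1) * f s) volume a b :=
  (intervalIntegral.intervalIntegrable_rpow' (by linarith)).mul_continuousOn hf.continuousOn

/-- Integrate the derivative of `s^α (1-s)^(k+1)` over `[0, ε]`, writing `s^α = s^(α-1) (1 -
(1-s))`. -/
lemma incBeta_succ {α : ℝ} (hα : 0 < α) (k : ℕ) {ε : ℝ} (hε : 0 ≤ ε) :
    (α + (k + 1)) * incBeta α (k + 1) ε - (k + 1) * incBeta α k ε = ε ^ α * (1 - ε) ^ (k + 1) := by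
  have h1 := intervalIntegrable_rpow_mul hα (f := fun s => (1 - s) ^ (k + 1)) (by fun_prop) 0 ε
  have h2 := intervalIntegrable_rpow_mul hα (f := fun s => (1 - s) ^ k) (by fun_prop) 0 ε
  have h := intervalIntegral.integral_eq_sub_of_hasDeriv_right_of_le hε
    (f := fun s : ℝ => s ^ α * (1 - s) ^ (k + 1))
    (f' := fun s : ℝ => (α + (k + 1)) * (s ^ (α - 1) * (1 - s) ^ (k + 1))
      - (k + 1) * (s ^ (α - 1) * (1 - s) ^ k)) ?_ ?_ ?_
  · rw [intervalIntegral.integral_sub (h1.const_mul _) (h2.const_mul _),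
      intervalIntegral.integral_const_mul, intervalIntegral.integral_const_mul] at h
    rw [incBeta, incBeta, h, Real.zero_rpow hα.ne']
    ring
  · exact ContinuousOn.mul (continuousOn_id.rpow_const fun _ _ => Or.inr hα.le)
      (by fun_prop)
  · intro s hs
    have hs0 : s ≠ 0 := hs.1.ne'
    have hd := (Real.hasDerivAt_rpow_const (p := α) (Or.inl hs0)).mul
      (((hasDerivAt_id s).const_sub 1).pow (k + 1))
    refine (hd.congr_deriv ?_).hasDerivWithinAt
    have : s ^ α = s ^ (α - 1) * s := by
      rw [Real.rpow_sub_one hs0]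
      field_simp
    rw [this]
    simp only [id, Pi.pow_apply, Nat.add_sub_cancel]
    push_cast
    ring
  · exact (h1.const_mul _).sub (h2.const_mul _)

lemma betaTail_zero {α : ℝ} (hα : 0 < α) (ε : ℝ) : betaTail α 0 ε = ε ^ α := by
  have hG := (Real.Gamma_pos_of_pos hα).ne'
  simp only [betaTail, incBeta, pow_zero, mul_one]
  rw [integral_rpow (Or.inl (by linarith)), sub_add_cancel, Real.zero_rpow hα.ne']
  have h := Real.Gamma_add_one hα.ne'
  simp only [Nat.cast_zero, zero_add, Nat.factorial_zero, Nat.cast_one, one_mul]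
  rw [add_comm, h]
  field_simp
  ring

/-- With the value at `k = 0`, this recursion exhibits `betaTail α k ε` as the distribution function
at `k` of a negative binomial variable with masses `betaMass α i ε`. -/
lemma betaTail_succ {α : ℝ} (hα : 0 < α) (k : ℕ) {ε : ℝ} (hε : 0 ≤ ε) :
    betaTail α (k + 1) ε = betaTail α k ε + betaMass α (k + 1) ε := by
  have hG := (Real.Gamma_pos_of_pos hα).ne'
  have h := incBeta_succ hα k hε
  have hk : (0 : ℝ) < k + 1 + α := by positivity
  have hg : Real.Gamma (((k + 1 : ℕ) : ℝ) + 1 + α) = (k + 1 + α) * Real.Gamma (k + 1 + α) := by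
    rw [← Real.Gamma_add_one hk.ne']
    push_cast
    ring_nf
  have hf : ((k + 1).factorial : ℝ) = (k + 1) * k.factorial := by
    push_cast [Nat.factorial_succ]
    ring
  have hk0 : (k.factorial : ℝ) ≠ 0 := by exact_mod_cast k.factorial_ne_zero
  have hk1 : (k : ℝ) + 1 ≠ 0 := by positivity
  rw [betaTail, betaTail, betaMass, hg, hf]
  push_cast
  field_simp
  linear_combination h

/-- At `ε = 1` each increment contains a positive power of `1 - ε = 0`. The recursion thereby
evaluates the complete beta integral. -/
lemma betaTail_one {α : ℝ} (hα : 0 < α) (k : ℕ) : betaTail α k 1 = 1 := by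
  induction k with
  | zero => rw [betaTail_zero hα, Real.one_rpow]
  | succ k ih => simp [betaTail_succ hα k zero_le_one, ih, betaMass]

lemma betaTail_zero_right (α : ℝ) (k : ℕ) : betaTail α k 0 = 0 := by
  simp [betaTail, incBeta]

/-- The mean of a truncated negative binomial variable in closed form. -/
lemma sum_betaTail {α : ℝ} (hα : 0 < α) {ε : ℝ} (hε : 0 < ε) (n : ℕ) :
    ∑ k ∈ Finset.range (n + 1), betaTail α k ε =
      (n + 1) * betaTail α n ε + (n + 1) * betaMass α (n + 1) ε
        - α * ((1 - ε) / ε) * betaTail (α + 1) n ε := by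
  have hG := (Real.Gamma_pos_of_pos hα).ne'
  have hG1 := Real.Gamma_add_one hα.ne'
  have hεα : ε ^ (α + 1) = ε ^ α * ε := Real.rpow_add_one hε.ne' α
  -- Size-biasing: weighting the masses by their index turns them into masses with parameter `α +
  -- 1`, so the truncated mean becomes a distribution function for `α + 1`.
  have hmass : ∀ k : ℕ, ((k : ℝ) + 1) * betaMass α (k + 1) ε =
      α * ((1 - ε) / ε) * betaMass (α + 1) k ε := by
    intro k
    have hf : ((k + 1).factorial : ℝ) = (k + 1) * k.factorial := by
      push_cast [Nat.factorial_succ]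
      ring
    have hk0 : (k.factorial : ℝ) ≠ 0 := by exact_mod_cast k.factorial_ne_zero
    have hk1 : (k : ℝ) + 1 ≠ 0 := by positivity
    rw [betaMass, betaMass, hεα, hf, hG1]
    push_cast
    rw [show (k : ℝ) + 1 + α = k + (α + 1) by ring]
    field_simp
    ring
  induction n with
  | zero =>
    simp only [zero_add, Finset.range_one, Finset.sum_singleton, Nat.cast_zero, one_mul]
    have h0 := hmass 0
    have h1 : betaMass (α + 1) 0 ε = betaTail (α + 1) 0 ε := by
      rw [betaTail_zero (by linarith), betaMass]
      simp [Real.Gamma_pos_of_pos (show 0 < α + 1 by linarith) |>.ne']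
    rw [h1] at h0
    simp only [Nat.cast_zero, zero_add, one_mul] at h0
    rw [h0]
    ring
  | succ n ih =>
    have h := hmass (n + 1)
    rw [Finset.sum_range_succ, ih, betaTail_succ (by linarith : 0 < α + 1) n hε.le, mul_add,
      ← h, betaTail_succ hα n hε.le]
    push_cast
    ring

/-! ### The radial probabilities -/

lemma setIntegral_Ioo_radial {α : ℝ} (k : ℕ) {r : ℝ} (hr0 : 0 ≤ r) (hr1 : r ≤ 1) :
    ∫ y in Set.Ioo r 1, y * (y ^ (2 * k) * (1 - y ^ 2) ^ (α - 1)) =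
      incBeta α k (1 - r ^ 2) / 2 := by
  have himg : (fun y : ℝ => 1 - y ^ 2) '' Set.Ioo r 1 = Set.Ioo 0 (1 - r ^ 2) := by
    ext s
    constructor
    · rintro ⟨y, ⟨h1, h2⟩, rfl⟩
      constructor <;> simp only <;> nlinarith
    · rintro ⟨h1, h2⟩
      have hs : 0 ≤ 1 - s := by nlinarith
      have hsq := Real.sq_sqrt hs
      refine ⟨√(1 - s), ⟨?_, ?_⟩, by simp only; rw [hsq]; ring⟩
      · exact Real.lt_sqrt_of_sq_lt (by linarith)
      · rw [Real.sqrt_lt' one_pos]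
        linarith
  have hinj : Set.InjOn (fun y : ℝ => 1 - y ^ 2) (Set.Ioo r 1) := by
    intro x hx y hy h
    have h' : x ^ 2 = y ^ 2 := by simpa using h
    exact (sq_eq_sq₀ (hr0.trans hx.1.le) (hr0.trans hy.1.le)).1 h'
  have h := integral_image_eq_integral_abs_deriv_smul (f := fun y : ℝ => 1 - y ^ 2)
    (f' := fun y => -(2 * y)) measurableSet_Ioo
    (fun y _ => by simpa using ((hasDerivAt_pow 2 y).const_sub 1).hasDerivWithinAt) hinj
    (fun s => s ^ (α - 1) * (1 - s) ^ k)
  rw [himg] at h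
  rw [incBeta, intervalIntegral.integral_of_le (by nlinarith), integral_Ioc_eq_integral_Ioo, h,
    ← integral_div]
  refine setIntegral_congr_fun measurableSet_Ioo fun y hy => ?_
  have hy0 : 0 ≤ y := hr0.trans hy.1.le
  simp only [abs_neg, abs_of_nonneg (show 0 ≤ 2 * y by linarith), smul_eq_mul, sub_sub_cancel]
  rw [← pow_mul]
  ring

lemma integral_radialDensity_compl {α : ℝ} (k : ℕ) {r : ℝ} (hr0 : 0 ≤ r) (hr1 : r ≤ 1) :
    ∫ w : ℂ, ‖w‖ ^ (2 * k) * diskWeight α w * (1 - diskInd r w) =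
      Real.pi * incBeta α k (1 - r ^ 2) := by
  have h := integral_fun_norm_addHaar (volume : Measure ℂ) (fun y : ℝ =>
    y ^ (2 * k) * (if y ≤ 1 then (1 - y ^ 2) ^ (α - 1) else 0) * (1 - if y < r then 1 else 0))
  simp only [Complex.finrank_real_complex] at h
  have hball : (volume : Measure ℂ).real (Metric.ball 0 1) = Real.pi := by
    simp [Measure.real, Complex.volume_ball]
  rw [hball] at h
  simp only [diskWeight, diskInd]
  rw [h]
  have h2 : ∫ y in Set.Ioi (0 : ℝ), y ^ (2 - 1) • (y ^ (2 * k) *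
      (if y ≤ 1 then (1 - y ^ 2) ^ (α - 1) else 0) * (1 - if y < r then 1 else 0)) =
      ∫ y in Set.Ioo r 1, y * (y ^ (2 * k) * (1 - y ^ 2) ^ (α - 1)) := by
    -- Endpoints are null. Passing to the closed sets makes the two indicator functions agree at
    -- every point, also when `r = 0`.
    rw [← integral_Ioc_eq_integral_Ioo, ← integral_Icc_eq_integral_Ioc,
      ← integral_indicator measurableSet_Icc, ← integral_Ici_eq_integral_Ioi,
      ← integral_indicator measurableSet_Ici]
    refine integral_congr_ae (Eventually.of_forall fun y => ?_)
    by_cases h1 : y ≤ 1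
    · by_cases h2 : y < r
      · simp [Set.indicator, h1, h2]
      · push Not at h2
        simp [Set.indicator, h1, h2, h2.not_gt, hr0.trans h2]
    · simp [Set.indicator, h1]
  rw [h2, setIntegral_Ioo_radial k hr0 hr1]
  simp only [nsmul_eq_mul, smul_eq_mul]
  push_cast
  ring

lemma integrable_diskInd {α : ℝ} (hα : 0 < α) (k : ℕ) (r : ℝ) :
    Integrable (diskInd r) (radialLaw α k) := by
  have := isProbabilityMeasure_radialLaw hα k
  refine Integrable.of_bound (measurable_diskInd r).aestronglyMeasurable 1
    (Eventually.of_forall fun w => ?_)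
  rw [Real.norm_of_nonneg (diskInd_nonneg _ _)]
  exact diskInd_le_one _ _

lemma integral_diskInd {α : ℝ} (hα : 0 < α) (k : ℕ) {r : ℝ} (hr0 : 0 ≤ r) (hr1 : r ≤ 1) :
    ∫ w, diskInd r w ∂(radialLaw α k) = 1 - betaTail α k (1 - r ^ 2) := by
  have := isProbabilityMeasure_radialLaw hα k
  have hnorm : ∫ w, (((1 - diskInd r w : ℝ)) : ℂ) ∂(radialLaw α k) =
      (∫ w : ℂ, ((‖w‖ ^ (2 * k) * diskWeight α w : ℝ) : ℂ) * ((1 - diskInd r w : ℝ) : ℂ)) /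
        ((∫ w : ℂ, ‖w‖ ^ (2 * k) * diskWeight α w : ℝ) : ℂ) :=
    integral_normalized_withDensity (measurable_radialDensity α k) (radialDensity_nonneg α k)
      (integrable_radialDensity hα k) _
  have hden : ∫ w : ℂ, ‖w‖ ^ (2 * k) * diskWeight α w = Real.pi * incBeta α k 1 := by
    have h := integral_radialDensity_compl (α := α) k le_rfl zero_le_one
    simpa [diskInd, (norm_nonneg _).not_gt] using h
  have h1 : ∫ w, (1 - diskInd r w) ∂(radialLaw α k) = incBeta α k (1 - r ^ 2) / incBeta α k 1 := by
    simp_rw [← Complex.ofReal_mul] at hnorm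
    rw [integral_complex_ofReal, integral_complex_ofReal, ← Complex.ofReal_div,
      Complex.ofReal_inj, integral_radialDensity_compl k hr0 hr1, hden,
      mul_div_mul_left _ _ Real.pi_ne_zero] at hnorm
    exact hnorm
  rw [integral_sub (integrable_const _) (integrable_diskInd hα k r)] at h1
  simp only [integral_const, probReal_univ, smul_eq_mul, mul_one] at h1
  -- This identifies the Gamma prefactor as the reciprocal of `incBeta α k 1`.
  have hT := betaTail_one hα k
  rw [betaTail] at hT ⊢
  have hb : incBeta α k 1 ≠ 0 := by
    intro h0
    simp [h0] at hT
  have hc : incBeta α k (1 - r ^ 2) / incBeta α k 1 =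
      Real.Gamma (k + 1 + α) / (k.factorial * Real.Gamma α) * incBeta α k (1 - r ^ 2) := by
    rw [div_eq_iff hb]
    linear_combination (-incBeta α k (1 - r ^ 2)) * hT
  linarith

lemma radius_nonneg (t : ℝ) (n : ℕ) : 0 ≤ radius t n := Real.sqrt_nonneg _

lemma radius_le_one {t : ℝ} (ht : 0 ≤ t) (n : ℕ) : radius t n ≤ 1 := by
  refine Real.sqrt_le_one.2 ?_
  have : 0 ≤ t / n := by positivity
  linarith

lemma radius_sq {t : ℝ} {n : ℕ} (h : t ≤ n) : 1 - radius t n ^ 2 = t / n := by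
  rw [radius, Real.sq_sqrt]
  · ring
  · have : t / n ≤ 1 := div_le_one_of_le₀ h (by positivity)
    linarith

lemma integral_diskInd_radius {α t : ℝ} (hα : 0 < α) (k : ℕ) {n : ℕ} (ht : 0 ≤ t) (h : t ≤ n) :
    ∫ w, diskInd (radius t n) w ∂(radialLaw α k) = 1 - betaTail α k (t / n) := by
  rw [integral_diskInd hα k (radius_nonneg _ _) (radius_le_one ht n), radius_sq h]

/-! ### Elementary bounds -/

lemma abs_log_one_sub_add_le {y : ℝ} (hy : |y| ≤ 1 / 2) :
    |Real.log (1 - y) + y + y ^ 2 / 2| ≤ 2 * |y| ^ 3 := by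
  have h := Real.abs_log_sub_add_sum_range_le (x := y) (by linarith) 2
  simp only [Finset.sum_range_succ, Finset.range_zero, Finset.sum_empty] at h
  norm_num at h
  have h2 : |y| ^ 3 / (1 - |y|) ≤ 2 * |y| ^ 3 := by
    rw [div_le_iff₀ (by linarith)]
    nlinarith [pow_nonneg (abs_nonneg y) 3]
  refine le_trans (le_of_eq ?_) (h.trans h2)
  congr 1
  ring

/-- The argument will be `α / j`, which need not be small. For `x ≥ 1/2` the crude bounds `0 ≤ log
(1 + x) ≤ x` suffice, at the price of the constant `5`. -/
lemma abs_log_one_add_sub_le {x : ℝ} (hx : 0 ≤ x) :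
    |Real.log (1 + x) - x + x ^ 2 / 2| ≤ 5 * x ^ 3 := by
  have hx3 : 0 ≤ x ^ 3 := by positivity
  rcases le_total x (1 / 2) with h | h
  · have h1 := abs_log_one_sub_add_le (y := -x) (by rwa [abs_neg, abs_of_nonneg hx])
    rw [abs_neg, abs_of_nonneg hx] at h1
    calc |Real.log (1 + x) - x + x ^ 2 / 2| = |Real.log (1 - -x) + -x + (-x) ^ 2 / 2| := by
          congr 1
          ring_nf
      _ ≤ 2 * x ^ 3 := h1
      _ ≤ _ := by linarith
  · have h1 : Real.log (1 + x) ≤ x := by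
      have := Real.log_le_sub_one_of_pos (show 0 < 1 + x by linarith)
      linarith
    have h2 : 0 ≤ Real.log (1 + x) := Real.log_nonneg (by linarith)
    rw [abs_le]
    constructor
    · nlinarith [mul_nonneg hx (show 0 ≤ x - 1 / 2 by linarith),
        mul_nonneg (mul_nonneg hx hx) (show 0 ≤ x - 1 / 2 by linarith)]
    · nlinarith [mul_nonneg hx (show 0 ≤ x - 1 / 2 by linarith),
        mul_nonneg (mul_nonneg hx hx) (show 0 ≤ x - 1 / 2 by linarith)]

lemma abs_exp_sub_one_sub_le {y Y : ℝ} (hy : |y| ≤ Y) :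
    |Real.exp y - 1 - y| ≤ Real.exp Y * y ^ 2 := by
  have h := Complex.norm_exp_sub_sum_le_norm_mul_exp (y : ℂ) 2
  simp only [Finset.sum_range_succ, Finset.range_zero, Finset.sum_empty] at h
  simp only [pow_zero, Nat.factorial_zero, Nat.cast_one, div_one, zero_add, pow_one,
    Nat.factorial_one, Complex.norm_real, Real.norm_eq_abs, sq_abs] at h
  rw [← Complex.ofReal_exp, ← sub_sub] at h
  norm_cast at h
  rw [Real.norm_eq_abs] at h
  calc _ ≤ y ^ 2 * Real.exp |y| := h
    _ ≤ y ^ 2 * Real.exp Y := by gcongr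
    _ = _ := mul_comm _ _

/-! ### Ratios of Gamma functions -/

/-- `Γ(j + α) / (Γ(j) j^α)` with `j = k + 1`. -/
noncomputable def gammaRatio (α : ℝ) (k : ℕ) : ℝ :=
  Real.Gamma (k + 1 + α) / (k.factorial * (k + 1 : ℝ) ^ α)

lemma gammaRatio_pos {α : ℝ} (hα : 0 < α) (k : ℕ) : 0 < gammaRatio α k := by
  have : 0 < Real.Gamma (k + 1 + α) := Real.Gamma_pos_of_pos (by positivity)
  have hk0 : (0 : ℝ) < k.factorial := by exact_mod_cast k.factorial_pos
  unfold gammaRatio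
  positivity

lemma prod_range_add_eq_Gamma {α : ℝ} (hα : 0 < α) (n : ℕ) :
    ∏ j ∈ Finset.range n, (α + j) = Real.Gamma (n + α) / Real.Gamma α := by
  have hG := (Real.Gamma_pos_of_pos hα).ne'
  induction n with
  | zero => simp [hG]
  | succ n ih =>
    have hk : (0 : ℝ) < n + α := by positivity
    rw [Finset.prod_range_succ, ih]
    push_cast
    rw [show (n : ℝ) + 1 + α = n + α + 1 by ring, Real.Gamma_add_one hk.ne']
    ring

/-- Euler's limit formula for `Γ(α)`, rearranged and taken at index `k + 1`. -/
lemma tendsto_gammaRatio {α : ℝ} (hα : 0 < α) :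
    Tendsto (gammaRatio α) atTop (nhds 1) := by
  have hG := Real.Gamma_pos_of_pos hα
  have h1 := (Real.GammaSeq_tendsto_Gamma α).comp (tendsto_add_atTop_nat 1)
  have h2 : Tendsto (fun k : ℕ => ((k : ℝ) + 1) / (k + 1 + α)) atTop (nhds 1) := by
    have h := (tendsto_natCast_div_add_atTop (𝕜 := ℝ) α).comp (tendsto_add_atTop_nat 1)
    refine h.congr fun k => ?_
    simp
  have h3 : Tendsto (fun k : ℕ => Real.Gamma α * ((k : ℝ) + 1) / (k + 1 + α) /
      Real.GammaSeq α (k + 1)) atTop (nhds 1) := by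
    have := (h2.const_mul (Real.Gamma α)).div h1 hG.ne'
    rw [mul_one, div_self hG.ne'] at this
    refine this.congr fun k => ?_
    simp only [Pi.div_apply, Function.comp_apply]
    ring
  refine h3.congr fun k => ?_
  have hg1 : 0 < Real.Gamma (k + 1 + α) := Real.Gamma_pos_of_pos (by positivity)
  have hk0 : (0 : ℝ) < k.factorial := by exact_mod_cast k.factorial_pos
  have hkα : (0 : ℝ) < k + 1 + α := by positivity
  have hpow : (0 : ℝ) < ((k : ℝ) + 1) ^ α := by positivity
  rw [Real.GammaSeq, prod_range_add_eq_Gamma hα, gammaRatio, Nat.factorial_succ]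
  push_cast
  rw [show (k : ℝ) + 1 + 1 + α = k + 1 + α + 1 by ring, Real.Gamma_add_one hkα.ne']
  field_simp

/-- Stirling's series is avoided. The functional equation makes the increments of `log (gammaRatio α
k)` explicit, and `A = α (α-1) / 2` is the value for which subtracting `A / j` cancels their `j⁻²`
term. The remaining increments are `O(j⁻³)`; summing them from infinity, where the limit is `0`,
gives `O(j⁻²)`, and exponentiating finishes. -/
lemma abs_gammaRatio_sub_le {α : ℝ} (hα : 0 < α) :
    ∃ C, 0 ≤ C ∧ ∀ k : ℕ, |gammaRatio α k - 1 - α * (α - 1) / 2 / (k + 1)| ≤ C / (k + 1) ^ 2 := by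
  set A := α * (α - 1) / 2 with hA
  set d : ℕ → ℝ := fun k => Real.log (gammaRatio α k) - A / (k + 1) with hd
  have hd0 : Tendsto d atTop (nhds 0) := by
    have h1 := (tendsto_gammaRatio hα).log one_ne_zero
    have h2 : Tendsto (fun k : ℕ => A / ((k : ℝ) + 1)) atTop (nhds 0) :=
      tendsto_const_nhds.div_atTop (tendsto_atTop_add_const_right _ _ tendsto_natCast_atTop_atTop)
    simpa using h1.sub h2
  set B : ℝ := 5 * α ^ 3 + 5 * α + |A| with hB
  have hB0 : 0 ≤ B := by positivity
  have hstep : ∀ k : ℕ, |d (k + 1) - d k| ≤ B / (k + 1) ^ 3 := by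
    intro k
    have hj : (0 : ℝ) < k + 1 := by positivity
    set j : ℝ := k + 1 with hjdef
    have hk0 : (0 : ℝ) < k.factorial := by exact_mod_cast k.factorial_pos
    have hg1 : 0 < Real.Gamma (j + α) := Real.Gamma_pos_of_pos (by positivity)
    have hrat : gammaRatio α (k + 1) = gammaRatio α k * ((1 + α / j) / (1 + 1 / j) ^ α) := by
      have e1 : (1 + 1 / j) ^ α = (j + 1) ^ α / j ^ α := by
        rw [← Real.div_rpow (by positivity) hj.le]
        congr 1
        field_simp
      have hp1 : 0 < j ^ α := by positivity
      have hp2 : 0 < (j + 1) ^ α := by positivity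
      rw [gammaRatio, gammaRatio, e1, Nat.factorial_succ]
      push_cast
      rw [← hjdef, show j + 1 + α = j + α + 1 by ring, Real.Gamma_add_one (by positivity)]
      field_simp
    have hlog : Real.log (gammaRatio α (k + 1)) = Real.log (gammaRatio α k) +
        (Real.log (1 + α / j) - α * Real.log (1 + 1 / j)) := by
      rw [hrat, Real.log_mul (gammaRatio_pos hα k).ne' (by positivity),
        Real.log_div (by positivity) (by positivity), Real.log_rpow (by positivity)]
    have l1 := abs_log_one_add_sub_le (x := α / j) (by positivity)
    have l2 := abs_log_one_add_sub_le (x := 1 / j) (by positivity)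
    have hdiff : d (k + 1) - d k = (Real.log (1 + α / j) - α / j + (α / j) ^ 2 / 2)
        - α * (Real.log (1 + 1 / j) - 1 / j + (1 / j) ^ 2 / 2) - A / (j ^ 2 * (j + 1)) := by
      simp only [hd]
      rw [hlog]
      push_cast
      rw [← hjdef, hA]
      field_simp
      ring
    have l3 : |A / (j ^ 2 * (j + 1))| ≤ |A| / j ^ 3 := by
      rw [abs_div, abs_of_pos (show 0 < j ^ 2 * (j + 1) by positivity)]
      gcongr
      nlinarith [pow_pos hj 2]
    rw [hdiff]
    calc _ ≤ |Real.log (1 + α / j) - α / j + (α / j) ^ 2 / 2|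
          + α * |Real.log (1 + 1 / j) - 1 / j + (1 / j) ^ 2 / 2| + |A / (j ^ 2 * (j + 1))| := by
          refine (abs_sub _ _).trans
            (add_le_add ((abs_sub _ _).trans (add_le_add le_rfl ?_)) le_rfl)
          rw [abs_mul, abs_of_pos hα]
      _ ≤ 5 * (α / j) ^ 3 + α * (5 * (1 / j) ^ 3) + |A| / j ^ 3 := by gcongr
      _ = _ := by
          rw [hB]
          field_simp
  have hd2 : ∀ k : ℕ, |d k| ≤ 2 * B / (k + 1) ^ 2 := by
    -- A telescoping majorant of the increments: it makes `d k - 2B/j²` and `-(d k + 2B/j²)`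
    -- increasing sequences with limit `0`, hence nonpositive.
    have hinv : ∀ k : ℕ, B / ((k : ℝ) + 1) ^ 3 ≤
        2 * B / (k + 1) ^ 2 - 2 * B / ((k + 1 : ℕ) + 1) ^ 2 := by
      intro k
      have hj : (1 : ℝ) ≤ k + 1 := by
        have : (0 : ℝ) ≤ k := Nat.cast_nonneg k
        linarith
      push_cast
      set j : ℝ := k + 1 with hjdef
      have e : 2 * B / j ^ 2 - 2 * B / (j + 1) ^ 2 - B / j ^ 3 =
          B * (3 * j ^ 2 - 1) / (j ^ 3 * (j + 1) ^ 2) := by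
        field_simp
        ring
      have : 0 ≤ B * (3 * j ^ 2 - 1) / (j ^ 3 * (j + 1) ^ 2) := by
        have : 0 ≤ 3 * j ^ 2 - 1 := by nlinarith
        positivity
      linarith
    have hs0 : Tendsto (fun k : ℕ => 2 * B / ((k : ℝ) + 1) ^ 2) atTop (nhds 0) := by
      refine tendsto_const_nhds.div_atTop ?_
      exact (tendsto_pow_atTop two_ne_zero).comp
        (tendsto_atTop_add_const_right _ _ tendsto_natCast_atTop_atTop)
    intro k
    rw [abs_le]
    constructor
    · have hm : Monotone fun k : ℕ => -(d k + 2 * B / ((k : ℝ) + 1) ^ 2) := by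
        refine monotone_nat_of_le_succ fun k => ?_
        have := (abs_le.1 (hstep k)).2
        have := hinv k
        linarith
      have := hm.ge_of_tendsto (by simpa using (hd0.add hs0).neg) k
      linarith
    · have hm : Monotone fun k : ℕ => d k - 2 * B / ((k : ℝ) + 1) ^ 2 := by
        refine monotone_nat_of_le_succ fun k => ?_
        have := (abs_le.1 (hstep k)).1
        have := hinv k
        linarith
      have := hm.ge_of_tendsto (by simpa using hd0.sub hs0) k
      linarith
  refine ⟨2 * B + Real.exp (|A| + 2 * B) * (|A| + 2 * B) ^ 2, by positivity, fun k => ?_⟩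
  have hj : (1 : ℝ) ≤ k + 1 := by
    have : (0 : ℝ) ≤ k := Nat.cast_nonneg k
    linarith
  set j : ℝ := k + 1 with hjdef
  have hj0 : 0 < j := by linarith
  have hexp : gammaRatio α k = Real.exp (A / j + d k) := by
    simp only [hd]
    rw [add_sub_cancel, Real.exp_log (gammaRatio_pos hα k)]
  have hdk := hd2 k
  rw [← hjdef] at hdk
  have hy : |A / j + d k| ≤ (|A| + 2 * B) / j := by
    refine (abs_add_le _ _).trans ?_
    rw [add_div, abs_div, abs_of_pos hj0]
    have : 2 * B / j ^ 2 ≤ 2 * B / j := by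
      gcongr
      nlinarith
    linarith
  have hy' : |A / j + d k| ≤ |A| + 2 * B := hy.trans (div_le_self (by positivity) hj)
  have h1 := abs_exp_sub_one_sub_le hy'
  have h2 : (A / j + d k) ^ 2 ≤ ((|A| + 2 * B) / j) ^ 2 := by
    rw [← sq_abs]
    gcongr
  rw [hexp]
  calc |Real.exp (A / j + d k) - 1 - A / j|
      = |(Real.exp (A / j + d k) - 1 - (A / j + d k)) + d k| := by congr 1; ring
    _ ≤ Real.exp (|A| + 2 * B) * ((|A| + 2 * B) / j) ^ 2 + 2 * B / j ^ 2 := by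
        refine (abs_add_le _ _).trans (add_le_add (h1.trans ?_) hdk)
        gcongr
    _ = _ := by
        field_simp
        ring

/-! ### The normalised incomplete Gamma function -/

lemma integrableOn_gamma {α : ℝ} (hα : 0 < α) :
    IntegrableOn (fun s : ℝ => s ^ (α - 1) * Real.exp (-s)) (Set.Ioi 0) := by
  refine (Real.GammaIntegral_convergent hα).congr_fun (fun s _ => ?_) measurableSet_Ioi
  simp only
  ring

lemma Q_eq {α : ℝ} (hα : 0 < α) {y : ℝ} (hy : 0 ≤ y) :
    Q α y = 1 - (∫ s in (0 : ℝ)..y, s ^ (α - 1) * Real.exp (-s)) / Real.Gamma α := by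
  have hG := (Real.Gamma_pos_of_pos hα).ne'
  have hi := integrableOn_gamma hα
  have h := setIntegral_union (μ := volume) (f := fun s : ℝ => s ^ (α - 1) * Real.exp (-s))
    (Set.Ioc_disjoint_Ioi (a := (0 : ℝ)) (le_refl y)) measurableSet_Ioi
    (hi.mono_set Set.Ioc_subset_Ioi_self) (hi.mono_set (Set.Ioi_subset_Ioi hy))
  rw [Set.Ioc_union_Ioi_eq_Ioi hy, ← intervalIntegral.integral_of_le hy] at h
  have hΓ : Real.Gamma α = ∫ s in Set.Ioi (0 : ℝ), s ^ (α - 1) * Real.exp (-s) := by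
    rw [Real.Gamma_eq_integral hα]
    exact integral_congr_ae (Eventually.of_forall fun s => mul_comm _ _)
  rw [← hΓ] at h
  rw [Q, eq_sub_iff_add_eq, ← add_div, add_comm, ← h, div_self hG]

lemma Q_zero {α : ℝ} (hα : 0 < α) : Q α 0 = 1 := by
  simp [Q_eq hα le_rfl]

/-- Substituting `s ↦ s x` isolates the factor `x^α` that governs the behaviour at `x = 0`. -/
lemma one_sub_Q_mul {α : ℝ} (hα : 0 < α) {t x : ℝ} (ht : 0 ≤ t) (hx : 0 ≤ x) :
    1 - Q α (t * x) =
      x ^ α / Real.Gamma α * ∫ s in (0 : ℝ)..t, s ^ (α - 1) * Real.exp (-(s * x)) := by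
  rcases hx.eq_or_lt with rfl | hx
  · simp [Q_zero hα, Real.zero_rpow hα.ne']
  rw [Q_eq hα (by positivity), sub_sub_cancel]
  have h := intervalIntegral.mul_integral_comp_mul_right (a := 0) (b := t)
    (f := fun s : ℝ => s ^ (α - 1) * Real.exp (-s)) x
  rw [zero_mul] at h
  have h2 : ∫ s in (0 : ℝ)..t, (s * x) ^ (α - 1) * Real.exp (-(s * x)) =
      x ^ (α - 1) * ∫ s in (0 : ℝ)..t, s ^ (α - 1) * Real.exp (-(s * x)) := by
    rw [← intervalIntegral.integral_const_mul]
    refine intervalIntegral.integral_congr fun s hs => ?_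
    rw [Set.uIcc_of_le ht] at hs
    rw [Real.mul_rpow hs.1 hx.le]
    ring
  rw [← h, h2, Real.rpow_sub_one hx.ne']
  field_simp

/-! ### Expansion of the tail probabilities -/

/-- The first-order correction to the tail probabilities. -/
noncomputable def corr (α t x : ℝ) : ℝ :=
  x ^ (α - 1) / Real.Gamma α * (t ^ α * Real.exp (-(t * x)) * ((1 - α - t * x) / 2))

/-- Up to a factor `x`, the term `α (α-1) / 2` is the Gamma ratio correction and the other two come
from expanding `(1 - s/n)^k`. Together they form the exact derivative of `s^α e^{-sx} (α - 1 + s x)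
/ 2`, so only the endpoint `s = t` survives. -/
lemma integral_corr {α : ℝ} (hα : 0 < α) {t : ℝ} (ht : 0 ≤ t) (x : ℝ) :
    ∫ s in (0 : ℝ)..t, s ^ (α - 1) * (Real.exp (-(s * x)) *
      (α * (α - 1) / 2 + s * x - s ^ 2 * x ^ 2 / 2)) =
    t ^ α * Real.exp (-(t * x)) * ((α - 1 + t * x) / 2) := by
  have hi := intervalIntegrable_rpow_mul hα (f := fun s : ℝ => Real.exp (-(s * x)) *
      (α * (α - 1) / 2 + s * x - s ^ 2 * x ^ 2 / 2)) (by fun_prop) 0 t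
  rw [intervalIntegral.integral_eq_sub_of_hasDeriv_right_of_le ht
    (f := fun s : ℝ => s ^ α * (Real.exp (-(s * x)) * ((α - 1 + s * x) / 2))) ?_ ?_ hi]
  · rw [Real.zero_rpow hα.ne']
    ring
  · exact ContinuousOn.mul (continuousOn_id.rpow_const fun _ _ => Or.inr hα.le)
      (by fun_prop)
  · intro s hs
    have hs0 : s ≠ 0 := hs.1.ne'
    have e1 : HasDerivAt (fun s : ℝ => s * x) x s := by simpa using (hasDerivAt_id s).mul_const x
    have hd := (Real.hasDerivAt_rpow_const (p := α) (Or.inl hs0)).mul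
      (e1.neg.exp.mul ((e1.const_add (α - 1)).div_const 2))
    refine HasDerivAt.hasDerivWithinAt (HasDerivAt.congr_deriv
      (f := fun s : ℝ => s ^ α * (Real.exp (-(s * x)) * ((α - 1 + s * x) / 2))) hd ?_)
    have : s ^ α = s ^ (α - 1) * s := by
      rw [Real.rpow_sub_one hs0]
      field_simp
    rw [this]
    simp only [Pi.mul_apply, Pi.neg_apply]
    ring

/-- Expansion of `(1 - s/n)^(j-1)` with `x = j/n`. -/
lemma abs_one_sub_pow_sub_le {t : ℝ} (ht : 0 ≤ t) :
    ∃ C : ℝ, 0 ≤ C ∧ ∀ n k : ℕ, 2 * t ≤ n → k < n → ∀ s ∈ Set.Icc (0 : ℝ) t,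
      |(1 - s / n) ^ k - Real.exp (-(s * ((k + 1) / n))) *
        (1 + (s - s ^ 2 * ((k + 1) / n) / 2) / n)| ≤ C / n ^ 2 := by
  set D : ℝ := t + t ^ 2 / 2 + t ^ 2 / 2 + 2 * t ^ 3 with hD
  have hD0 : 0 ≤ D := by positivity
  refine ⟨(t ^ 2 / 2 + 2 * t ^ 3) + Real.exp D * D ^ 2, by positivity, ?_⟩
  intro n k hn hk s hs
  have hs0 := hs.1
  have hn0 : (0 : ℝ) < n := by exact_mod_cast (Nat.zero_le k).trans_lt hk
  have hn1 : (1 : ℝ) ≤ n := by exact_mod_cast (Nat.succ_le_of_lt ((Nat.zero_le k).trans_lt hk))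
  have hkn : (k : ℝ) + 1 ≤ n := by exact_mod_cast hk
  have hk0 : (0 : ℝ) ≤ k := Nat.cast_nonneg k
  set x : ℝ := (k + 1) / n with hx
  have hx0 : 0 ≤ x := by positivity
  have hx1 : x ≤ 1 := (div_le_one hn0).2 hkn
  -- The shift by one matters: the exponent is `j - 1`, and the missing factor contributes the term
  -- `s` to the first-order correction.
  have hkx : (k : ℝ) = x * n - 1 := by
    rw [hx]
    field_simp
    ring
  have hy0 : 0 ≤ s / n := by positivity
  have hy : |s / n| ≤ 1 / 2 := by
    rw [abs_of_nonneg hy0, div_le_div_iff₀ hn0 two_pos]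
    linarith [hs.2]
  have hlog := abs_log_one_sub_add_le hy
  rw [abs_of_nonneg hy0] at hlog
  have hpos : 0 < 1 - s / n := by
    rw [abs_of_nonneg hy0] at hy
    linarith
  set L : ℝ := Real.log (1 - s / n) + s / n + (s / n) ^ 2 / 2 with hL
  set y : ℝ := k * Real.log (1 - s / n) + s * x with hydef
  have hy1 : y = (s - s ^ 2 * x / 2) / n + ((s / n) ^ 2 / 2 + k * L) := by
    rw [hydef, hL, hkx]
    field_simp
    ring
  have hrem : |(s / n) ^ 2 / 2 + k * L| ≤ (t ^ 2 / 2 + 2 * t ^ 3) / n ^ 2 := by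
    have a1 : |(s / n) ^ 2 / 2| ≤ t ^ 2 / 2 / n ^ 2 := by
      rw [abs_of_nonneg (by positivity), div_pow]
      have : s ^ 2 ≤ t ^ 2 := by gcongr; exact hs.2
      calc s ^ 2 / n ^ 2 / 2 = s ^ 2 / 2 / n ^ 2 := by ring
        _ ≤ _ := by gcongr
    have a2 : |k * L| ≤ 2 * t ^ 3 / n ^ 2 := by
      rw [abs_mul, abs_of_nonneg hk0]
      calc k * |L| ≤ n * (2 * (s / n) ^ 3) := by
            gcongr
        _ = 2 * s ^ 3 / n ^ 2 := by field_simp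
        _ ≤ _ := by gcongr; exact hs.2
    calc _ ≤ t ^ 2 / 2 / n ^ 2 + 2 * t ^ 3 / n ^ 2 := (abs_add_le _ _).trans (add_le_add a1 a2)
      _ = _ := by ring
  have hmain : |(s - s ^ 2 * x / 2) / n| ≤ (t + t ^ 2 / 2) / n := by
    rw [abs_div, abs_of_pos hn0]
    gcongr
    refine (abs_sub _ _).trans ?_
    rw [abs_of_nonneg hs0, abs_of_nonneg (by positivity)]
    have : s ^ 2 * x ≤ t ^ 2 * 1 := by
      gcongr
      exact hs.2
    linarith [hs.2]
  have hyD : |y| ≤ D / n := by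
    rw [hy1]
    refine (abs_add_le _ _).trans ((add_le_add hmain hrem).trans ?_)
    have : (t ^ 2 / 2 + 2 * t ^ 3) / (n : ℝ) ^ 2 ≤ (t ^ 2 / 2 + 2 * t ^ 3) / n := by
      gcongr
      nlinarith
    calc _ ≤ (t + t ^ 2 / 2) / n + (t ^ 2 / 2 + 2 * t ^ 3) / n := by linarith
      _ = _ := by rw [hD]; ring
  have hyD' : |y| ≤ D := hyD.trans (div_le_self hD0 hn1)
  have hexp := abs_exp_sub_one_sub_le hyD'
  have hpow : (1 - s / n) ^ k = Real.exp (-(s * x)) * Real.exp y := by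
    rw [← Real.exp_add, hydef, ← Real.exp_log (pow_pos hpos k), Real.log_pow]
    congr 1
    ring
  have he1 : Real.exp (-(s * x)) ≤ 1 := Real.exp_le_one_iff.2 (by
    have : 0 ≤ s * x := by positivity
    linarith)
  rw [hpow, ← mul_sub, abs_mul, abs_of_pos (Real.exp_pos _)]
  refine (mul_le_of_le_one_left (abs_nonneg _) he1).trans ?_
  have hsq : y ^ 2 ≤ (D / n) ^ 2 := by
    rw [← sq_abs]
    gcongr
  calc |Real.exp y - (1 + (s - s ^ 2 * x / 2) / n)|
      = |(Real.exp y - 1 - y) + ((s / n) ^ 2 / 2 + k * L)| := by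
        congr 1
        linarith
    _ ≤ Real.exp D * (D / n) ^ 2 + (t ^ 2 / 2 + 2 * t ^ 3) / n ^ 2 := by
        refine (abs_add_le _ _).trans (add_le_add (hexp.trans ?_) hrem)
        gcongr
    _ = _ := by
        field_simp
        ring

/-- Rescaling the integration variable by `n`; the powers of `n` and `k + 1` regroup into `x^α` and
a Gamma ratio tending to `1`. -/
lemma betaTail_eq_gammaRatio_mul {α : ℝ} {t : ℝ} (ht : 0 ≤ t) {n : ℕ} (hn : 0 < n)
    (k : ℕ) :
    betaTail α k (t / n) = ((k + 1) / n : ℝ) ^ α / Real.Gamma α * (gammaRatio α k *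
      ∫ s in (0 : ℝ)..t, s ^ (α - 1) * (1 - s / n) ^ k) := by
  have hn0 : (0 : ℝ) < n := by exact_mod_cast hn
  have hk0 : (0 : ℝ) < k.factorial := by exact_mod_cast k.factorial_pos
  have hinc : incBeta α k (t / n) =
      (n : ℝ) ^ (-α) * ∫ s in (0 : ℝ)..t, s ^ (α - 1) * (1 - s / n) ^ k := by
    have h := intervalIntegral.integral_comp_div (a := 0) (b := t)
      (f := fun s : ℝ => s ^ (α - 1) * (1 - s) ^ k) hn0.ne'
    rw [zero_div, smul_eq_mul] at h
    have h2 : ∫ s in (0 : ℝ)..t, (s / n) ^ (α - 1) * (1 - s / n) ^ k =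
        (n : ℝ) ^ (1 - α) * ∫ s in (0 : ℝ)..t, s ^ (α - 1) * (1 - s / n) ^ k := by
      rw [← intervalIntegral.integral_const_mul]
      refine intervalIntegral.integral_congr fun s hs => ?_
      rw [Set.uIcc_of_le ht] at hs
      rw [Real.div_rpow hs.1 hn0.le, show 1 - α = -(α - 1) by ring, Real.rpow_neg hn0.le]
      field_simp
    rw [h2] at h
    rw [show 1 - α = -α + 1 by ring, Real.rpow_add_one hn0.ne'] at h
    rw [incBeta]
    have h3 : (n : ℝ) * (∫ s in (0 : ℝ)..t / n, s ^ (α - 1) * (1 - s) ^ k) =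
        n * ((n : ℝ) ^ (-α) * ∫ s in (0 : ℝ)..t, s ^ (α - 1) * (1 - s / n) ^ k) := by
      rw [← h]
      ring
    exact mul_left_cancel₀ hn0.ne' h3
  have hp : (0 : ℝ) < ((k : ℝ) + 1) ^ α := by positivity
  have hp2 : (0 : ℝ) < (n : ℝ) ^ α := by positivity
  rw [betaTail, hinc, gammaRatio, Real.div_rpow (by positivity) hn0.le, Real.rpow_neg hn0.le]
  field_simp

/-- One factor is expanded in `1/j` and the other in `1/n`. Since `j ≤ n`, every product of
corrections and every remainder is `O(j⁻²)`. -/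
lemma abs_mul_sub_le_of_expansions {R J γ δ A C₁ K I D n j : ℝ} (hj : 1 ≤ j) (hjn : j ≤ n)
    (hC₁ : 0 ≤ C₁) (hR : |R - 1 - A / j| ≤ C₁ / j ^ 2) (hJ : |J - γ - δ / n| ≤ K / j ^ 2)
    (hγ : |γ| ≤ I) (hδ : |δ| ≤ D) :
    |R * J - γ - (δ / n + A * γ / j)| ≤
      ((1 + |A| + C₁) * K + C₁ * (I + D) + |A| * D) / j ^ 2 := by
  have hj0 : 0 < j := by linarith
  have hn0 : 0 < n := by linarith
  have hR' : |R| ≤ 1 + |A| + C₁ := by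
    have e2 : R = (R - 1 - A / j) + 1 + A / j := by ring
    have b1 : C₁ / j ^ 2 ≤ C₁ := div_le_self hC₁ (by nlinarith)
    have b2 : |A / j| ≤ |A| := by
      rw [abs_div, abs_of_pos hj0]
      exact div_le_self (abs_nonneg _) hj
    have b3 := abs_add_le (R - 1 - A / j) 1
    have b4 := abs_add_le (R - 1 - A / j + 1) (A / j)
    rw [abs_one] at b3
    rw [← e2] at b4
    linarith
  have hγδ : |γ + δ / n| ≤ I + D := by
    refine (abs_add_le _ _).trans (add_le_add hγ ?_)
    rw [abs_div, abs_of_pos hn0]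
    exact (div_le_self (abs_nonneg _) (hj.trans hjn)).trans hδ
  have h1 : |R * (J - γ - δ / n)| ≤ (1 + |A| + C₁) * (K / j ^ 2) := by
    rw [abs_mul]
    exact mul_le_mul hR' hJ (abs_nonneg _) (by positivity)
  have h2 : |(R - 1 - A / j) * (γ + δ / n)| ≤ C₁ / j ^ 2 * (I + D) := by
    rw [abs_mul]
    exact mul_le_mul hR hγδ (abs_nonneg _) (by positivity)
  have h3 : |A * δ / (j * n)| ≤ |A| * D / j ^ 2 := by
    rw [abs_div, abs_mul, abs_of_pos (show 0 < j * n by positivity)]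
    have : 0 ≤ D := (abs_nonneg _).trans hδ
    gcongr
    nlinarith
  have e : R * J - γ - (δ / n + A * γ / j) =
      R * (J - γ - δ / n) + (R - 1 - A / j) * (γ + δ / n) + A * δ / (j * n) := by
    field_simp
    ring
  have h4 := abs_add_le (R * (J - γ - δ / n) + (R - 1 - A / j) * (γ + δ / n)) (A * δ / (j * n))
  have h5 := abs_add_le (R * (J - γ - δ / n)) ((R - 1 - A / j) * (γ + δ / n))
  rw [e]
  calc _ ≤ (1 + |A| + C₁) * (K / j ^ 2) + C₁ / j ^ 2 * (I + D) + |A| * D / j ^ 2 := by linarith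
    _ = _ := by ring

/-- The two sources of correction, `δ/n` from the integrand and `A γ / j` from the Gamma ratio, add
up to `(x δ + A γ) / (x n)`, and `integral_corr` evaluates the numerator. Keeping the prefactor
`x^α` in the error is essential, because for small `k` the factor `1/j²` gives no decay in `n`. -/
theorem abs_betaTail_sub_le {α : ℝ} (hα : 0 < α) {t : ℝ} (ht : 0 ≤ t) :
    ∃ C : ℝ, 0 ≤ C ∧ ∀ n k : ℕ, 2 * t ≤ n → k < n →
      |(1 - betaTail α k (t / n)) - (Q α (t * ((k + 1) / n)) + corr α t ((k + 1) / n) / n)| ≤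
        C * ((k + 1) / n : ℝ) ^ α / (k + 1) ^ 2 := by
  obtain ⟨C₁, hC₁, h₁⟩ := abs_gammaRatio_sub_le hα
  obtain ⟨C₂, hC₂, h₂⟩ := abs_one_sub_pow_sub_le ht
  have hG := Real.Gamma_pos_of_pos hα
  set A : ℝ := α * (α - 1) / 2 with hA
  set I : ℝ := ∫ s in (0 : ℝ)..t, s ^ (α - 1) with hI
  have hI0 : 0 ≤ I := intervalIntegral.integral_nonneg ht fun s hs => Real.rpow_nonneg hs.1 _
  have hIi : IntervalIntegrable (fun s : ℝ => s ^ (α - 1)) volume 0 t :=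
    intervalIntegral.intervalIntegrable_rpow' (by linarith)
  have hbound : ∀ {f : ℝ → ℝ} {M : ℝ}, Continuous f → (∀ s ∈ Set.Icc 0 t, |f s| ≤ M) →
      |∫ s in (0 : ℝ)..t, s ^ (α - 1) * f s| ≤ M * I := by
    intro f M hf hM
    rw [hI, ← intervalIntegral.integral_const_mul, ← Real.norm_eq_abs]
    refine intervalIntegral.norm_integral_le_of_norm_le ht
      (Eventually.of_forall fun s hs => ?_) (hIi.const_mul M)
    have hs' : s ∈ Set.Icc 0 t := ⟨hs.1.le, hs.2⟩
    rw [norm_mul, Real.norm_of_nonneg (Real.rpow_nonneg hs'.1 _), mul_comm]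
    exact mul_le_mul_of_nonneg_right (hM s hs') (Real.rpow_nonneg hs'.1 _)
  set C₃ : ℝ := t + t ^ 2 / 2 with hC₃
  set E : ℝ := (1 + |A| + C₁) * (C₂ * I) + C₁ * (I + C₃ * I) + |A| * (C₃ * I) with hE
  refine ⟨E / Real.Gamma α, by positivity, ?_⟩
  intro n k hn hk
  have hn' : 0 < n := (Nat.zero_le k).trans_lt hk
  have hn0 : (0 : ℝ) < n := by exact_mod_cast hn'
  have hkn : (k : ℝ) + 1 ≤ n := by exact_mod_cast hk
  have hj0 : (0 : ℝ) < k + 1 := by positivity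
  have hj1 : (1 : ℝ) ≤ k + 1 := by
    have : (0 : ℝ) ≤ k := Nat.cast_nonneg k
    linarith
  have hpow := h₂ n k hn hk
  have hgr := h₁ k
  set j : ℝ := k + 1 with hj
  set x : ℝ := j / n with hx
  have hx0 : 0 < x := by positivity
  have hx1 : x ≤ 1 := (div_le_one hn0).2 hkn
  have hjx : j = x * n := by
    rw [hx]
    field_simp
  set γ : ℝ := ∫ s in (0 : ℝ)..t, s ^ (α - 1) * Real.exp (-(s * x)) with hγ
  set δ : ℝ := ∫ s in (0 : ℝ)..t, s ^ (α - 1) * (Real.exp (-(s * x)) * (s - s ^ 2 * x / 2)) with hδ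
  set J : ℝ := ∫ s in (0 : ℝ)..t, s ^ (α - 1) * (1 - s / n) ^ k with hJ
  have i0 := intervalIntegrable_rpow_mul hα (f := fun s : ℝ => Real.exp (-(s * x)))
    (by fun_prop) 0 t
  have i1 := intervalIntegrable_rpow_mul hα (f := fun s : ℝ => Real.exp (-(s * x)) *
    (s - s ^ 2 * x / 2)) (by fun_prop) 0 t
  have i2 := intervalIntegrable_rpow_mul hα (f := fun s : ℝ => (1 - s / n) ^ k)
    (by fun_prop) 0 t
  have he : ∀ s ∈ Set.Icc 0 t, |Real.exp (-(s * x))| ≤ 1 := fun s hs => by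
    rw [abs_of_pos (Real.exp_pos _)]
    exact Real.exp_le_one_iff.2 (by
      have : 0 ≤ s * x := mul_nonneg hs.1 hx0.le
      linarith)
  have hγb : |γ| ≤ I := by
    have := hbound (f := fun s : ℝ => Real.exp (-(s * x))) (by fun_prop) he
    simpa using this
  have hδb : |δ| ≤ C₃ * I := by
    refine hbound (f := fun s : ℝ => Real.exp (-(s * x)) * (s - s ^ 2 * x / 2)) (by fun_prop) ?_
    intro s hs
    rw [abs_mul]
    refine (mul_le_of_le_one_left (abs_nonneg _) (he s hs)).trans ((abs_sub _ _).trans ?_)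
    have hs0 := hs.1
    rw [abs_of_nonneg hs0, abs_of_nonneg (by positivity)]
    have : s ^ 2 * x ≤ t ^ 2 * 1 := by
      gcongr
      exact hs.2
    linarith [hs.2]
  have hJb : |J - γ - δ / n| ≤ C₂ / n ^ 2 * I := by
    have e : J - γ - δ / n = ∫ s in (0 : ℝ)..t, s ^ (α - 1) * ((1 - s / n) ^ k -
        Real.exp (-(s * x)) * (1 + (s - s ^ 2 * x / 2) / n)) := by
      rw [hJ, hγ, hδ, ← intervalIntegral.integral_div, ← intervalIntegral.integral_sub i2 i0,
        ← intervalIntegral.integral_sub (i2.sub i0) (i1.div_const _)]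
      congr 1
      ext s
      ring
    rw [e]
    exact hbound (by fun_prop) hpow
  have hid : x * δ + A * γ = t ^ α * Real.exp (-(t * x)) * ((α - 1 + t * x) / 2) := by
    rw [← integral_corr hα ht x, hδ, hγ, ← intervalIntegral.integral_const_mul,
      ← intervalIntegral.integral_const_mul, ← intervalIntegral.integral_add
        (i1.const_mul _) (i0.const_mul _)]
    congr 1
    ext s
    rw [hA]
    ring
  have hcorr : corr α t x = -(x ^ α / Real.Gamma α * (δ + A * γ / x)) := by
    rw [corr, Real.rpow_sub_one hx0.ne', show δ + A * γ / x = (x * δ + A * γ) / x by field_simp,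
      hid]
    ring
  have hQ := one_sub_Q_mul hα ht hx0.le
  rw [← hγ] at hQ
  have hbt := betaTail_eq_gammaRatio_mul (α := α) ht hn' k
  rw [← hj, ← hx, ← hJ] at hbt
  have key : (1 - betaTail α k (t / n)) - (Q α (t * x) + corr α t x / n) =
      -(x ^ α / Real.Gamma α * (gammaRatio α k * J - γ - (δ + A * γ / x) / n)) := by
    rw [hbt, hcorr, show Q α (t * x) = 1 - x ^ α / Real.Gamma α * γ by linarith]
    ring
  have hnj : C₂ / (n : ℝ) ^ 2 * I ≤ C₂ * I / j ^ 2 := by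
    rw [div_mul_eq_mul_div]
    gcongr
  have hinner : |gammaRatio α k * J - γ - (δ + A * γ / x) / n| ≤ E / j ^ 2 := by
    rw [add_div, show A * γ / x / n = A * γ / j by rw [hjx, div_div]]
    exact abs_mul_sub_le_of_expansions hj1 hkn hC₁ hgr (hJb.trans hnj) hγb hδb
  rw [key, abs_neg, abs_mul, abs_of_nonneg (by positivity)]
  calc x ^ α / Real.Gamma α * |gammaRatio α k * J - γ - (δ + A * γ / x) / n|
      ≤ x ^ α / Real.Gamma α * (E / j ^ 2) := by gcongr
    _ = _ := by ring

/-! ### Regularity and bounds for the incomplete Gamma function -/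

lemma continuousOn_Q {α : ℝ} (hα : 0 < α) : ContinuousOn (Q α) (Set.Ici 0) := by
  have h := intervalIntegral.continuous_primitive (μ := volume)
    (fun a b => intervalIntegrable_rpow_mul hα (f := fun s => Real.exp (-s)) (by fun_prop) a b) 0
  have h2 : Continuous fun y : ℝ =>
      1 - (∫ s in (0 : ℝ)..y, s ^ (α - 1) * Real.exp (-s)) / Real.Gamma α :=
    continuous_const.sub (h.div_const _)
  exact h2.continuousOn.congr fun y hy => Q_eq hα hy

lemma continuousOn_Q_mul {α t : ℝ} (hα : 0 < α) (ht : 0 ≤ t) :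
    ContinuousOn (fun x => Q α (t * x)) (Set.Ici 0) :=
  (continuousOn_Q hα).comp (by fun_prop) fun _ hx => mul_nonneg ht hx

lemma hasDerivAt_Q {α : ℝ} (hα : 0 < α) {y : ℝ} (hy : 0 < y) :
    HasDerivAt (Q α) (-(y ^ (α - 1) * Real.exp (-y) / Real.Gamma α)) y := by
  have hcont : ContinuousOn (fun s : ℝ => s ^ (α - 1) * Real.exp (-s)) (Set.Ioi 0) :=
    ContinuousOn.mul (continuousOn_id.rpow_const fun s hs => Or.inl (ne_of_gt hs)) (by fun_prop)
  have h := intervalIntegral.integral_hasDerivAt_right (a := 0) (b := y)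
    (f := fun s : ℝ => s ^ (α - 1) * Real.exp (-s))
    (intervalIntegrable_rpow_mul hα (by fun_prop) 0 y)
    (hcont.stronglyMeasurableAtFilter isOpen_Ioi y hy)
    (hcont.continuousAt (Ioi_mem_nhds hy))
  refine ((h.div_const (Real.Gamma α)).const_sub 1).congr_of_eventuallyEq ?_
  filter_upwards [Ioi_mem_nhds hy] with z hz using Q_eq hα (le_of_lt hz)

lemma hasDerivAt_Q_mul {α : ℝ} (hα : 0 < α) {t x : ℝ} (ht : 0 ≤ t) (hx : 0 < x) :
    HasDerivAt (fun x => Q α (t * x))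
      (-(x ^ (α - 1) / Real.Gamma α * (t ^ α * Real.exp (-(t * x))))) x := by
  rcases ht.eq_or_lt with rfl | ht
  · simpa [Real.zero_rpow hα.ne'] using hasDerivAt_const x (Q α 0)
  · have h1 : HasDerivAt (fun x : ℝ => t * x) t x := by simpa using (hasDerivAt_id x).const_mul t
    refine ((hasDerivAt_Q hα (mul_pos ht hx)).comp x h1).congr_deriv ?_
    rw [Real.mul_rpow ht.le hx.le, Real.rpow_sub_one ht.ne']
    field_simp

lemma Q_le_one {α : ℝ} (hα : 0 < α) {y : ℝ} (hy : 0 ≤ y) : Q α y ≤ 1 := by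
  have hG := Real.Gamma_pos_of_pos hα
  have h : 0 ≤ ∫ s in (0 : ℝ)..y, s ^ (α - 1) * Real.exp (-s) :=
    intervalIntegral.integral_nonneg hy fun s hs =>
      mul_nonneg (Real.rpow_nonneg hs.1 _) (Real.exp_pos _).le
  rw [Q_eq hα hy]
  have := div_nonneg h hG.le
  linarith

lemma Q_lt_one {α : ℝ} (hα : 0 < α) {y : ℝ} (hy : 0 < y) : Q α y < 1 := by
  have hG := Real.Gamma_pos_of_pos hα
  have h : 0 < ∫ s in (0 : ℝ)..y, s ^ (α - 1) * Real.exp (-s) :=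
    intervalIntegral.intervalIntegral_pos_of_pos_on
      (intervalIntegrable_rpow_mul hα (by fun_prop) 0 y)
      (fun s hs => mul_pos (Real.rpow_pos_of_pos hs.1 _) (Real.exp_pos _)) hy
  rw [Q_eq hα hy.le]
  have := div_pos h hG
  linarith

lemma Q_pos {α : ℝ} (hα : 0 < α) {y : ℝ} (hy : 0 ≤ y) : 0 < Q α y := by
  refine div_pos ?_ (Real.Gamma_pos_of_pos hα)
  have hpos : ∀ s ∈ Set.Ioi y, 0 < s ^ (α - 1) * Real.exp (-s) := fun s hs =>
    mul_pos (Real.rpow_pos_of_pos (lt_of_le_of_lt hy hs) _) (Real.exp_pos _)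
  rw [setIntegral_pos_iff_support_of_nonneg_ae]
  · have : Set.Ioi y ⊆ Function.support (fun s : ℝ => s ^ (α - 1) * Real.exp (-s)) ∩ Set.Ioi y :=
      fun s hs => ⟨(hpos s hs).ne', hs⟩
    refine lt_of_lt_of_le ?_ (measure_mono this)
    simp
  · filter_upwards [ae_restrict_mem measurableSet_Ioi] with s hs using (hpos s hs).le
  · exact (integrableOn_gamma hα).mono_set (Set.Ioi_subset_Ioi hy)

/-- `∫₀¹ s^(a-1) e^(-st) ds`. -/
noncomputable def unitGamma (a t : ℝ) : ℝ :=
  ∫ s in (0 : ℝ)..1, s ^ (a - 1) * Real.exp (-(s * t))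

lemma one_sub_Q_eq_unitGamma {a t : ℝ} (ha : 0 < a) (ht : 0 ≤ t) :
    1 - Q a t = t ^ a / Real.Gamma a * unitGamma a t := by
  have := one_sub_Q_mul ha zero_le_one ht
  rwa [one_mul] at this

/-- Integration by parts, as for `Γ(α+1) = α Γ(α)`, with a boundary term at `s = 1`. -/
lemma unitGamma_add_one {α : ℝ} (hα : 0 < α) (t : ℝ) :
    t * unitGamma (α + 1) t = α * unitGamma α t - Real.exp (-t) := by
  have i1 := intervalIntegrable_rpow_mul hα (f := fun s : ℝ => Real.exp (-(s * t)))
    (by fun_prop) 0 1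
  have i2 := intervalIntegrable_rpow_mul (show 0 < α + 1 by linarith)
    (f := fun s : ℝ => Real.exp (-(s * t))) (by fun_prop) 0 1
  have h := intervalIntegral.integral_eq_sub_of_hasDeriv_right_of_le zero_le_one
    (f := fun s : ℝ => s ^ α * Real.exp (-(s * t)))
    (f' := fun s : ℝ => α * (s ^ (α - 1) * Real.exp (-(s * t)))
      - t * (s ^ (α + 1 - 1) * Real.exp (-(s * t)))) ?_ ?_ ?_
  · rw [intervalIntegral.integral_sub (i1.const_mul _) (i2.const_mul _),
      intervalIntegral.integral_const_mul, intervalIntegral.integral_const_mul] at h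
    simp only [Real.one_rpow, one_mul, Real.zero_rpow hα.ne', zero_mul, sub_zero] at h
    rw [unitGamma, unitGamma]
    linarith
  · exact ContinuousOn.mul (continuousOn_id.rpow_const fun _ _ => Or.inr hα.le)
      (by fun_prop)
  · intro s hs
    have e1 : HasDerivAt (fun s : ℝ => s * t) t s := by simpa using (hasDerivAt_id s).mul_const t
    have hd := (Real.hasDerivAt_rpow_const (p := α) (Or.inl hs.1.ne')).mul e1.neg.exp
    refine (HasDerivAt.congr_deriv hd ?_).hasDerivWithinAt
    rw [add_sub_cancel_right]
    simp only [Pi.neg_apply]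
    ring
  · exact (i1.const_mul _).sub (i2.const_mul _)

/-! ### The mean coefficients -/

lemma intervalIntegrable_Q_mul {α t : ℝ} (hα : 0 < α) (ht : 0 ≤ t) :
    IntervalIntegrable (fun x => Q α (t * x)) volume 0 1 := by
  refine ContinuousOn.intervalIntegrable ((continuousOn_Q_mul hα ht).mono fun x hx => ?_)
  rw [Set.uIcc_of_le zero_le_one] at hx
  exact hx.1

/-- Integrate the derivative of `x Q(α, t x)` over `[0, 1]`. -/
lemma b₁_eq_unitGamma {α t : ℝ} (hα : 0 < α) (ht : 0 ≤ t) :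
    b₁ α t = Q α t + t ^ α / Real.Gamma α * unitGamma (α + 1) t := by
  have i1 := intervalIntegrable_Q_mul hα ht
  have i2 := intervalIntegrable_rpow_mul (show 0 < α + 1 by linarith)
    (f := fun s : ℝ => Real.exp (-(s * t))) (by fun_prop) 0 1
  have h := intervalIntegral.integral_eq_sub_of_hasDeriv_right_of_le zero_le_one
    (f := fun x : ℝ => x * Q α (t * x))
    (f' := fun x : ℝ => Q α (t * x)
      - t ^ α / Real.Gamma α * (x ^ (α + 1 - 1) * Real.exp (-(x * t)))) ?_ ?_ ?_
  · rw [intervalIntegral.integral_sub i1 (i2.const_mul _),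
      intervalIntegral.integral_const_mul] at h
    rw [b₁, unitGamma]
    simp only [mul_one, one_mul, zero_mul, sub_zero] at h
    linarith
  · exact continuousOn_id.mul ((continuousOn_Q_mul hα ht).mono fun x hx => hx.1)
  · intro x hx
    refine (((hasDerivAt_id x).mul (hasDerivAt_Q_mul hα ht hx.1)).congr_deriv ?_).hasDerivWithinAt
    have hx0 : x ≠ 0 := hx.1.ne'
    simp only [id]
    rw [add_sub_cancel_right, Real.rpow_sub_one hx0, mul_comm t x]
    field_simp
    ring
  · exact i1.sub (i2.const_mul _)

lemma b₁_eq {α t : ℝ} (hα : 0 < α) (ht : 0 < t) :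
    b₁ α t = Q α t + α * ((1 - Q (α + 1) t) / t) := by
  have hG := (Real.Gamma_pos_of_pos hα).ne'
  rw [b₁_eq_unitGamma hα ht.le, one_sub_Q_eq_unitGamma (by linarith) ht.le,
    Real.Gamma_add_one hα.ne', Real.rpow_add_one ht.ne']
  field_simp

lemma c₁_eq_unitGamma {α t : ℝ} (hα : 0 < α) (ht : 0 ≤ t) :
    c₁ α t = t ^ α / Real.Gamma α * (Real.exp (-t) / 2 - α * unitGamma α t) := by
  have i1 := intervalIntegrable_rpow_mul hα (f := fun s : ℝ => Real.exp (-(s * t)))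
    (by fun_prop) 0 1
  have i2 := intervalIntegrable_rpow_mul (show 0 < α + 1 by linarith)
    (f := fun s : ℝ => Real.exp (-(s * t))) (by fun_prop) 0 1
  have hint : ∫ x in (0 : ℝ)..1, x ^ (α - 1) * Real.exp (-(t * x)) * ((1 - α - t * x) / 2) =
      (1 - α) / 2 * unitGamma α t - t / 2 * unitGamma (α + 1) t := by
    rw [unitGamma, unitGamma, ← intervalIntegral.integral_const_mul,
      ← intervalIntegral.integral_const_mul, ← intervalIntegral.integral_sub (i1.const_mul _)
        (i2.const_mul _)]
    refine intervalIntegral.integral_congr_ae (Eventually.of_forall fun x hx => ?_)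
    rw [Set.uIoc_of_le zero_le_one] at hx
    rw [add_sub_cancel_right, Real.rpow_sub_one hx.1.ne', mul_comm t x]
    field_simp [hx.1.ne']
  have h1 := one_sub_Q_eq_unitGamma hα ht
  have h2 := unitGamma_add_one hα t
  rw [c₁, hint]
  linear_combination (-1 / 2) * h1 - t ^ α / Real.Gamma α / 2 * h2

/-! ### The sum of the means -/

/-- Handles the boundary mass in the closed form `sum_betaTail`. The system size is `n + 1`, so `n +
1` corresponds to `x = 1`. -/
lemma abs_weighted_betaMass_sub_le {α : ℝ} (hα : 0 < α) {t : ℝ} (ht : 0 < t) :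
    ∃ C : ℝ, 0 ≤ C ∧ ∀ n : ℕ, 2 * t ≤ ((n + 1 : ℕ) : ℝ) →
      |((n : ℝ) + 1) * betaMass α (n + 1) (t / ((n + 1 : ℕ) : ℝ))
        - t ^ α / Real.Gamma α * Real.exp (-t)| ≤ C / (n + 1) := by
  obtain ⟨C₁, hC₁, h₁⟩ := abs_gammaRatio_sub_le hα
  obtain ⟨C₂, hC₂, h₂⟩ := abs_one_sub_pow_sub_le ht.le
  have hG := Real.Gamma_pos_of_pos hα
  set A : ℝ := α * (α - 1) / 2 with hA
  refine ⟨t ^ α / Real.Gamma α * ((|A| + C₁) + t + (t + t ^ 2 / 2 + C₂)), by positivity, ?_⟩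
  intro n hn
  have hx := h₂ (n + 1) n hn (Nat.lt_succ_self n) t ⟨ht.le, le_rfl⟩
  have hg := h₁ n
  have hk0 : (0 : ℝ) < n.factorial := by exact_mod_cast n.factorial_pos
  have hw : ((n : ℝ) + 1) * betaMass α (n + 1) (t / ((n + 1 : ℕ) : ℝ)) =
      t ^ α / Real.Gamma α * ((1 - t / ((n + 1 : ℕ) : ℝ)) ^ n * (1 - t / ((n + 1 : ℕ) : ℝ))
        * gammaRatio α n) := by
    have hp : (0 : ℝ) < ((n : ℝ) + 1) ^ α := by positivity
    rw [betaMass, gammaRatio, Real.div_rpow ht.le (by positivity), Nat.factorial_succ, pow_succ]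
    push_cast
    field_simp
  rw [hw]
  push_cast at hx hn ⊢
  set N : ℝ := (n : ℝ) + 1 with hN
  have hN1 : 1 ≤ N := by
    have : (0 : ℝ) ≤ n := Nat.cast_nonneg n
    linarith
  have hN0 : 0 < N := by linarith
  set X : ℝ := (1 - t / N) ^ n with hX
  have hu0 : 0 ≤ 1 - t / N := by
    have : t / N ≤ 1 := (div_le_one hN0).2 (by linarith)
    linarith
  have htN : 0 ≤ t / N := by positivity
  have hu1 : 1 - t / N ≤ 1 := by linarith
  have hX0 : 0 ≤ X := pow_nonneg hu0 _
  have hX1 : X ≤ 1 := pow_le_one₀ hu0 hu1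
  have hsq : ∀ {c : ℝ}, 0 ≤ c → c / N ^ 2 ≤ c / N := fun hc => by
    gcongr
    nlinarith
  have hg' : |gammaRatio α n - 1| ≤ (|A| + C₁) / N := by
    have h3 := abs_add_le (gammaRatio α n - 1 - A / N) (A / N)
    rw [sub_add_cancel, abs_div A, abs_of_pos hN0] at h3
    have := hsq hC₁
    rw [add_div]
    linarith
  have he1 : Real.exp (-t) ≤ 1 := Real.exp_le_one_iff.2 (by linarith)
  have hXe : |X - Real.exp (-t)| ≤ (t + t ^ 2 / 2 + C₂) / N := by
    rw [div_self hN0.ne', mul_one, mul_one] at hx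
    have h3 := abs_add_le (X - Real.exp (-t) * (1 + (t - t ^ 2 / 2) / N))
      (Real.exp (-t) * ((t - t ^ 2 / 2) / N))
    rw [show X - Real.exp (-t) * (1 + (t - t ^ 2 / 2) / N) +
      Real.exp (-t) * ((t - t ^ 2 / 2) / N) = X - Real.exp (-t) by ring] at h3
    have h4 : |Real.exp (-t) * ((t - t ^ 2 / 2) / N)| ≤ (t + t ^ 2 / 2) / N := by
      rw [abs_mul, abs_of_pos (Real.exp_pos _), abs_div, abs_of_pos hN0]
      refine (mul_le_of_le_one_left (by positivity) he1).trans ?_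
      gcongr
      refine (abs_sub _ _).trans ?_
      rw [abs_of_pos ht, abs_of_nonneg (by positivity)]
    have := hsq hC₂
    rw [add_div]
    linarith
  have e : t ^ α / Real.Gamma α * (X * (1 - t / N) * gammaRatio α n)
      - t ^ α / Real.Gamma α * Real.exp (-t) =
      t ^ α / Real.Gamma α * (X * (1 - t / N) * (gammaRatio α n - 1) + -(X * (t / N))
        + (X - Real.exp (-t))) := by ring
  have b1 : |X * (1 - t / N) * (gammaRatio α n - 1)| ≤ (|A| + C₁) / N := by
    rw [abs_mul, abs_of_nonneg (mul_nonneg hX0 hu0)]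
    exact (mul_le_of_le_one_left (abs_nonneg _) (mul_le_one₀ hX1 hu0 hu1)).trans hg'
  have b2 : |-(X * (t / N))| ≤ t / N := by
    rw [abs_neg, abs_of_nonneg (mul_nonneg hX0 htN)]
    exact mul_le_of_le_one_left htN hX1
  have h3 := abs_add_le (X * (1 - t / N) * (gammaRatio α n - 1)) (-(X * (t / N)))
  have h4 := abs_add_le (X * (1 - t / N) * (gammaRatio α n - 1) + -(X * (t / N)))
    (X - Real.exp (-t))
  rw [e, abs_mul, abs_of_nonneg (by positivity), mul_div_assoc]
  refine mul_le_mul_of_nonneg_left ?_ (by positivity)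
  rw [add_div, add_div]
  linarith

/-- This is where the error improves to `O(1/n)` for every `α`: after `sum_betaTail` only the tails
with parameters `α` and `α + 1` at the last index, plus one mass, need expanding, and the
singularity at `x = 0` never enters. -/
theorem abs_sum_one_sub_betaTail_sub_le {α : ℝ} (hα : 0 < α) {t : ℝ} (ht : 0 ≤ t) :
    ∃ C : ℝ, 0 ≤ C ∧ ∀ n : ℕ, 0 < n → 2 * t ≤ n →
      |∑ k ∈ Finset.range n, (1 - betaTail α k (t / n)) - (b₁ α t * n + c₁ α t)| ≤ C / n := by
  rcases ht.eq_or_lt with rfl | ht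
  -- For `t = 0` all probabilities are `1`; the closed form used below divides by `ε = t/n`.
  · refine ⟨0, le_rfl, fun n _ _ => ?_⟩
    have hb : b₁ α 0 = 1 := by simp [b₁, Q_zero hα]
    have hc : c₁ α 0 = 0 := by simp [c₁, Q_zero hα, Real.zero_rpow hα.ne']
    simp [betaTail_zero_right, hb, hc]
  have hα1 : 0 < α + 1 := by linarith
  have hG := Real.Gamma_pos_of_pos hα
  obtain ⟨C₁, hC₁, h₁⟩ := abs_betaTail_sub_le hα ht.le
  obtain ⟨C₂, hC₂, h₂⟩ := abs_betaTail_sub_le hα1 ht.le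
  obtain ⟨C₃, hC₃, h₃⟩ := abs_weighted_betaMass_sub_le hα ht
  refine ⟨C₁ + C₃ + α / t * C₂ + α * |corr (α + 1) t 1|, by positivity, ?_⟩
  intro n hn0 hn
  -- With `n + 1` particles the last index `k = n` has `x = (k+1)/(n+1) = 1` exactly.
  obtain ⟨n, rfl⟩ := Nat.exists_eq_succ_of_ne_zero hn0.ne'
  have e1 := h₁ (n + 1) n hn (Nat.lt_succ_self n)
  have e2 := h₂ (n + 1) n hn (Nat.lt_succ_self n)
  have e3 := h₃ n hn
  rw [Nat.succ_eq_add_one]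
  rw [Finset.sum_sub_distrib, sum_betaTail hα (by positivity)]
  simp only [Finset.sum_const, Finset.card_range, nsmul_eq_mul, mul_one]
  set T := betaTail α n (t / ((n + 1 : ℕ) : ℝ)) with hT
  set T' := betaTail (α + 1) n (t / ((n + 1 : ℕ) : ℝ)) with hT'
  set w := ((n : ℝ) + 1) * betaMass α (n + 1) (t / ((n + 1 : ℕ) : ℝ)) with hw
  push_cast at e1 e2 hn ⊢
  have hN1 : (1 : ℝ) ≤ n + 1 := by
    have : (0 : ℝ) ≤ n := Nat.cast_nonneg n
    linarith
  clear_value T T' w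
  set N : ℝ := (n : ℝ) + 1 with hN
  have hN0 : 0 < N := by linarith
  rw [div_self hN0.ne', mul_one, Real.one_rpow, mul_one] at e1 e2
  set v := corr α t 1 with hv
  set v' := corr (α + 1) t 1 with hv'
  have hlead : b₁ α t = Q α t + α * ((1 - Q (α + 1) t) / t) := b₁_eq hα ht
  have hconst : c₁ α t = v - t ^ α / Real.Gamma α * Real.exp (-t) - α * (1 - Q (α + 1) t)
      - α / t * v' := by
    have h5 := unitGamma_add_one hα t
    rw [c₁_eq_unitGamma hα ht.le, one_sub_Q_eq_unitGamma hα1 ht.le, hv, hv', corr, corr,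
      Real.Gamma_add_one hα.ne', Real.rpow_add_one ht.ne', Real.one_rpow, Real.one_rpow]
    field_simp
    linear_combination 2 * h5
  -- Both tails carry a factor of order `N`, which is why their expansions are needed up to
  -- `O(N⁻²)`.
  have hsplit : N - (N * T + w - α * ((1 - t / N) / (t / N)) * T') - (b₁ α t * N + c₁ α t) =
      N * ((1 - T) - (Q α t + v / N)) + -(w - t ^ α / Real.Gamma α * Real.exp (-t))
        + -(α * (N / t - 1) * ((1 - T') - (Q (α + 1) t + v' / N))) + α * v' / N := by
    rw [hlead, hconst]
    field_simp
    ring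
  have b1 : |N * ((1 - T) - (Q α t + v / N))| ≤ C₁ / N := by
    rw [abs_mul, abs_of_pos hN0]
    calc _ ≤ N * (C₁ / N ^ 2) := by gcongr
      _ = _ := by field_simp
  have b2 : |-(w - t ^ α / Real.Gamma α * Real.exp (-t))| ≤ C₃ / N := by rwa [abs_neg]
  have b3 : |-(α * (N / t - 1) * ((1 - T') - (Q (α + 1) t + v' / N)))| ≤ α / t * C₂ / N := by
    have hNt : 0 ≤ N / t - 1 := by
      have : 1 ≤ N / t := (one_le_div ht).2 (by linarith)
      linarith
    rw [abs_neg, abs_mul, abs_of_nonneg (mul_nonneg hα.le hNt)]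
    calc _ ≤ α * (N / t) * (C₂ / N ^ 2) := by
          gcongr
          linarith
      _ = _ := by field_simp
  have b4 : |α * v' / N| ≤ α * |v'| / N := by
    rw [abs_div, abs_mul, abs_of_pos hN0, abs_of_pos hα]
  rw [hsplit, show (C₁ + C₃ + α / t * C₂ + α * |v'|) / N =
    C₁ / N + C₃ / N + α / t * C₂ / N + α * |v'| / N by ring]
  refine (abs_add_le _ _).trans (add_le_add ((abs_add_le _ _).trans (add_le_add
    ((abs_add_le _ _).trans (add_le_add b1 b2)) b3)) b4)

/-! ### Functions of power type -/

/-- `A` is of size `x^γ` on `(0, 1]`, with the matching Lipschitz bounds on dyadic intervals. -/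
def PowerLip {E : Type*} [NormedAddCommGroup E] (γ : ℝ) (A : ℝ → E) (C : ℝ) : Prop :=
  (∀ x ∈ Set.Ioc (0 : ℝ) 1, ‖A x‖ ≤ C * x ^ γ) ∧
    ∀ b ∈ Set.Ioc (0 : ℝ) 1, ∀ x ∈ Set.Icc (b / 2) b, ∀ y ∈ Set.Icc (b / 2) b,
      ‖A x - A y‖ ≤ C * b ^ (γ - 1) * |x - y|

lemma PowerLip.nonneg {E : Type*} [NormedAddCommGroup E] {γ C : ℝ} {A : ℝ → E}
    (h : PowerLip γ A C) : 0 ≤ C := by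
  have := (norm_nonneg _).trans (h.1 1 ⟨one_pos, le_rfl⟩)
  simpa using this

lemma PowerLip.mono {E : Type*} [NormedAddCommGroup E] {γ C D : ℝ} {A : ℝ → E}
    (h : PowerLip γ A C) (hCD : C ≤ D) : PowerLip γ A D := by
  refine ⟨fun x hx => (h.1 x hx).trans ?_, fun b hb x hx y hy => (h.2 b hb x hx y hy).trans ?_⟩
  · have := hx.1
    gcongr
  · have := hb.1
    gcongr

lemma rpow_le_of_mem_Icc_half (γ : ℝ) {b z : ℝ} (hb : 0 < b) (hz : z ∈ Set.Icc (b / 2) b) :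
    z ^ γ ≤ 2 ^ |γ| * b ^ γ := by
  have hz0 : 0 < z := by linarith [hz.1]
  have hbγ : 0 < b ^ γ := by positivity
  rcases le_total 0 γ with h | h
  · calc z ^ γ ≤ b ^ γ := Real.rpow_le_rpow hz0.le hz.2 h
      _ ≤ 2 ^ |γ| * b ^ γ :=
        le_mul_of_one_le_left hbγ.le (Real.one_le_rpow one_le_two (abs_nonneg _))
  · calc z ^ γ ≤ (b / 2) ^ γ := Real.rpow_le_rpow_of_nonpos (by positivity) hz.1 h
      _ = 2 ^ |γ| * b ^ γ := by
        rw [abs_of_nonpos h, Real.div_rpow hb.le two_pos.le, Real.rpow_neg two_pos.le]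
        field_simp

lemma powerLip_of_hasDerivAt {γ C D : ℝ} {A A' : ℝ → ℝ} (hC : 0 ≤ C) (hD : 0 ≤ D)
    (hA : ∀ x ∈ Set.Ioc (0 : ℝ) 1, |A x| ≤ C * x ^ γ)
    (hd : ∀ x ∈ Set.Ioc (0 : ℝ) 1, HasDerivAt A (A' x) x)
    (hA' : ∀ x ∈ Set.Ioc (0 : ℝ) 1, |A' x| ≤ D * x ^ (γ - 1)) :
    PowerLip γ A (C + D * 2 ^ |γ - 1|) := by
  have hp : (0 : ℝ) < 2 ^ |γ - 1| := by positivity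
  refine ⟨fun x hx => (hA x hx).trans ?_, fun b hb x hx y hy => ?_⟩
  · have := hx.1
    gcongr
    exact le_add_of_nonneg_right (by positivity)
  · have hb0 := hb.1
    have hsub : ∀ z ∈ Set.Icc (b / 2) b, z ∈ Set.Ioc (0 : ℝ) 1 := fun z hz =>
      ⟨by linarith [hz.1], hz.2.trans hb.2⟩
    have h := (convex_Icc (b / 2) b).norm_image_sub_le_of_norm_hasDerivWithin_le
      (f := A) (f' := A') (C := D * (2 ^ |γ - 1| * b ^ (γ - 1)))
      (fun z hz => (hd z (hsub z hz)).hasDerivWithinAt) (fun z hz => ?_) hy hx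
    · refine h.trans ?_
      rw [Real.norm_eq_abs]
      refine mul_le_mul_of_nonneg_right ?_ (abs_nonneg _)
      have : 0 < b ^ (γ - 1) := by positivity
      nlinarith [mul_nonneg hC this.le]
    · exact (hA' z (hsub z hz)).trans
        (mul_le_mul_of_nonneg_left (rpow_le_of_mem_Icc_half _ hb0 hz) hD)

lemma powerLip_rpow_mul (γ : ℝ) {g : ℝ → ℝ} (hg : ContDiff ℝ 1 g) :
    ∃ C, PowerLip γ (fun x => x ^ γ * g x) C := by
  obtain ⟨M, hM⟩ := isCompact_Icc.exists_bound_of_continuousOn (s := Set.Icc (0 : ℝ) 1)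
    hg.continuous.continuousOn
  obtain ⟨M', hM'⟩ := isCompact_Icc.exists_bound_of_continuousOn (s := Set.Icc (0 : ℝ) 1)
    (hg.continuous_deriv le_rfl).continuousOn
  have hM0 : 0 ≤ M := (norm_nonneg _).trans (hM 0 ⟨le_rfl, zero_le_one⟩)
  have hM0' : 0 ≤ M' := (norm_nonneg _).trans (hM' 0 ⟨le_rfl, zero_le_one⟩)
  refine ⟨_, powerLip_of_hasDerivAt (C := M) (D := |γ| * M + M')
    (A' := fun x => γ * x ^ (γ - 1) * g x + x ^ γ * deriv g x) hM0 (by positivity) ?_ ?_ ?_⟩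
  · intro x hx
    have hx0 := hx.1
    rw [abs_mul, abs_of_nonneg (by positivity), mul_comm]
    have := hM x ⟨hx0.le, hx.2⟩
    rw [Real.norm_eq_abs] at this
    gcongr
  · intro x hx
    exact (Real.hasDerivAt_rpow_const (Or.inl hx.1.ne')).mul
      (hg.differentiable one_ne_zero x).hasDerivAt
  · intro x hx
    have hx0 := hx.1
    have h1 := hM x ⟨hx0.le, hx.2⟩
    have h2 := hM' x ⟨hx0.le, hx.2⟩
    rw [Real.norm_eq_abs] at h1 h2
    have hp : 0 < x ^ (γ - 1) := by positivity
    have hxx : x ^ γ ≤ x ^ (γ - 1) := Real.rpow_le_rpow_of_exponent_ge hx0 hx.2 (by linarith)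
    refine (abs_add_le _ _).trans ?_
    rw [abs_mul, abs_mul, abs_mul, abs_of_pos hp, abs_of_pos (show 0 < x ^ γ by positivity)]
    calc |γ| * x ^ (γ - 1) * |g x| + x ^ γ * |deriv g x|
        ≤ |γ| * x ^ (γ - 1) * M + x ^ (γ - 1) * M' := by gcongr
      _ = _ := by ring

lemma powerLip_pi {m : ℕ} {γ : ℝ} {A : ℝ → Fin m → ℝ}
    (h : ∀ ℓ, ∃ C, PowerLip γ (fun x => A x ℓ) C) : ∃ C, PowerLip γ A C := by
  choose C hC using h
  have hle : ∀ ℓ, C ℓ ≤ ∑ i, C i := fun ℓ =>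
    Finset.single_le_sum (fun i _ => (hC i).nonneg) (Finset.mem_univ ℓ)
  have h0 : 0 ≤ ∑ i, C i := Finset.sum_nonneg fun i _ => (hC i).nonneg
  refine ⟨∑ i, C i, fun x hx => ?_, fun b hb x hx y hy => ?_⟩
  · have := hx.1
    exact (pi_norm_le_iff_of_nonneg (by positivity)).2 fun ℓ => ((hC ℓ).mono (hle ℓ)).1 x hx
  · have := hb.1
    exact (pi_norm_le_iff_of_nonneg (by positivity)).2 fun ℓ =>
      ((hC ℓ).mono (hle ℓ)).2 b hb x hx y hy

/-- Exponents add under products. In the application a vector of exponent `α - 1` meets a derivative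
of exponent `α`, giving `2α - 1 > -1`. -/
lemma PowerLip.pairing {E : Type*} [NormedAddCommGroup E] [NormedSpace ℝ E] {γ δ C D : ℝ}
    {A : ℝ → E} {B : ℝ → E →L[ℝ] ℝ} (hA : PowerLip γ A C) (hB : PowerLip δ B D) :
    PowerLip (γ + δ) (fun x => B x (A x)) (C * D * (1 + 2 ^ |γ| + 2 ^ |δ|)) := by
  have hC := hA.nonneg
  have hD := hB.nonneg
  refine ⟨fun x hx => ?_, fun b hb x hx y hy => ?_⟩
  · have hx0 := hx.1
    calc ‖B x (A x)‖ ≤ ‖B x‖ * ‖A x‖ := (B x).le_opNorm _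
      _ ≤ (D * x ^ δ) * (C * x ^ γ) :=
        mul_le_mul (hB.1 x hx) (hA.1 x hx) (norm_nonneg _) (by positivity)
      _ = C * D * 1 * x ^ (γ + δ) := by rw [Real.rpow_add hx0]; ring
      _ ≤ _ := by
        gcongr
        have h1 : (0 : ℝ) < 2 ^ |γ| := by positivity
        have h2 : (0 : ℝ) < 2 ^ |δ| := by positivity
        linarith
  · have hb0 := hb.1
    have hx1 : x ∈ Set.Ioc (0 : ℝ) 1 := ⟨by linarith [hx.1], hx.2.trans hb.2⟩
    have hy1 : y ∈ Set.Ioc (0 : ℝ) 1 := ⟨by linarith [hy.1], hy.2.trans hb.2⟩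
    have e : B x (A x) - B y (A y) = (B x - B y) (A x) + B y (A x - A y) := by
      simp
    have h1 : ‖(B x - B y) (A x)‖ ≤
        (D * b ^ (δ - 1) * |x - y|) * (C * (2 ^ |γ| * b ^ γ)) := by
      refine ((B x - B y).le_opNorm _).trans (mul_le_mul (hB.2 b hb x hx y hy)
        ((hA.1 x hx1).trans ?_) (norm_nonneg _) (by positivity))
      gcongr
      exact rpow_le_of_mem_Icc_half _ hb0 hx
    have h2 : ‖B y (A x - A y)‖ ≤
        (D * (2 ^ |δ| * b ^ δ)) * (C * b ^ (γ - 1) * |x - y|) := by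
      refine ((B y).le_opNorm _).trans (mul_le_mul ((hB.1 y hy1).trans ?_)
        (hA.2 b hb x hx y hy) (norm_nonneg _) (by positivity))
      gcongr
      exact rpow_le_of_mem_Icc_half _ hb0 hy
    have e1 : b ^ (δ - 1) * b ^ γ = b ^ (γ + δ - 1) := by
      rw [← Real.rpow_add hb0]
      congr 1
      ring
    have e2 : b ^ δ * b ^ (γ - 1) = b ^ (γ + δ - 1) := by
      rw [← Real.rpow_add hb0]
      congr 1
      ring
    rw [e]
    refine (norm_add_le _ _).trans ((add_le_add h1 h2).trans ?_)
    calc (D * b ^ (δ - 1) * |x - y|) * (C * (2 ^ |γ| * b ^ γ))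
          + (D * (2 ^ |δ| * b ^ δ)) * (C * b ^ (γ - 1) * |x - y|)
        = C * D * 2 ^ |γ| * (b ^ (δ - 1) * b ^ γ) * |x - y|
          + C * D * 2 ^ |δ| * (b ^ δ * b ^ (γ - 1)) * |x - y| := by ring
      _ = C * D * (2 ^ |γ| + 2 ^ |δ|) * b ^ (γ + δ - 1) * |x - y| := by rw [e1, e2]; ring
      _ ≤ _ := by
        gcongr
        linarith

/-! ### Quadrature for functions with a power singularity -/

/-- The rule is exact on affine functions, so only the deviation from the tangent at `a`
contributes, and that is at most `M (b - a)`. Control of the oscillation of `h'` replaces a second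
derivative, which would not be available for `R ∘ q` with `R` merely `C²` in a form uniform near
`0`. -/
lemma abs_trapezoid_sub_le {a b M : ℝ} (hab : a ≤ b) {h f : ℝ → ℝ}
    (hd : ∀ x ∈ Set.Icc a b, HasDerivAt h (f x) x)
    (hf : ∀ x ∈ Set.Icc a b, |f x - f a| ≤ M) :
    |(b - a) * ((h a + h b) / 2) - ∫ x in a..b, h x| ≤ 2 * M * (b - a) ^ 2 := by
  have ha : a ∈ Set.Icc a b := ⟨le_rfl, hab⟩
  have hb : b ∈ Set.Icc a b := ⟨hab, le_rfl⟩
  have hM : 0 ≤ M := (abs_nonneg _).trans (hf a ha)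
  set e : ℝ → ℝ := fun x => h x - (h a + f a * (x - a)) with he
  have hed : ∀ x ∈ Set.Icc a b, HasDerivAt e (f x - f a) x := by
    intro x hx
    have h1 : HasDerivAt (fun x => h a + f a * (x - a)) (f a) x := by
      simpa using (((hasDerivAt_id x).sub_const a).const_mul (f a)).const_add (h a)
    exact (hd x hx).sub h1
  have heb : ∀ x ∈ Set.Icc a b, |e x| ≤ M * (b - a) := by
    intro x hx
    have h1 := (convex_Icc a b).norm_image_sub_le_of_norm_hasDerivWithin_le
      (fun z hz => (hed z hz).hasDerivWithinAt) (fun z hz => hf z hz) ha hx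
    have h2 : e a = 0 := by simp [he]
    rw [h2, sub_zero, Real.norm_eq_abs, Real.norm_eq_abs,
      abs_of_nonneg (show 0 ≤ x - a by linarith [hx.1])] at h1
    refine h1.trans ?_
    gcongr
    exact hx.2
  have hei : IntervalIntegrable e volume a b := by
    refine ContinuousOn.intervalIntegrable fun x hx => ?_
    rw [Set.uIcc_of_le hab] at hx
    exact (hed x hx).continuousAt.continuousWithinAt
  have hint : ∫ x in a..b, h x = (b - a) * h a + f a * ((b - a) ^ 2 / 2) + ∫ x in a..b, e x := by
    have h1 : ∀ x, h x = (h a + f a * (x - a)) + e x := fun x => by simp [he]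
    have h2 : ∫ x in a..b, (h a + f a * (x - a)) = (b - a) * h a + f a * ((b - a) ^ 2 / 2) := by
      rw [intervalIntegral.integral_add (by simp) (Continuous.intervalIntegrable (by fun_prop) _ _),
        intervalIntegral.integral_const_mul, intervalIntegral.integral_sub
          (Continuous.intervalIntegrable (by fun_prop) _ _) (by simp), integral_id]
      simp only [intervalIntegral.integral_const, smul_eq_mul]
      ring
    rw [← h2, ← intervalIntegral.integral_add (Continuous.intervalIntegrable (by fun_prop) _ _) hei]
    exact intervalIntegral.integral_congr fun x _ => h1 x
  have hie : |∫ x in a..b, e x| ≤ M * (b - a) * (b - a) := by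
    have := intervalIntegral.norm_integral_le_of_norm_le_const (a := a) (b := b) (f := e)
      (C := M * (b - a)) (fun x hx => by
        rw [Set.uIoc_of_le hab] at hx
        exact heb x ⟨hx.1.le, hx.2⟩)
    rwa [abs_of_nonneg (by linarith : 0 ≤ b - a)] at this
  have hfin : (b - a) * ((h a + h b) / 2) - ∫ x in a..b, h x =
      (b - a) * e b / 2 - ∫ x in a..b, e x := by
    rw [hint]
    simp only [he]
    ring
  rw [hfin]
  refine (abs_sub _ _).trans ?_
  have h3 : |(b - a) * e b / 2| ≤ (b - a) * (M * (b - a)) := by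
    rw [abs_div, abs_mul, abs_of_nonneg (by linarith : 0 ≤ b - a), abs_two]
    refine (div_le_self (by positivity) one_le_two).trans ?_
    exact mul_le_mul_of_nonneg_left (heb b hb) (by linarith)
  calc _ ≤ (b - a) * (M * (b - a)) + M * (b - a) * (b - a) := add_le_add h3 hie
    _ = _ := by ring

lemma abs_rectangle_sub_le {a b M : ℝ} (hab : a ≤ b) {f : ℝ → ℝ}
    (hfi : IntervalIntegrable f volume a b) (hf : ∀ x ∈ Set.Icc a b, |f x - f b| ≤ M) :
    |(b - a) * f b - ∫ x in a..b, f x| ≤ M * (b - a) := by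
  have h1 : (b - a) * f b - ∫ x in a..b, f x = -∫ x in a..b, (f x - f b) := by
    rw [intervalIntegral.integral_sub hfi (by simp)]
    simp
  rw [h1, abs_neg]
  have := intervalIntegral.norm_integral_le_of_norm_le_const (a := a) (b := b)
    (f := fun x => f x - f b) (C := M) (fun x hx => by
      rw [Set.uIoc_of_le hab] at hx
      exact hf x ⟨hx.1.le, hx.2⟩)
  rwa [abs_of_nonneg (by linarith : 0 ≤ b - a)] at this

/-- Riemann sums with the first correction, for integrands with a power singularity at `0`. -/
theorem abs_sum_sub_integral_le {β C : ℝ} (hβ : 0 < β) {h f g : ℝ → ℝ}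
    (hh : ∀ x ∈ Set.Icc (0 : ℝ) 1, |h x| ≤ C * x ^ β) (hhc : ContinuousOn h (Set.Icc 0 1))
    (hd : ∀ x ∈ Set.Ioc (0 : ℝ) 1, HasDerivAt h (f x) x) (hf : PowerLip (β - 1) f C)
    (hg : PowerLip (β - 1) g C) (hgi : IntervalIntegrable g volume 0 1) {n : ℕ} (hn : 0 < n) :
    |∑ k ∈ Finset.range n, (h ((k + 1) / n) + g ((k + 1) / n) / n) -
        (n * (∫ x in (0 : ℝ)..1, h x) + (∫ x in (0 : ℝ)..1, g x) + h 1 / 2)| ≤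
      C * (6 + 1 / β) * ∑ k ∈ Finset.range n, ((k + 1) / n : ℝ) ^ β / (k + 1) ^ 2 := by
  have hn0 : (0 : ℝ) < n := by exact_mod_cast hn
  have hC := hf.nonneg
  set a : ℕ → ℝ := fun k => k / n with ha
  have hak : ∀ k : ℕ, a (k + 1) = (k + 1) / n := fun k => by simp [ha]
  have ha0 : a 0 = 0 := by simp [ha]
  have han : a n = 1 := by simp [ha, hn0.ne']
  have hasub : ∀ k, a (k + 1) - a k = 1 / n := fun k => by
    simp only [ha]
    push_cast
    ring
  have hamem : ∀ k ≤ n, a k ∈ Set.Icc (0 : ℝ) 1 := fun k hk =>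
    ⟨by positivity, (div_le_one hn0).2 (by exact_mod_cast hk)⟩
  have hale : ∀ k, a k ≤ a (k + 1) := fun k => by
    have := hasub k
    have : 0 < 1 / (n : ℝ) := by positivity
    linarith
  have hsubset : ∀ k < n, Set.uIcc (a k) (a (k + 1)) ⊆ Set.Icc 0 1 := fun k hk => by
    rw [Set.uIcc_of_le (hale k)]
    exact Set.Icc_subset_Icc (hamem k hk.le).1 (hamem (k + 1) hk).2
  have hhi : ∀ k < n, IntervalIntegrable h volume (a k) (a (k + 1)) := fun k hk =>
    (hhc.mono (hsubset k hk)).intervalIntegrable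
  have hgi' : ∀ k < n, IntervalIntegrable g volume (a k) (a (k + 1)) := fun k hk =>
    hgi.mono_set (by rw [Set.uIcc_of_le zero_le_one]; exact hsubset k hk)
  have hH := intervalIntegral.sum_integral_adjacent_intervals hhi
  have hK := intervalIntegral.sum_integral_adjacent_intervals hgi'
  -- Distributing the boundary term `h 1 / 2` over the cells as half-increments turns the
  -- right-endpoint sum into a trapezoidal sum.
  have hT := Finset.sum_range_sub (fun k => h (a k)) n
  have hh0 : h 0 = 0 := by
    have := hh 0 ⟨le_rfl, zero_le_one⟩
    rw [Real.zero_rpow hβ.ne', mul_zero] at this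
    exact abs_eq_zero.1 (le_antisymm this (abs_nonneg _))
  rw [ha0, han] at hH hK hT
  rw [hh0, sub_zero] at hT
  rw [← hH, ← hK, ← hT, Finset.mul_sum, Finset.sum_div, ← Finset.sum_add_distrib,
    ← Finset.sum_add_distrib, ← Finset.sum_sub_distrib, Finset.mul_sum]
  refine (Finset.abs_sum_le_sum_abs _ _).trans (Finset.sum_le_sum fun k hk => ?_)
  have hkn := Finset.mem_range.1 hk
  have hbmem := hamem (k + 1) hkn
  rw [← hak k]
  have hsplit : h (a (k + 1)) + g (a (k + 1)) / n - (n * (∫ x in a k..a (k + 1), h x)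
      + (∫ x in a k..a (k + 1), g x) + (h (a (k + 1)) - h (a k)) / 2) =
      n * ((a (k + 1) - a k) * ((h (a k) + h (a (k + 1))) / 2) - ∫ x in a k..a (k + 1), h x)
        + ((a (k + 1) - a k) * g (a (k + 1)) - ∫ x in a k..a (k + 1), g x) := by
    rw [hasub]
    field_simp
    ring
  have hb0 : 0 < a (k + 1) := by
    rw [hak]
    positivity
  have hbn : a (k + 1) * n = k + 1 := by
    rw [hak]
    field_simp
  have hab := hale k
  have hsubk := hasub k
  have hhck := hsubset k hkn
  have hgik := hgi' k hkn
  rw [Set.uIcc_of_le hab] at hhck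
  have hbIoc : a (k + 1) ∈ Set.Ioc (0 : ℝ) 1 := ⟨hb0, hbmem.2⟩
  rw [hsplit]
  refine (abs_add_le _ _).trans ?_
  rw [abs_mul, abs_of_pos hn0]
  -- The first cell touches the singularity: there is no cancellation, and each of the four
  -- contributions is bounded separately by a multiple of `b^β`. Every later cell lies in `[b/2,
  -- b]`, where the Lipschitz bounds apply.
  rcases Nat.eq_zero_or_pos k with rfl | hk0
  · set b := a (0 + 1) with hb
    rw [ha0] at hab hhck hsubk hgik ⊢
    rw [sub_zero] at hsubk ⊢
    have hnb : (n : ℝ) = 1 / b := by rw [hsubk]; field_simp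
    have hbβ : 0 < b ^ β := by positivity
    have p1 : |h b| ≤ C * b ^ β := hh b hbmem
    have p2 : |∫ x in (0 : ℝ)..b, h x| ≤ C * b ^ β * b := by
      have := intervalIntegral.norm_integral_le_of_norm_le_const (a := 0) (b := b) (f := h)
        (C := C * b ^ β) (fun x hx => by
          rw [Set.uIoc_of_le hab] at hx
          refine (hh x ⟨hx.1.le, hx.2.trans hbmem.2⟩).trans ?_
          have := hx.1.le
          gcongr
          exact hx.2)
      rwa [sub_zero, abs_of_pos hb0] at this
    have p3 : |g b| ≤ C * b ^ (β - 1) := hg.1 b hbIoc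
    have p4 : |∫ x in (0 : ℝ)..b, g x| ≤ C * (b ^ β / β) := by
      have := intervalIntegral.norm_integral_le_of_norm_le (a := 0) (b := b) (f := g)
        (g := fun x => C * x ^ (β - 1)) hab (Eventually.of_forall fun x hx =>
          hg.1 x ⟨hx.1, hx.2.trans hbmem.2⟩)
        ((intervalIntegral.intervalIntegrable_rpow' (by linarith)).const_mul _)
      rwa [intervalIntegral.integral_const_mul, integral_rpow (Or.inl (by linarith)),
        sub_add_cancel, Real.zero_rpow hβ.ne', sub_zero] at this
    have q1 : (n : ℝ) * |b * ((h 0 + h b) / 2) - ∫ x in (0 : ℝ)..b, h x| ≤ 2 * (C * b ^ β) := by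
      rw [hh0, zero_add]
      have : |b * (h b / 2) - ∫ x in (0 : ℝ)..b, h x| ≤ b * (C * b ^ β) + C * b ^ β * b := by
        refine (abs_sub _ _).trans (add_le_add ?_ p2)
        rw [abs_mul, abs_of_pos hb0, abs_div, abs_two]
        gcongr
        exact (div_le_self (abs_nonneg _) one_le_two).trans p1
      calc (n : ℝ) * |b * (h b / 2) - ∫ x in (0 : ℝ)..b, h x|
          ≤ n * (b * (C * b ^ β) + C * b ^ β * b) := by gcongr
        _ = _ := by
          rw [hnb]
          field_simp
          ring
    have q2 : |b * g b - ∫ x in (0 : ℝ)..b, g x| ≤ C * b ^ β + C * (b ^ β / β) := by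
      refine (abs_sub _ _).trans (add_le_add ?_ p4)
      rw [abs_mul, abs_of_pos hb0]
      calc b * |g b| ≤ b * (C * b ^ (β - 1)) := by gcongr
        _ = C * b ^ β := by
          rw [Real.rpow_sub_one hb0.ne']
          field_simp
    have : 0 ≤ C * b ^ β := by positivity
    calc _ ≤ 2 * (C * b ^ β) + (C * b ^ β + C * (b ^ β / β)) := add_le_add q1 q2
      _ = C * b ^ β * (3 + 1 / β) := by ring
      _ ≤ C * b ^ β * (6 + 1 / β) := by
        gcongr
        norm_num
      _ = _ := by
        simp
        ring
  · have hkR : (1 : ℝ) ≤ k := by exact_mod_cast hk0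
    have hhalf : a (k + 1) / 2 ≤ a k := by
      rw [hak]
      simp only [ha]
      rw [div_div, div_le_div_iff₀ (by positivity) hn0]
      nlinarith
    set A := a k with hA
    set b := a (k + 1) with hb
    have hAm : A ∈ Set.Icc (b / 2) b := ⟨hhalf, hab⟩
    have hbm : b ∈ Set.Icc (b / 2) b := ⟨by linarith, le_rfl⟩
    have hsub : ∀ x ∈ Set.Icc A b, x ∈ Set.Icc (b / 2) b := fun x hx => ⟨hhalf.trans hx.1, hx.2⟩
    have hpow : 0 < b ^ (β - 1 - 1) := by positivity
    have hdist : ∀ x ∈ Set.Icc A b, ∀ y ∈ Set.Icc A b, |x - y| ≤ 1 / n := fun x hx y hy => by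
      rw [abs_le]
      constructor <;> linarith [hx.1, hx.2, hy.1, hy.2]
    have r1 := abs_trapezoid_sub_le (M := C * b ^ (β - 1 - 1) * (1 / n)) hab
      (fun x hx => hd x ⟨by linarith [(hsub x hx).1], (hsub x hx).2.trans hbmem.2⟩)
      (fun x hx => (hf.2 b hbIoc x (hsub x hx) A hAm).trans (by
        have := hdist x hx A ⟨le_rfl, hab⟩
        gcongr))
    have r2 := abs_rectangle_sub_le (M := C * b ^ (β - 1 - 1) * (1 / n)) hab hgik
      (fun x hx => (hg.2 b hbIoc x (hsub x hx) b hbm).trans (by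
        have := hdist x hx b ⟨hab, le_rfl⟩
        gcongr))
    rw [hsubk] at r1 r2 ⊢
    have hfin : b ^ (β - 1 - 1) / n ^ 2 = b ^ β / (k + 1) ^ 2 := by
      rw [← hbn, Real.rpow_sub_one hb0.ne', Real.rpow_sub_one hb0.ne']
      field_simp
    have hpos : 0 ≤ b ^ β / ((k : ℝ) + 1) ^ 2 := by positivity
    calc _ ≤ (n : ℝ) * (2 * (C * b ^ (β - 1 - 1) * (1 / n)) * (1 / n) ^ 2)
          + C * b ^ (β - 1 - 1) * (1 / n) * (1 / n) := by gcongr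
      _ = C * 3 * (b ^ (β - 1 - 1) / n ^ 2) := by
        field_simp
        ring
      _ ≤ C * (6 + 1 / β) * (b ^ β / (k + 1) ^ 2) := by
        rw [hfin]
        gcongr
        have : 0 < 1 / β := by positivity
        linarith

/-! ### The error rate -/

lemma errorExponent_le_one {α : ℝ} (hα : 0 < α) : (2 * min α 1 + α) / (2 + α) ≤ 1 := by
  rw [div_le_one (by positivity)]
  linarith [min_le_right α 1]

lemma inv_le_errorRate {α : ℝ} (hα : 0 < α) {n : ℕ} (hn : 0 < n) : 1 / (n : ℝ) ≤ errorRate α n := by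
  have hn1 : (1 : ℝ) ≤ n := by exact_mod_cast hn
  rw [errorRate, one_div, ← Real.rpow_neg_one]
  exact Real.rpow_le_rpow_of_exponent_le hn1 (neg_le_neg (errorExponent_le_one hα))

/-- For `α ≥ 1` each term is at most `1/n²`. For `α < 1` the exponent `ρ = 3α/(2+α)` satisfies `ρ ≤
2α`, so `x^(2α) ≤ x^ρ`, and `ρ < 1`, so the resulting series `∑ j^(ρ-2)` converges. -/
lemma sum_rpow_div_sq_le_errorRate {α : ℝ} (hα : 0 < α) :
    ∃ C : ℝ, 0 ≤ C ∧ ∀ n : ℕ, 0 < n →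
      ∑ k ∈ Finset.range n, ((k + 1) / n : ℝ) ^ (2 * α) / (k + 1) ^ 2 ≤ C * errorRate α n := by
  have hbase : ∀ n : ℕ, 0 < n → ∀ k ∈ Finset.range n, (0 : ℝ) < (k + 1) / n ∧
      ((k : ℝ) + 1) / n ≤ 1 := by
    intro n hn k hk
    have hn0 : (0 : ℝ) < n := by exact_mod_cast hn
    refine ⟨by positivity, (div_le_one hn0).2 ?_⟩
    exact_mod_cast Finset.mem_range.1 hk
  rcases le_total 1 α with h | h
  · refine ⟨1, zero_le_one, fun n hn => ?_⟩
    have hn0 : (0 : ℝ) < n := by exact_mod_cast hn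
    calc ∑ k ∈ Finset.range n, ((k + 1) / n : ℝ) ^ (2 * α) / (k + 1) ^ 2
        ≤ ∑ k ∈ Finset.range n, 1 / (n : ℝ) ^ 2 := by
          refine Finset.sum_le_sum fun k hk => ?_
          obtain ⟨h1, h2⟩ := hbase n hn k hk
          have h3 : ((k + 1) / n : ℝ) ^ (2 * α) ≤ ((k + 1) / n : ℝ) ^ 2 := by
            rw [← Real.rpow_natCast]
            exact Real.rpow_le_rpow_of_exponent_ge h1 h2 (by push_cast; linarith)
          calc _ ≤ ((k + 1) / n : ℝ) ^ 2 / (k + 1) ^ 2 := by gcongr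
            _ = _ := by
              field_simp
      _ = 1 / (n : ℝ) := by
        rw [Finset.sum_const, Finset.card_range, nsmul_eq_mul]
        field_simp
      _ ≤ _ := by
        rw [one_mul]
        exact inv_le_errorRate hα hn
  · set ρ : ℝ := (2 * min α 1 + α) / (2 + α) with hρ
    rw [min_eq_left h] at hρ
    -- The value `α = 1` also falls in this branch; there `ρ = 1` and the series would diverge, but
    -- the terms equal `1/n²`.
    rcases h.eq_or_lt with h1 | h1
    · subst h1
      refine ⟨1, zero_le_one, fun n hn => ?_⟩
      have hn0 : (0 : ℝ) < n := by exact_mod_cast hn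
      rw [one_mul]
      refine le_trans (le_of_eq ?_) (inv_le_errorRate one_pos hn)
      have : ∀ k : ℕ, ((k + 1) / n : ℝ) ^ (2 * (1 : ℝ)) / (k + 1) ^ 2 = 1 / (n : ℝ) ^ 2 := by
        intro k
        rw [mul_one, Real.rpow_two]
        field_simp
      simp only [this, Finset.sum_const, Finset.card_range, nsmul_eq_mul]
      field_simp
    have hρ1 : ρ < 1 := by
      rw [hρ, div_lt_one (by positivity)]
      linarith
    have hρ2 : ρ ≤ 2 * α := by
      rw [hρ, div_le_iff₀ (by positivity)]
      nlinarith
    have hs : Summable fun k : ℕ => (((k + 1 : ℕ) : ℝ)) ^ (ρ - 2) :=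
      (summable_nat_add_iff (f := fun k : ℕ => (k : ℝ) ^ (ρ - 2)) 1).2
        (Real.summable_nat_rpow.2 (by linarith))
    refine ⟨∑' k : ℕ, (((k + 1 : ℕ) : ℝ)) ^ (ρ - 2), tsum_nonneg fun k => by positivity, ?_⟩
    intro n hn
    have hn0 : (0 : ℝ) < n := by exact_mod_cast hn
    have hrate : errorRate α n = (n : ℝ) ^ (-ρ) := by rw [errorRate, min_eq_left h, ← hρ]
    rw [hrate]
    calc _ ≤ ∑ k ∈ Finset.range n, (((k + 1 : ℕ) : ℝ)) ^ (ρ - 2) * (n : ℝ) ^ (-ρ) := by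
          refine Finset.sum_le_sum fun k hk => ?_
          obtain ⟨h1, h2⟩ := hbase n hn k hk
          have h3 : ((k + 1) / n : ℝ) ^ (2 * α) ≤ ((k + 1) / n : ℝ) ^ ρ :=
            Real.rpow_le_rpow_of_exponent_ge h1 h2 hρ2
          calc _ ≤ ((k + 1) / n : ℝ) ^ ρ / (k + 1) ^ 2 := by gcongr
            _ = _ := by
              push_cast
              rw [Real.div_rpow (by positivity) hn0.le, Real.rpow_sub (by positivity),
                Real.rpow_neg hn0.le, Real.rpow_two]
              field_simp
      _ = (∑ k ∈ Finset.range n, (((k + 1 : ℕ) : ℝ)) ^ (ρ - 2)) * (n : ℝ) ^ (-ρ) := by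
          rw [Finset.sum_mul]
      _ ≤ _ := by
          gcongr
          exact hs.sum_le_tsum _ fun k _ => by positivity

/-! ### The limiting profiles -/

/-- The vector of limiting probabilities `Q(α, t_ℓ x)`. -/
noncomputable def qVec {m : ℕ} (α : ℝ) (t : Fin m → ℝ) (x : ℝ) : Fin m → ℝ :=
  fun ℓ => Q α (t ℓ * x)

/-- The vector of first-order corrections. -/
noncomputable def corrVec {m : ℕ} (α : ℝ) (t : Fin m → ℝ) (x : ℝ) : Fin m → ℝ :=
  fun ℓ => corr α (t ℓ) x

/-- The derivative of `qVec`. -/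
noncomputable def qVecDeriv {m : ℕ} (α : ℝ) (t : Fin m → ℝ) (x : ℝ) : Fin m → ℝ :=
  fun ℓ => x ^ (α - 1) * (-(t ℓ ^ α / Real.Gamma α) * Real.exp (-(t ℓ * x)))

/-- The success probabilities of the independent moduli. -/
noncomputable def pVec {m : ℕ} (α : ℝ) (t : Fin m → ℝ) (n k : ℕ) : Fin m → ℝ :=
  fun ℓ => 1 - betaTail α k (t ℓ / n)

lemma betaTail_mem_Icc {α t : ℝ} (hα : 0 < α) (ht : 0 ≤ t) {n : ℕ} (hn : t ≤ n) (k : ℕ) :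
    1 - betaTail α k (t / n) ∈ Set.Icc (0 : ℝ) 1 := by
  have := isProbabilityMeasure_radialLaw hα k
  rw [← integral_diskInd_radius hα k ht hn]
  refine ⟨integral_nonneg fun w => diskInd_nonneg _ _, ?_⟩
  calc _ ≤ ∫ w, (1 : ℝ) ∂(radialLaw α k) :=
        integral_mono (integrable_diskInd hα k _) (integrable_const _)
          fun w => diskInd_le_one _ _
    _ = 1 := by simp

section

variable {m : ℕ} {α : ℝ} {t : Fin m → ℝ}

lemma qVec_mem_Icc (hα : 0 < α) (ht : ∀ ℓ, 0 ≤ t ℓ) {x : ℝ} (hx : 0 ≤ x) :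
    qVec α t x ∈ Set.Icc (0 : Fin m → ℝ) 1 :=
  ⟨fun ℓ => (Q_pos hα (mul_nonneg (ht ℓ) hx)).le, fun ℓ => Q_le_one hα (mul_nonneg (ht ℓ) hx)⟩

lemma pVec_mem_Icc (hα : 0 < α) (ht : ∀ ℓ, 0 ≤ t ℓ) {n : ℕ} (hn : ∀ ℓ, t ℓ ≤ n) (k : ℕ) :
    pVec α t n k ∈ Set.Icc (0 : Fin m → ℝ) 1 :=
  ⟨fun ℓ => (betaTail_mem_Icc hα (ht ℓ) (hn ℓ) k).1,
    fun ℓ => (betaTail_mem_Icc hα (ht ℓ) (hn ℓ) k).2⟩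

lemma continuousOn_qVec (hα : 0 < α) (ht : ∀ ℓ, 0 ≤ t ℓ) :
    ContinuousOn (qVec α t) (Set.Ici 0) :=
  continuousOn_pi.2 fun ℓ => continuousOn_Q_mul hα (ht ℓ)

lemma qVec_zero (hα : 0 < α) : qVec α t 0 = 1 := by
  ext ℓ
  simp [qVec, Q_zero hα]

lemma hasDerivAt_qVec (hα : 0 < α) (ht : ∀ ℓ, 0 ≤ t ℓ) {x : ℝ} (hx : 0 < x) :
    HasDerivAt (qVec α t) (qVecDeriv α t x) x := by
  refine hasDerivAt_pi.2 fun ℓ => (hasDerivAt_Q_mul hα (ht ℓ) hx).congr_deriv ?_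
  simp only [qVecDeriv]
  ring

lemma powerLip_qVecDeriv : ∃ C, PowerLip (α - 1) (qVecDeriv α t) C :=
  powerLip_pi fun ℓ => powerLip_rpow_mul (α - 1)
    (g := fun x => -(t ℓ ^ α / Real.Gamma α) * Real.exp (-(t ℓ * x))) (by fun_prop)

lemma powerLip_corrVec : ∃ C, PowerLip (α - 1) (corrVec α t) C := by
  refine powerLip_pi fun ℓ => ?_
  obtain ⟨C, hC⟩ := powerLip_rpow_mul (α - 1)
    (g := fun x => t ℓ ^ α * Real.exp (-(t ℓ * x)) * ((1 - α - t ℓ * x) / 2) / Real.Gamma α)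
    (by fun_prop)
  refine ⟨C, ?_⟩
  convert hC using 2 with x
  simp only [corrVec, corr]
  ring

lemma continuousOn_corrVec : ContinuousOn (corrVec α t) (Set.Ioc 0 1) := by
  refine continuousOn_pi.2 fun ℓ => ?_
  unfold corrVec corr
  refine ContinuousOn.mul (ContinuousOn.div_const ?_ _) (by fun_prop)
  exact continuousOn_id.rpow_const fun x hx => Or.inl hx.1.ne'

lemma powerLip_one_sub_qVec (hα : 0 < α) (ht : ∀ ℓ, 0 ≤ t ℓ) :
    ∃ C, PowerLip α (fun x => 1 - qVec α t x) C := by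
  have hG := Real.Gamma_pos_of_pos hα
  refine powerLip_pi fun ℓ => ⟨_, powerLip_of_hasDerivAt (C := 1 / Real.Gamma α * (t ℓ ^ α / α))
    (D := t ℓ ^ α / Real.Gamma α)
    (A' := fun x => x ^ (α - 1) / Real.Gamma α * (t ℓ ^ α * Real.exp (-(t ℓ * x)))) ?_ ?_ ?_ ?_ ?_⟩
  · have := Real.rpow_nonneg (ht ℓ) α
    positivity
  · have := Real.rpow_nonneg (ht ℓ) α
    positivity
  · intro x hx
    have hx0 := hx.1
    have hI : |∫ s in (0 : ℝ)..t ℓ, s ^ (α - 1) * Real.exp (-(s * x))| ≤ t ℓ ^ α / α := by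
      have h := intervalIntegral.norm_integral_le_of_norm_le (a := 0) (b := t ℓ)
        (f := fun s => s ^ (α - 1) * Real.exp (-(s * x))) (g := fun s => s ^ (α - 1)) (ht ℓ)
        (Eventually.of_forall fun s hs => ?_)
        (intervalIntegral.intervalIntegrable_rpow' (by linarith))
      · rwa [integral_rpow (Or.inl (by linarith)), sub_add_cancel, Real.zero_rpow hα.ne',
          sub_zero] at h
      · have hs0 := hs.1
        rw [norm_mul, Real.norm_of_nonneg (by positivity), Real.norm_of_nonneg (by positivity)]
        refine mul_le_of_le_one_right (by positivity) (Real.exp_le_one_iff.2 ?_)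
        have : 0 ≤ s * x := by positivity
        linarith
    simp only [qVec, Pi.sub_apply, Pi.one_apply]
    rw [one_sub_Q_mul hα (ht ℓ) hx0.le, abs_mul, abs_of_nonneg (by positivity)]
    calc _ ≤ x ^ α / Real.Gamma α * (t ℓ ^ α / α) := by gcongr
      _ = _ := by ring
  · intro x hx
    exact ((hasDerivAt_Q_mul hα (ht ℓ) hx.1).const_sub 1).congr_deriv (neg_neg _)
  · intro x hx
    have hx0 := hx.1
    have htα := Real.rpow_nonneg (ht ℓ) α
    have he : Real.exp (-(t ℓ * x)) ≤ 1 := Real.exp_le_one_iff.2 (by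
      have := mul_nonneg (ht ℓ) hx0.le
      linarith)
    rw [abs_of_nonneg (by positivity)]
    calc _ ≤ x ^ (α - 1) / Real.Gamma α * (t ℓ ^ α * 1) := by gcongr
      _ = _ := by ring

lemma exists_norm_pVec_sub_le (hα : 0 < α) (ht : ∀ ℓ, 0 ≤ t ℓ) :
    ∃ C : ℝ, 0 ≤ C ∧ ∀ n k : ℕ, (∀ ℓ, 2 * t ℓ ≤ n) → k < n →
      ‖pVec α t n k - qVec α t ((k + 1) / n) - (n : ℝ)⁻¹ • corrVec α t ((k + 1) / n)‖ ≤
        C * ((k + 1) / n : ℝ) ^ α / (k + 1) ^ 2 := by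
  choose C hC0 hC using fun ℓ => abs_betaTail_sub_le hα (ht ℓ)
  have hle : ∀ ℓ, C ℓ ≤ ∑ i, C i := fun ℓ =>
    Finset.single_le_sum (fun i _ => hC0 i) (Finset.mem_univ ℓ)
  have h0 : 0 ≤ ∑ i, C i := Finset.sum_nonneg fun i _ => hC0 i
  refine ⟨∑ i, C i, h0, fun n k hn hk => (pi_norm_le_iff_of_nonneg (by positivity)).2 fun ℓ => ?_⟩
  refine le_trans (le_of_eq ?_) ((hC ℓ n k (hn ℓ) hk).trans ?_)
  · simp only [pVec, qVec, corrVec, Pi.sub_apply, Pi.smul_apply, smul_eq_mul, Real.norm_eq_abs]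
    congr 1
    ring
  · gcongr
    exact hle ℓ

end

/-! ### Sums of smooth functions of the success probabilities -/

lemma norm_sub_sub_fderiv_le {E : Type*} [NormedAddCommGroup E] [NormedSpace ℝ E] {R : E → ℝ}
    (hR : Differentiable ℝ R) {s : Set E} (hs : Convex ℝ s) {L : ℝ} (hL : 0 ≤ L)
    (hLip : ∀ p ∈ s, ∀ p' ∈ s, ‖fderiv ℝ R p - fderiv ℝ R p'‖ ≤ L * ‖p - p'‖)
    {p q : E} (hp : p ∈ s) (hq : q ∈ s) :
    |R p - R q - fderiv ℝ R q (p - q)| ≤ L * ‖p - q‖ ^ 2 := by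
  -- Intersecting with the ball of radius `‖p - q‖` bounds the variation of the derivative by `L ‖p
  -- - q‖`; this yields the quadratic estimate.
  have h := (hs.inter (convex_closedBall q ‖p - q‖)).norm_image_sub_le_of_norm_fderiv_le'
    (f := R) (φ := fderiv ℝ R q) (C := L * ‖p - q‖) (x := q) (y := p) (fun z _ => hR z)
    (fun z hz => (hLip z hz.1 q hq).trans (by
      have := hz.2
      rw [mem_closedBall_iff_norm] at this
      gcongr)) ⟨hq, by simp⟩ ⟨hp, by simp [dist_eq_norm]⟩
  rw [Real.norm_eq_abs] at h
  calc _ ≤ L * ‖p - q‖ * ‖p - q‖ := h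
    _ = _ := by ring

lemma exists_lipschitz_fderiv {m : ℕ} {R : (Fin m → ℝ) → ℝ} (hR : ContDiff ℝ 2 R) :
    ∃ L : ℝ, 0 ≤ L ∧ ∀ p ∈ Set.Icc (0 : Fin m → ℝ) 1, ∀ p' ∈ Set.Icc (0 : Fin m → ℝ) 1,
      ‖fderiv ℝ R p - fderiv ℝ R p'‖ ≤ L * ‖p - p'‖ := by
  have h1 : ContDiff ℝ 1 (fderiv ℝ R) := hR.fderiv_right (m := 1) (by norm_num)
  obtain ⟨K, hK⟩ := (h1.locallyLipschitz.locallyLipschitzOn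
    (s := Set.Icc (0 : Fin m → ℝ) 1)).exists_lipschitzOnWith_of_compact isCompact_Icc
  refine ⟨K, K.2, fun p hp p' hp' => ?_⟩
  have := hK.dist_le_mul p hp p' hp'
  rwa [dist_eq_norm, dist_eq_norm] at this

section

variable {m : ℕ} {α : ℝ} {t : Fin m → ℝ}

/-- Since the derivative vanishes at `(1, …, 1)` and is Lipschitz on the cube, it inherits the
bounds of `1 - q(x)`. This is the extra factor `x^α` gained by removing the tangent map. -/
lemma powerLip_fderiv_qVec (hα : 0 < α) (ht : ∀ ℓ, 0 ≤ t ℓ) {R : (Fin m → ℝ) → ℝ}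
    (hR : ContDiff ℝ 2 R) (h1 : fderiv ℝ R 1 = 0) :
    ∃ C, PowerLip α (fun x => fderiv ℝ R (qVec α t x)) C := by
  obtain ⟨L, hL0, hL⟩ := exists_lipschitz_fderiv hR
  obtain ⟨C, hC⟩ := powerLip_one_sub_qVec hα ht
  have hone : (1 : Fin m → ℝ) ∈ Set.Icc (0 : Fin m → ℝ) 1 := ⟨zero_le_one, le_rfl⟩
  refine ⟨L * C, fun x hx => ?_, fun b hb x hx y hy => ?_⟩
  · have h := hL _ (qVec_mem_Icc hα ht hx.1.le) 1 hone
    rw [h1, sub_zero, norm_sub_rev] at h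
    calc _ ≤ L * ‖1 - qVec α t x‖ := h
      _ ≤ L * (C * x ^ α) := mul_le_mul_of_nonneg_left (hC.1 x hx) hL0
      _ = _ := by ring
  · have hx0 : 0 ≤ x := by linarith [hx.1, hb.1]
    have hy0 : 0 ≤ y := by linarith [hy.1, hb.1]
    have h := hL _ (qVec_mem_Icc hα ht hx0) _ (qVec_mem_Icc hα ht hy0)
    have h2 := hC.2 b hb x hx y hy
    rw [sub_sub_sub_cancel_left, norm_sub_rev] at h2
    calc _ ≤ L * ‖qVec α t x - qVec α t y‖ := h
      _ ≤ L * (C * b ^ (α - 1) * |x - y|) := mul_le_mul_of_nonneg_left h2 hL0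
      _ = _ := by ring

lemma continuousOn_fderiv_corrVec (hα : 0 < α) (ht : ∀ ℓ, 0 ≤ t ℓ) {R : (Fin m → ℝ) → ℝ}
    (hR : ContDiff ℝ 2 R) :
    ContinuousOn (fun x => fderiv ℝ R (qVec α t x) (corrVec α t x)) (Set.Ioc 0 1) := by
  have h1 : Continuous (fderiv ℝ R) := hR.continuous_fderiv two_ne_zero
  exact (h1.comp_continuousOn ((continuousOn_qVec hα ht).mono fun x hx => hx.1.le)).clm_apply
    continuousOn_corrVec

lemma intervalIntegrable_of_powerLip {γ C : ℝ} (hγ : -1 < γ) {A : ℝ → ℝ} (hA : PowerLip γ A C)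
    (hc : ContinuousOn A (Set.Ioc 0 1)) : IntervalIntegrable A volume 0 1 := by
  refine ((intervalIntegral.intervalIntegrable_rpow' hγ (a := 0) (b := 1)).const_mul C).mono_fun'
    ?_ ?_
  · rw [Set.uIoc_of_le zero_le_one]
    exact hc.aestronglyMeasurable measurableSet_Ioc
  · rw [Set.uIoc_of_le zero_le_one]
    filter_upwards [ae_restrict_mem measurableSet_Ioc] with x hx using hA.1 x hx

/-- The expansion for functions vanishing to second order at `(1, …, 1)`. -/
theorem exists_abs_sum_comp_pVec_sub_le (hα : 0 < α) (ht : ∀ ℓ, 0 ≤ t ℓ) {R : (Fin m → ℝ) → ℝ}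
    (hR : ContDiff ℝ 2 R) (hR1 : R 1 = 0) (hdR1 : fderiv ℝ R 1 = 0) :
    ∃ C : ℝ, 0 ≤ C ∧ ∀ n : ℕ, 0 < n → (∀ ℓ, 2 * t ℓ ≤ n) →
      |∑ k ∈ Finset.range n, R (pVec α t n k) - (n * (∫ x in (0 : ℝ)..1, R (qVec α t x))
        + (∫ x in (0 : ℝ)..1, fderiv ℝ R (qVec α t x) (corrVec α t x)) + R (qVec α t 1) / 2)| ≤
      C * ∑ k ∈ Finset.range n, ((k + 1) / n : ℝ) ^ (2 * α) / (k + 1) ^ 2 := by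
  obtain ⟨L, hL0, hL⟩ := exists_lipschitz_fderiv hR
  obtain ⟨C₁, hC₁⟩ := powerLip_one_sub_qVec hα ht
  obtain ⟨C₂, hC₂⟩ := powerLip_qVecDeriv (α := α) (t := t)
  obtain ⟨C₃, hC₃⟩ := powerLip_corrVec (α := α) (t := t)
  obtain ⟨C₄, hC₄⟩ := powerLip_fderiv_qVec hα ht hR hdR1
  obtain ⟨C₅, hC₅0, hC₅⟩ := exists_norm_pVec_sub_le hα ht
  have hRd : Differentiable ℝ R := hR.differentiable two_ne_zero
  -- Both the derivative of `R(q(x))` and the correction term have exponent `2α - 1`, so the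
  -- quadrature theorem applies with `β = 2α`.
  have hf := hC₂.pairing hC₄
  have hg := hC₃.pairing hC₄
  set D₁ := C₂ * C₄ * (1 + 2 ^ |α - 1| + 2 ^ |α|) with hD₁
  set D₂ := C₃ * C₄ * (1 + 2 ^ |α - 1| + 2 ^ |α|) with hD₂
  rw [show α - 1 + α = 2 * α - 1 by ring] at hf hg
  have hone : (1 : Fin m → ℝ) ∈ Set.Icc (0 : Fin m → ℝ) 1 := ⟨zero_le_one, le_rfl⟩
  have hconv := convex_Icc (𝕜 := ℝ) (0 : Fin m → ℝ) 1
  set D := L * C₁ ^ 2 + D₁ + D₂ with hD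
  have h1 := hf.nonneg
  have h2 := hg.nonneg
  have h3 : 0 ≤ L * C₁ ^ 2 := by positivity
  have hh : ∀ x ∈ Set.Icc (0 : ℝ) 1, |R (qVec α t x)| ≤ D * x ^ (2 * α) := by
    intro x hx
    rcases hx.1.eq_or_lt with rfl | hx0
    · rw [qVec_zero hα, hR1, abs_zero]
      positivity
    have h := norm_sub_sub_fderiv_le hRd hconv hL0 hL (qVec_mem_Icc hα ht hx.1) hone
    rw [hdR1, hR1, sub_zero, _root_.zero_apply, sub_zero, norm_sub_rev] at h
    have hq := hC₁.1 x ⟨hx0, hx.2⟩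
    calc _ ≤ L * ‖1 - qVec α t x‖ ^ 2 := h
      _ ≤ L * (C₁ * x ^ α) ^ 2 := by gcongr
      _ = L * C₁ ^ 2 * x ^ (2 * α) := by
        rw [mul_comm 2 α, Real.rpow_mul hx0.le, Real.rpow_two]
        ring
      _ ≤ _ := by
        gcongr
        linarith
  have hgi : IntervalIntegrable (fun x => fderiv ℝ R (qVec α t x) (corrVec α t x)) volume 0 1 :=
    intervalIntegrable_of_powerLip (by linarith) hg (continuousOn_fderiv_corrVec hα ht hR)
  refine ⟨D * (6 + 1 / (2 * α)) + (L * (C₃ + C₅) ^ 2 + C₄ * C₅), ?_, ?_⟩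
  · have := hC₄.nonneg
    positivity
  intro n hn htn
  have hn0 : (0 : ℝ) < n := by exact_mod_cast hn
  have hmain := abs_sum_sub_integral_le (β := 2 * α) (C := D) (by positivity)
    (h := fun x => R (qVec α t x)) (f := fun x => fderiv ℝ R (qVec α t x) (qVecDeriv α t x))
    (g := fun x => fderiv ℝ R (qVec α t x) (corrVec α t x)) hh
    (hR.continuous.comp_continuousOn ((continuousOn_qVec hα ht).mono fun x hx => hx.1))
    (fun x hx => (hRd _).hasFDerivAt.comp_hasDerivAt x (hasDerivAt_qVec hα ht hx.1))
    (hf.mono (by linarith)) (hg.mono (by linarith)) hgi hn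
  set S := ∑ k ∈ Finset.range n, ((k + 1) / n : ℝ) ^ (2 * α) / (k + 1) ^ 2 with hS
  -- Replacing `p_k` by its two-term expansion costs a Taylor remainder of order `(x^α / j)²` and
  -- the derivative, of size `x^α`, applied to an error of order `x^α / j²`; both match the
  -- quadrature error.
  have hdiff : |∑ k ∈ Finset.range n, R (pVec α t n k) - ∑ k ∈ Finset.range n,
      (R (qVec α t ((k + 1) / n)) + fderiv ℝ R (qVec α t ((k + 1) / n))
        (corrVec α t ((k + 1) / n)) / n)| ≤ (L * (C₃ + C₅) ^ 2 + C₄ * C₅) * S := by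
    rw [← Finset.sum_sub_distrib, hS, Finset.mul_sum]
    refine (Finset.abs_sum_le_sum_abs _ _).trans (Finset.sum_le_sum fun k hk => ?_)
    have hkn := Finset.mem_range.1 hk
    have he := hC₅ n k htn hkn
    have hk1 : (1 : ℝ) ≤ k + 1 := by
      have : (0 : ℝ) ≤ k := Nat.cast_nonneg k
      linarith
    set b : ℝ := (k + 1) / n with hb
    have hb0 : 0 < b := by positivity
    have hb1 : b ≤ 1 := (div_le_one hn0).2 (by exact_mod_cast hkn)
    have hbn : b * n = k + 1 := by
      rw [hb]
      field_simp
    set j : ℝ := (k : ℝ) + 1 with hj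
    set p := pVec α t n k with hp
    set q := qVec α t b with hq
    set v := corrVec α t b with hv
    have hpm : p ∈ Set.Icc (0 : Fin m → ℝ) 1 :=
      pVec_mem_Icc hα ht (fun ℓ => (by linarith [ht ℓ] : t ℓ ≤ 2 * t ℓ).trans (htn ℓ)) k
    have hqm : q ∈ Set.Icc (0 : Fin m → ℝ) 1 := qVec_mem_Icc hα ht hb0.le
    have hT := norm_sub_sub_fderiv_le hRd hconv hL0 hL hpm hqm
    have hbα : 0 < b ^ α := by positivity
    have hj0 : 0 < j := by linarith
    have hpq : ‖p - q‖ ≤ (C₃ + C₅) * b ^ α / j := by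
      have e : p - q = (p - q - (n : ℝ)⁻¹ • v) + (n : ℝ)⁻¹ • v := by abel
      have hv1 : ‖(n : ℝ)⁻¹ • v‖ ≤ C₃ * b ^ α / j := by
        rw [norm_smul, Real.norm_of_nonneg (by positivity)]
        calc (n : ℝ)⁻¹ * ‖v‖ ≤ (n : ℝ)⁻¹ * (C₃ * b ^ (α - 1)) := by
              gcongr
              exact hC₃.1 b ⟨hb0, hb1⟩
          _ = _ := by
            rw [← hbn, Real.rpow_sub_one hb0.ne']
            field_simp
      have he' : C₅ * b ^ α / j ^ 2 ≤ C₅ * b ^ α / j := by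
        gcongr
        nlinarith
      rw [e]
      refine (norm_add_le _ _).trans ((add_le_add (he.trans he') hv1).trans (le_of_eq ?_))
      ring
    have hlin : |fderiv ℝ R q (p - q - (n : ℝ)⁻¹ • v)| ≤
        (C₄ * b ^ α) * (C₅ * b ^ α / j ^ 2) := by
      refine ((fderiv ℝ R q).le_opNorm _).trans (mul_le_mul (hC₄.1 b ⟨hb0, hb1⟩) he
        (norm_nonneg _) ?_)
      have := hC₄.nonneg
      positivity
    have hsplit : R p - (R q + fderiv ℝ R q v / n) =
        (R p - R q - fderiv ℝ R q (p - q)) + fderiv ℝ R q (p - q - (n : ℝ)⁻¹ • v) := by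
      rw [map_sub (fderiv ℝ R q) (p - q), map_smul, smul_eq_mul]
      ring
    rw [hsplit]
    have hb2 : b ^ (2 * α) = (b ^ α) ^ 2 := by
      rw [mul_comm 2 α, Real.rpow_mul hb0.le, Real.rpow_two]
    calc _ ≤ L * ((C₃ + C₅) * b ^ α / j) ^ 2 + (C₄ * b ^ α) * (C₅ * b ^ α / j ^ 2) := by
          refine (abs_add_le _ _).trans (add_le_add (hT.trans ?_) hlin)
          gcongr
      _ = _ := by
        rw [hb2]
        ring_nf
  refine (abs_sub_le _ _ _).trans ((add_le_add hdiff hmain).trans (le_of_eq ?_))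
  ring

end

/-! ### Arbitrary smooth symbols: removal of the tangent map at `(1, …, 1)` -/

section

variable {m : ℕ} {α : ℝ} {t : Fin m → ℝ}

lemma intervalIntegrable_corr (hα : 0 < α) (s : ℝ) : IntervalIntegrable (corr α s) volume 0 1 := by
  have h := intervalIntegrable_rpow_mul hα
    (f := fun x => s ^ α * Real.exp (-(s * x)) * ((1 - α - s * x) / 2) / Real.Gamma α)
    (by fun_prop) 0 1
  refine h.congr fun x _ => ?_
  simp only [corr]
  ring

lemma integral_corr_eq (α s : ℝ) :
    ∫ x in (0 : ℝ)..1, corr α s x = c₁ α s - (Q α s - 1) / 2 := by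
  rw [c₁, add_sub_cancel_right, ← intervalIntegral.integral_const_mul]
  refine intervalIntegral.integral_congr fun x _ => ?_
  simp only [corr]
  ring

lemma clm_eq_sum (φ : (Fin m → ℝ) →L[ℝ] ℝ) (v : Fin m → ℝ) :
    φ v = ∑ ℓ, v ℓ * φ (Pi.single ℓ 1) := by
  conv_lhs => rw [pi_eq_sum_univ' v]
  rw [map_sum]
  refine Finset.sum_congr rfl fun ℓ _ => ?_
  rw [map_smul, smul_eq_mul]

lemma isBigO_inv_errorRate (hα : 0 < α) :
    (fun n : ℕ => 1 / (n : ℝ)) =O[atTop] errorRate α := by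
  refine IsBigO.of_bound 1 ?_
  filter_upwards [eventually_gt_atTop 0] with n hn
  rw [one_mul, Real.norm_of_nonneg (by positivity)]
  exact (inv_le_errorRate hα hn).trans (Real.le_norm_self _)

/-- The expansion of the sum of the success probabilities. -/
lemma isBigO_sum_pVec (hα : 0 < α) (ht : ∀ ℓ, 0 ≤ t ℓ) (ℓ : Fin m) :
    (fun n : ℕ => ∑ k ∈ Finset.range n, pVec α t n k ℓ - (b₁ α (t ℓ) * n + c₁ α (t ℓ)))
      =O[atTop] errorRate α := by
  obtain ⟨C, hC0, hC⟩ := abs_sum_one_sub_betaTail_sub_le hα (ht ℓ)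
  refine IsBigO.trans (IsBigO.of_bound C ?_) (isBigO_inv_errorRate hα)
  filter_upwards [eventually_gt_atTop 0, eventually_ge_atTop ⌈2 * t ℓ⌉₊] with n hn hn2
  have hn0 : (0 : ℝ) < n := by exact_mod_cast hn
  rw [Real.norm_eq_abs, Real.norm_of_nonneg (by positivity), mul_one_div]
  exact hC n hn ((Nat.le_ceil _).trans (by exact_mod_cast hn2))

/-- Expansion of `∑_k K(p_k)` for a smooth function `K` of the success probabilities. -/
theorem isBigO_sum_comp_pVec (hα : 0 < α) (ht : ∀ ℓ, 0 ≤ t ℓ) {K : (Fin m → ℝ) → ℝ}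
    (hK : ContDiff ℝ 2 K) :
    (fun n : ℕ => ∑ k ∈ Finset.range n, K (pVec α t n k)
      - ((∫ x in (0 : ℝ)..1, K (qVec α t x)) * n
        + ((∫ x in (0 : ℝ)..1, fderiv ℝ K (qVec α t x) (corrVec α t x))
          + (K (qVec α t 1) - K 1) / 2))) =O[atTop] errorRate α := by
  set φ : (Fin m → ℝ) →L[ℝ] ℝ := fderiv ℝ K 1 with hφ
  -- `R` vanishes to second order at the value `q(0) = (1, …, 1)`. The subtracted affine map
  -- involves only the sums `∑_k p_k`, whose expansion is more precise; the rest of the proof checks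
  -- that the coefficients recombine.
  set R : (Fin m → ℝ) → ℝ := fun p => K p - (K 1 + φ (p - 1)) with hRdef
  have hKd : Differentiable ℝ K := hK.differentiable two_ne_zero
  have hR : ContDiff ℝ 2 R := by fun_prop
  have hdR : ∀ p, fderiv ℝ R p = fderiv ℝ K p - φ := by
    intro p
    have h1 : HasFDerivAt (fun p => K 1 + φ (p - 1)) φ p := by
      have := (φ.hasFDerivAt (x := p - 1)).comp p ((hasFDerivAt_id p).sub_const 1)
      exact this.const_add (K 1)
    exact ((hKd p).hasFDerivAt.sub h1).fderiv
  obtain ⟨C, hC0, hC⟩ := exists_abs_sum_comp_pVec_sub_le hα ht hR (by simp [hRdef])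
    (by rw [hdR, sub_self])
  obtain ⟨C', hC0', hC'⟩ := sum_rpow_div_sq_le_errorRate hα
  have hqc : ContinuousOn (qVec α t) (Set.uIcc 0 1) := by
    rw [Set.uIcc_of_le zero_le_one]
    exact (continuousOn_qVec hα ht).mono fun x hx => hx.1
  have hquad : (fun n : ℕ => ∑ k ∈ Finset.range n, R (pVec α t n k)
      - (n * (∫ x in (0 : ℝ)..1, R (qVec α t x))
        + (∫ x in (0 : ℝ)..1, fderiv ℝ R (qVec α t x) (corrVec α t x)) + R (qVec α t 1) / 2))
      =O[atTop] errorRate α := by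
    refine IsBigO.of_bound (C * C') ?_
    have hev : ∀ᶠ n : ℕ in atTop, ∀ ℓ, 2 * t ℓ ≤ n := eventually_all.2 fun ℓ => by
      filter_upwards [eventually_ge_atTop ⌈2 * t ℓ⌉₊] with n hn
      exact (Nat.le_ceil _).trans (by exact_mod_cast hn)
    filter_upwards [eventually_gt_atTop 0, hev] with n hn hn2
    rw [Real.norm_eq_abs, mul_assoc]
    refine (hC n hn hn2).trans (mul_le_mul_of_nonneg_left ((hC' n hn).trans ?_) hC0)
    exact mul_le_mul_of_nonneg_left (Real.le_norm_self _) hC0'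
  have hlin : (fun n : ℕ => ∑ ℓ, (∑ k ∈ Finset.range n, pVec α t n k ℓ
      - (b₁ α (t ℓ) * n + c₁ α (t ℓ))) * φ (Pi.single ℓ 1)) =O[atTop] errorRate α :=
    IsBigO.fun_sum fun ℓ _ => by
      simpa [mul_comm] using (isBigO_sum_pVec hα ht ℓ).const_mul_left (φ (Pi.single ℓ 1))
  refine (hquad.add hlin).congr_left fun n => ?_
  have hsum : ∑ k ∈ Finset.range n, R (pVec α t n k) = ∑ k ∈ Finset.range n, K (pVec α t n k)
      - (n * K 1 + ∑ ℓ, (∑ k ∈ Finset.range n, pVec α t n k ℓ - n) * φ (Pi.single ℓ 1)) := by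
    simp only [hRdef]
    rw [Finset.sum_sub_distrib, Finset.sum_add_distrib]
    congr 2
    · simp
    · simp_rw [clm_eq_sum φ (_ - _)]
      rw [Finset.sum_comm]
      refine Finset.sum_congr rfl fun ℓ _ => ?_
      rw [← Finset.sum_mul]
      simp
  have hQi : ∀ ℓ, IntervalIntegrable (fun x => (qVec α t x - 1) ℓ * φ (Pi.single ℓ 1)) volume 0 1 :=
    fun ℓ => ((intervalIntegrable_Q_mul hα (ht ℓ)).sub (by simp)).mul_const _
  have hint : ∫ x in (0 : ℝ)..1, R (qVec α t x) = (∫ x in (0 : ℝ)..1, K (qVec α t x))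
      - (K 1 + ∑ ℓ, (b₁ α (t ℓ) - 1) * φ (Pi.single ℓ 1)) := by
    have hK1 : IntervalIntegrable (fun x => K (qVec α t x)) volume 0 1 :=
      (hK.continuous.comp_continuousOn hqc).intervalIntegrable
    have hφ1 : IntervalIntegrable (fun x => φ (qVec α t x - 1)) volume 0 1 :=
      (φ.continuous.comp_continuousOn (hqc.sub continuousOn_const)).intervalIntegrable
    simp only [hRdef]
    rw [intervalIntegral.integral_sub hK1 (IntervalIntegrable.add (by simp) hφ1),
      intervalIntegral.integral_add (by simp) hφ1]
    simp_rw [clm_eq_sum φ (_ - _)]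
    rw [intervalIntegral.integral_finsetSum fun ℓ _ => hQi ℓ]
    congr 2
    · simp
    · refine Finset.sum_congr rfl fun ℓ _ => ?_
      rw [intervalIntegral.integral_mul_const]
      congr 1
      have := intervalIntegral.integral_sub (intervalIntegrable_Q_mul hα (ht ℓ))
        (by simp : IntervalIntegrable (fun _ : ℝ => (1 : ℝ)) volume 0 1)
      simpa [b₁, qVec] using this
  have hint2 : ∫ x in (0 : ℝ)..1, fderiv ℝ R (qVec α t x) (corrVec α t x) =
      (∫ x in (0 : ℝ)..1, fderiv ℝ K (qVec α t x) (corrVec α t x))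
      - ∑ ℓ, (c₁ α (t ℓ) - (Q α (t ℓ) - 1) / 2) * φ (Pi.single ℓ 1) := by
    have hci : ∀ ℓ, IntervalIntegrable (fun x => corrVec α t x ℓ * φ (Pi.single ℓ 1)) volume 0 1 :=
      fun ℓ => (intervalIntegrable_corr hα (t ℓ)).mul_const _
    have hφi : IntervalIntegrable (fun x => φ (corrVec α t x)) volume 0 1 := by
      simp_rw [clm_eq_sum φ (corrVec _ _ _)]
      have := IntervalIntegrable.sum Finset.univ fun ℓ _ => hci ℓ
      refine this.congr fun x _ => ?_
      simp
    obtain ⟨C₃, hC₃⟩ := powerLip_corrVec (α := α) (t := t)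
    obtain ⟨C₄, hC₄⟩ := powerLip_fderiv_qVec hα ht hR (by rw [hdR, sub_self])
    have hRi := intervalIntegrable_of_powerLip (by linarith) (hC₃.pairing hC₄)
      (continuousOn_fderiv_corrVec hα ht hR)
    have hKi : IntervalIntegrable (fun x => fderiv ℝ K (qVec α t x) (corrVec α t x))
        volume 0 1 := by
      refine (hRi.add hφi).congr fun x _ => ?_
      simp [hdR]
    have : ∑ ℓ, (c₁ α (t ℓ) - (Q α (t ℓ) - 1) / 2) * φ (Pi.single ℓ 1) =
        ∫ x in (0 : ℝ)..1, φ (corrVec α t x) := by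
      simp_rw [clm_eq_sum φ (corrVec _ _ _)]
      rw [intervalIntegral.integral_finsetSum fun ℓ _ => hci ℓ]
      refine Finset.sum_congr rfl fun ℓ _ => ?_
      rw [intervalIntegral.integral_mul_const]
      simp only [corrVec]
      rw [integral_corr_eq]
    rw [this, ← intervalIntegral.integral_sub hKi hφi]
    simp [hdR]
  have hend : R (qVec α t 1) = K (qVec α t 1)
      - (K 1 + ∑ ℓ, (Q α (t ℓ) - 1) * φ (Pi.single ℓ 1)) := by
    simp only [hRdef]
    rw [clm_eq_sum φ]
    simp [qVec]
  rw [hsum, hint, hint2, hend]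
  have e1 : ∀ F G : Fin m → ℝ, ∑ ℓ, (F ℓ - G ℓ) * φ (Pi.single ℓ 1) =
      ∑ ℓ, F ℓ * φ (Pi.single ℓ 1) - ∑ ℓ, G ℓ * φ (Pi.single ℓ 1) := fun F G => by
    rw [← Finset.sum_sub_distrib]
    exact Finset.sum_congr rfl fun ℓ _ => sub_mul _ _ _
  have e2 : ∑ ℓ, (b₁ α (t ℓ) * n + c₁ α (t ℓ)) * φ (Pi.single ℓ 1) =
      (∑ ℓ, b₁ α (t ℓ) * φ (Pi.single ℓ 1)) * n + ∑ ℓ, c₁ α (t ℓ) * φ (Pi.single ℓ 1) := by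
    rw [Finset.sum_mul, ← Finset.sum_add_distrib]
    exact Finset.sum_congr rfl fun ℓ _ => by ring
  have e3 : ∑ ℓ, (Q α (t ℓ) - 1) / 2 * φ (Pi.single ℓ 1) =
      (∑ ℓ, (Q α (t ℓ) - 1) * φ (Pi.single ℓ 1)) / 2 := by
    rw [Finset.sum_div]
    exact Finset.sum_congr rfl fun ℓ _ => by ring
  have e4 : ∑ ℓ, (n : ℝ) * φ (Pi.single ℓ 1) = n * ∑ ℓ, 1 * φ (Pi.single ℓ 1) := by
    rw [Finset.mul_sum]
    exact Finset.sum_congr rfl fun ℓ _ => by ring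
  have f1 : ∑ ℓ, (∑ k ∈ Finset.range n, pVec α t n k ℓ - n) * φ (Pi.single ℓ 1) =
      ∑ ℓ, (∑ k ∈ Finset.range n, pVec α t n k ℓ) * φ (Pi.single ℓ 1)
        - ∑ ℓ, (n : ℝ) * φ (Pi.single ℓ 1) := e1 _ _
  have f2 : ∑ ℓ, (b₁ α (t ℓ) - 1) * φ (Pi.single ℓ 1) =
      ∑ ℓ, b₁ α (t ℓ) * φ (Pi.single ℓ 1) - ∑ ℓ, 1 * φ (Pi.single ℓ 1) := e1 _ _
  have f3 : ∑ ℓ, (c₁ α (t ℓ) - (Q α (t ℓ) - 1) / 2) * φ (Pi.single ℓ 1) =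
      ∑ ℓ, c₁ α (t ℓ) * φ (Pi.single ℓ 1)
        - ∑ ℓ, (Q α (t ℓ) - 1) / 2 * φ (Pi.single ℓ 1) := e1 _ _
  have f4 : ∑ ℓ, (∑ k ∈ Finset.range n, pVec α t n k ℓ - (b₁ α (t ℓ) * n + c₁ α (t ℓ))) *
      φ (Pi.single ℓ 1) = ∑ ℓ, (∑ k ∈ Finset.range n, pVec α t n k ℓ) * φ (Pi.single ℓ 1)
        - ∑ ℓ, (b₁ α (t ℓ) * n + c₁ α (t ℓ)) * φ (Pi.single ℓ 1) := e1 _ _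
  rw [f1, f2, f3, f4, e2, e3, e4]
  ring

end

/-! ### Smooth dependence on parameters -/

section Parametric

variable {E P : Type} [NormedAddCommGroup E] [NormedSpace ℝ E]
  [NormedAddCommGroup P] [NormedSpace ℝ P]

/-- The parameters `u` for which the whole slice `{u} × K` lies in `U`. -/
def sliceSet {E P : Type} (U : Set (E × P)) (K : Set P) : Set E := {u | ∀ p ∈ K, (u, p) ∈ U}

/-- The tube lemma. -/
lemma isOpen_sliceSet {E P : Type} [TopologicalSpace E] [TopologicalSpace P] {U : Set (E × P)}
    (hU : IsOpen U) {K : Set P} (hK : IsCompact K) :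
    IsOpen (sliceSet U K) := by
  rw [isOpen_iff_eventually]
  intro u hu
  exact hK.eventually_forall_of_forall_eventually (P := fun u p => (u, p) ∈ U)
    fun p hp => hU.mem_nhds (hu p hp)

variable {U : Set (E × P)} {K : Set P} {q : ℝ → P} {w : ℝ → ℝ}

lemma ContDiffOn.fderiv_comp_inl {G : Type} [NormedAddCommGroup G] [NormedSpace ℝ G]
    {F : E × P → G} (hU : IsOpen U) (hF : ContDiffOn ℝ ∞ F U) :
    ContDiffOn ℝ ∞ (fun z => (fderiv ℝ F z).comp (ContinuousLinearMap.inl ℝ E P)) U :=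
  (hF.fderiv_of_isOpen hU (m := ∞) (by simp)).clm_comp contDiffOn_const

/-- Finite dimension gives a compact neighbourhood `B` of `u` with `B ×ˢ K ⊆ U`, on which `F` and
its derivative are bounded. A multiple of `‖w‖` then dominates, so the weight may be unbounded at
`0`, as `corr` is for `α < 1`. -/
lemma hasFDerivAt_integral_slice [FiniteDimensional ℝ E] {G : Type} [NormedAddCommGroup G]
    [NormedSpace ℝ G] {F : E × P → G} (hU : IsOpen U) (hK : IsCompact K)
    (hq : ContinuousOn q (Set.Ioc 0 1)) (hqK : ∀ x ∈ Set.Ioc (0 : ℝ) 1, q x ∈ K)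
    (hw : IntegrableOn w (Set.Ioc 0 1)) (hF : ContDiffOn ℝ ∞ F U) {u : E}
    (hu : u ∈ sliceSet U K) :
    HasFDerivAt (fun u => ∫ x in Set.Ioc (0 : ℝ) 1, w x • F (u, q x))
      (∫ x in Set.Ioc (0 : ℝ) 1,
        w x • (fderiv ℝ F (u, q x)).comp (ContinuousLinearMap.inl ℝ E P)) u := by
  have hV := isOpen_sliceSet hU hK
  obtain ⟨B, hB, huB, hBV⟩ := exists_compact_subset hV hu
  have hBK : B ×ˢ K ⊆ U := fun z hz => hBV hz.1 z.2 hz.2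
  have hF' := ContDiffOn.fderiv_comp_inl hU hF
  obtain ⟨M, hM⟩ := (hB.prod hK).exists_bound_of_continuousOn (hF.continuousOn.mono hBK)
  obtain ⟨M', hM'⟩ := (hB.prod hK).exists_bound_of_continuousOn (hF'.continuousOn.mono hBK)
  have hmeas : ∀ {G' : Type} [NormedAddCommGroup G'] [NormedSpace ℝ G'] {f : E × P → G'} {v : E},
      ContinuousOn f U → v ∈ sliceSet U K →
      AEStronglyMeasurable (fun x => w x • f (v, q x)) (volume.restrict (Set.Ioc 0 1)) := by
    intro G' _ _ f v hf hv
    refine hw.aestronglyMeasurable.smul (ContinuousOn.aestronglyMeasurable ?_ measurableSet_Ioc)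
    exact hf.comp (continuousOn_const.prodMk hq) fun x hx => hv _ (hqK x hx)
  refine hasFDerivAt_integral_of_dominated_of_fderiv_le (s := interior B)
    (bound := fun x => M' * ‖w x‖)
    (F' := fun u x => w x • (fderiv ℝ F (u, q x)).comp (ContinuousLinearMap.inl ℝ E P))
    (isOpen_interior.mem_nhds huB) ?_ ?_ ?_ ?_ ?_ ?_
  · filter_upwards [hV.mem_nhds hu] with v hv using hmeas hF.continuousOn hv
  · refine (hw.norm.const_mul M).mono' (hmeas hF.continuousOn hu) ?_
    filter_upwards [ae_restrict_mem measurableSet_Ioc] with x hx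
    rw [norm_smul, mul_comm]
    exact mul_le_mul_of_nonneg_right (hM (u, q x) ⟨interior_subset huB, hqK x hx⟩) (norm_nonneg _)
  · exact hmeas (f := fun z => (fderiv ℝ F z).comp (ContinuousLinearMap.inl ℝ E P))
      hF'.continuousOn hu
  · filter_upwards [ae_restrict_mem measurableSet_Ioc] with x hx v hv
    rw [norm_smul, mul_comm]
    exact mul_le_mul_of_nonneg_right (hM' (v, q x) ⟨interior_subset hv, hqK x hx⟩) (norm_nonneg _)
  · exact hw.norm.const_mul M'
  · filter_upwards [ae_restrict_mem measurableSet_Ioc] with x hx v hv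
    have hmem : (v, q x) ∈ U := hBV (interior_subset hv) _ (hqK x hx)
    have h1 : HasFDerivAt F (fderiv ℝ F (v, q x)) (v, q x) :=
      ((hF.contDiffAt (hU.mem_nhds hmem)).differentiableAt (by simp)).hasFDerivAt
    exact (h1.comp v (hasFDerivAt_prodMk_left v (q x))).const_smul (w x)

/-- The codomain `G` is quantified inside the induction, because the derivative is an integral of
the same kind with values in continuous linear maps. -/
lemma contDiffOn_integral_slice [FiniteDimensional ℝ E] (hU : IsOpen U) (hK : IsCompact K)
    (hq : ContinuousOn q (Set.Ioc 0 1)) (hqK : ∀ x ∈ Set.Ioc (0 : ℝ) 1, q x ∈ K)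
    (hw : IntegrableOn w (Set.Ioc 0 1)) (n : ℕ) :
    ∀ {G : Type} [NormedAddCommGroup G] [NormedSpace ℝ G] {F : E × P → G},
      ContDiffOn ℝ ∞ F U →
      ContDiffOn ℝ n (fun u => ∫ x in Set.Ioc (0 : ℝ) 1, w x • F (u, q x)) (sliceSet U K) := by
  have hV := isOpen_sliceSet hU hK
  induction n with
  | zero =>
    intro G _ _ F hF
    refine contDiffOn_zero.2 fun u hu => ?_
    exact (hasFDerivAt_integral_slice hU hK hq hqK hw hF hu).continuousAt.continuousWithinAt
  | succ n ih =>
    intro G _ _ F hF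
    push_cast
    refine (contDiffOn_succ_iff_fderiv_of_isOpen hV).2 ⟨fun u hu => ?_, by simp, ?_⟩
    · exact (hasFDerivAt_integral_slice hU hK hq hqK hw hF
        hu).differentiableAt.differentiableWithinAt
    · exact (ih (ContDiffOn.fderiv_comp_inl hU hF)).congr fun u hu =>
        (hasFDerivAt_integral_slice hU hK hq hqK hw hF hu).fderiv

/-- Operators from functions of `(u, p)` to functions of `u` that commute with differentiation
in `u`. -/
structure ParamOperator (U : Set (E × P)) (V : Set E) (T : (E × P → ℝ) → E → ℝ) : Prop where
  smooth : ∀ F, ContDiffOn ℝ ∞ F U → ContDiffOn ℝ ∞ (T F) V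
  fderiv_apply : ∀ F, ContDiffOn ℝ ∞ F U → ∀ u ∈ V, ∀ e,
    fderiv ℝ (T F) u e = T (fun z => fderiv ℝ F z (e, 0)) u
  congr : ∀ F F', Set.EqOn F F' U → Set.EqOn (T F) (T F') V

lemma ContDiffOn.fderiv_apply_const {F : E × P → ℝ} (hU : IsOpen U) (hF : ContDiffOn ℝ ∞ F U)
    (v : E × P) : ContDiffOn ℝ ∞ (fun z => fderiv ℝ F z v) U :=
  (hF.fderiv_of_isOpen hU (m := ∞) (by simp)).clm_apply contDiffOn_const

lemma paramOperator_integral [FiniteDimensional ℝ E] (hU : IsOpen U) (hK : IsCompact K)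
    (hq : ContinuousOn q (Set.Ioc 0 1)) (hqK : ∀ x ∈ Set.Ioc (0 : ℝ) 1, q x ∈ K)
    (hw : IntegrableOn w (Set.Ioc 0 1)) :
    ParamOperator U (sliceSet U K) fun F u => ∫ x in Set.Ioc (0 : ℝ) 1, w x • F (u, q x) where
  smooth F hF := contDiffOn_infty.2 fun n => contDiffOn_integral_slice hU hK hq hqK hw n hF
  fderiv_apply F hF u hu e := by
    have h := hasFDerivAt_integral_slice hU hK hq hqK hw hF hu
    have hV := isOpen_sliceSet hU hK
    have hF' := ContDiffOn.fderiv_comp_inl hU hF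
    obtain ⟨M, hM⟩ := hK.exists_bound_of_continuousOn
      (f := fun p => (fderiv ℝ F (u, p)).comp (ContinuousLinearMap.inl ℝ E P))
      (hF'.continuousOn.comp (by fun_prop) fun p hp => hu p hp)
    have hint : IntegrableOn (fun x => w x • (fderiv ℝ F (u, q x)).comp
        (ContinuousLinearMap.inl ℝ E P)) (Set.Ioc 0 1) := by
      refine (hw.norm.const_mul M).mono' (hw.aestronglyMeasurable.smul
        (ContinuousOn.aestronglyMeasurable (hF'.continuousOn.comp
          (continuousOn_const.prodMk hq) fun x hx => hu _ (hqK x hx)) measurableSet_Ioc)) ?_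
      filter_upwards [ae_restrict_mem measurableSet_Ioc] with x hx
      rw [norm_smul, mul_comm]
      exact mul_le_mul_of_nonneg_right (hM (q x) (hqK x hx)) (norm_nonneg _)
    rw [h.fderiv, ContinuousLinearMap.integral_apply hint]
    simp
  congr F F' hFF' u hu := setIntegral_congr_fun measurableSet_Ioc fun x hx => by
    rw [hFF' (hu _ (hqK x hx))]

lemma paramOperator_eval (hU : IsOpen U) {p : P} (hp : p ∈ K) :
    ParamOperator U (sliceSet U K) fun F u => F (u, p) where
  smooth F hF := hF.comp (contDiff_prodMk_left p).contDiffOn fun u hu => hu p hp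
  fderiv_apply F hF u hu e := by
    have h1 : HasFDerivAt F (fderiv ℝ F (u, p)) (u, p) :=
      ((hF.contDiffAt (hU.mem_nhds (hu p hp))).differentiableAt (by simp)).hasFDerivAt
    have h2 := (h1.comp (f := fun u => (u, p)) u (hasFDerivAt_prodMk_left u p)).fderiv
    simp only [Function.comp_def] at h2
    rw [h2]
    simp
  congr F F' hFF' u hu := hFF' (hu p hp)

variable {V : Set E}

lemma ParamOperator.differentiableAt {T : (E × P → ℝ) → E → ℝ} (hV : IsOpen V)
    (hT : ParamOperator U V T) {F : E × P → ℝ} (hF : ContDiffOn ℝ ∞ F U) {u : E} (hu : u ∈ V) :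
    DifferentiableAt ℝ (T F) u :=
  ((hT.smooth F hF).contDiffAt (hV.mem_nhds hu)).differentiableAt (by simp)

lemma ParamOperator.sum {ι : Type*} (s : Finset ι) {T : ι → (E × P → ℝ) → E → ℝ}
    (hV : IsOpen V) (hT : ∀ i ∈ s, ParamOperator U V (T i)) :
    ParamOperator U V fun F u => ∑ i ∈ s, T i F u where
  smooth F hF := ContDiffOn.sum fun i hi => (hT i hi).smooth F hF
  fderiv_apply F hF u hu e := by
    rw [fderiv_fun_sum fun i hi => (hT i hi).differentiableAt hV hF hu]
    rw [_root_.sum_apply]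
    exact Finset.sum_congr rfl fun i hi => (hT i hi).fderiv_apply F hF u hu e
  congr F F' hFF' u hu := Finset.sum_congr rfl fun i hi => (hT i hi).congr F F' hFF' hu

lemma ParamOperator.add_const_mul {T T' : (E × P → ℝ) → E → ℝ}
    (hV : IsOpen V) (hT : ParamOperator U V T) (hT' : ParamOperator U V T') (c : ℝ) :
    ParamOperator U V fun F u => T F u + c * T' F u where
  smooth F hF := (hT.smooth F hF).add (contDiffOn_const.mul (hT'.smooth F hF))
  fderiv_apply F hF u hu e := by
    have h1 := (hT.differentiableAt hV hF hu).hasFDerivAt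
    have h2 := (hT'.differentiableAt hV hF hu).hasFDerivAt
    have h3 : fderiv ℝ (fun u => T F u + c * T' F u) u = _ := (h1.add (h2.const_mul c)).fderiv
    rw [h3, ← hT.fderiv_apply F hF u hu e,
      ← hT'.fderiv_apply F hF u hu e]
    simp
  congr F F' hFF' u hu := by
    simp only
    rw [hT.congr F F' hFF' hu, hT'.congr F F' hFF' hu]

lemma fderiv_fderiv_apply_comm {F : E × P → ℝ} (hU : IsOpen U) (hF : ContDiffOn ℝ ∞ F U)
    {z : E × P} (hz : z ∈ U) (v v' : E × P) :
    fderiv ℝ (fun z => fderiv ℝ F z v) z v' = fderiv ℝ (fun z => fderiv ℝ F z v') z v := by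
  have hFz := hF.contDiffAt (hU.mem_nhds hz)
  have hd : DifferentiableAt ℝ (fderiv ℝ F) z :=
    ((hF.fderiv_of_isOpen hU (m := ∞) (by simp)).contDiffAt
      (hU.mem_nhds hz)).differentiableAt (by simp)
  have hsymm := hFz.isSymmSndFDerivAt (by
    rw [minSmoothness_of_isRCLikeNormedField]
    exact ENat.LEInfty.out)
  rw [fderiv_clm_apply hd (by fun_prop), fderiv_clm_apply hd (by fun_prop)]
  simpa using hsymm v' v

/-- Needed because the second-order coefficient differentiates the symbol in `p`; symmetry of second
derivatives lets the `u`-derivative pass through. -/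
lemma ParamOperator.comp_fderiv {T : (E × P → ℝ) → E → ℝ} (hU : IsOpen U)
    (hT : ParamOperator U V T) (v : E × P) :
    ParamOperator U V fun F => T fun z => fderiv ℝ F z v where
  smooth F hF := hT.smooth _ (ContDiffOn.fderiv_apply_const hU hF v)
  fderiv_apply F hF u hu e := by
    rw [hT.fderiv_apply _ (ContDiffOn.fderiv_apply_const hU hF v) u hu e]
    exact hT.congr _ _ (fun z hz => fderiv_fderiv_apply_comm hU hF hz _ _) hu
  congr F F' hFF' := hT.congr _ _ fun z hz => by
    have : F =ᶠ[nhds z] F' := by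
      filter_upwards [hU.mem_nhds hz] with y hy using hFF' hy
    rw [this.fderiv_eq]

end Parametric

/-! ### Mixed partial derivatives of parametric expressions -/

section Mixed

variable {m : ℕ} {P : Type} [NormedAddCommGroup P] [NormedSpace ℝ P]
  {U : Set ((Fin m → ℝ) × P)} {V : Set (Fin m → ℝ)}

/-- Mixed partial derivatives in the first variable. -/
noncomputable def mixedPartialFst (j : Fin m → ℕ) (F : (Fin m → ℝ) × P → ℝ) :
    (Fin m → ℝ) × P → ℝ :=
  (List.finRange m).foldr
    (fun ℓ G => (fun (h : (Fin m → ℝ) × P → ℝ) z => fderiv ℝ h z (Pi.single ℓ 1, 0))^[j ℓ] G) F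

/-- Agreement of `g` with `T F` on the open set `V` is enough, since line derivatives are local;
this is the invariant carried through the iteration. -/
lemma iterate_lineDeriv_eq {T : ((Fin m → ℝ) × P → ℝ) → (Fin m → ℝ) → ℝ} (hU : IsOpen U)
    (hV : IsOpen V) (hT : ParamOperator U V T) (e : Fin m → ℝ) (N : ℕ)
    {F : (Fin m → ℝ) × P → ℝ} {g : (Fin m → ℝ) → ℝ} (hF : ContDiffOn ℝ ∞ F U)
    (hg : Set.EqOn g (T F) V) :
    ContDiffOn ℝ ∞ ((fun (h : (Fin m → ℝ) × P → ℝ) z => fderiv ℝ h z (e, 0))^[N] F) U ∧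
    Set.EqOn ((fun (h : (Fin m → ℝ) → ℝ) u => lineDeriv ℝ h u e)^[N] g)
      (T ((fun (h : (Fin m → ℝ) × P → ℝ) z => fderiv ℝ h z (e, 0))^[N] F)) V := by
  induction N generalizing F g with
  | zero => exact ⟨hF, hg⟩
  | succ N ih =>
    rw [Function.iterate_succ_apply, Function.iterate_succ_apply]
    refine ih (ContDiffOn.fderiv_apply_const hU hF _) fun u hu => ?_
    have heq : g =ᶠ[nhds u] T F := by
      filter_upwards [hV.mem_nhds hu] with y hy using hg hy
    rw [heq.lineDeriv_eq, (hT.differentiableAt hV hF hu).lineDeriv_eq_fderiv,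
      hT.fderiv_apply F hF u hu e]

/-- The log moment generating function, `C₁` and `C₂` are `T logForm` for three choices of `T`.
Their mixed partials are thus the same three operators applied to one differentiated symbol. -/
lemma mixedPartial_eq {T : ((Fin m → ℝ) × P → ℝ) → (Fin m → ℝ) → ℝ} (hU : IsOpen U)
    (hV : IsOpen V) (hT : ParamOperator U V T) (j : Fin m → ℕ)
    {F : (Fin m → ℝ) × P → ℝ} {g : (Fin m → ℝ) → ℝ} (hF : ContDiffOn ℝ ∞ F U)
    (hg : Set.EqOn g (T F) V) :
    ContDiffOn ℝ ∞ (mixedPartialFst j F) U ∧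
      Set.EqOn (mixedPartial j g) (T (mixedPartialFst j F)) V := by
  unfold mixedPartial mixedPartialFst
  induction List.finRange m with
  | nil => exact ⟨hF, hg⟩
  | cons ℓ L ih =>
    simp only [List.foldr_cons]
    exact iterate_lineDeriv_eq hU hV hT _ _ ih.1 ih.2

end Mixed

/-! ### Joint cumulants -/

section Cumulants

variable {m : ℕ} {α : ℝ} {t : Fin m → ℝ}

/-- The generating function `1 + ∑ ω_ℓ(u) p_ℓ` of a single modulus. -/
noncomputable def omegaForm (z : (Fin m → ℝ) × (Fin m → ℝ)) : ℝ := 1 + ∑ ℓ, omega z.1 ℓ * z.2 ℓ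

/-- The logarithm of `omegaForm`. -/
noncomputable def logForm (z : (Fin m → ℝ) × (Fin m → ℝ)) : ℝ := Real.log (omegaForm z)

/-- The domain of `logForm`. -/
def posSet (m : ℕ) : Set ((Fin m → ℝ) × (Fin m → ℝ)) := {z | 0 < omegaForm z}

lemma contDiff_omegaForm : ContDiff ℝ ∞ (omegaForm (m := m)) := by
  unfold omegaForm omega
  fun_prop

lemma isOpen_posSet : IsOpen (posSet m) :=
  isOpen_lt continuous_const contDiff_omegaForm.continuous

lemma contDiffOn_logForm : ContDiffOn ℝ ∞ (logForm (m := m)) (posSet m) :=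
  contDiff_omegaForm.contDiffOn.log fun _ hz => ne_of_gt hz

lemma omegaForm_zero (p : Fin m → ℝ) : omegaForm (0, p) = 1 := by
  simp [omegaForm, omega]

lemma zero_mem_posSet (p : Fin m → ℝ) : ((0 : Fin m → ℝ), p) ∈ posSet m := by
  simp [posSet, omegaForm_zero]

/-- A monotone 0/1 vector is a block of zeros followed by ones, and `ω_ℓ = exp(∑_{j ≥ ℓ} u_j) -
exp(∑_{j > ℓ} u_j)` telescopes over the ones. The induction removes index `0`. -/
lemma exp_sum_mul_eq (u : Fin m → ℝ) {s : Fin m → ℝ} (hs : Monotone s)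
    (hs01 : ∀ ℓ, s ℓ = 0 ∨ s ℓ = 1) :
    Real.exp (∑ ℓ, u ℓ * s ℓ) = 1 + ∑ ℓ, omega u ℓ * s ℓ := by
  induction m with
  | zero => simp
  | succ m ih =>
    have h := ih (fun i => u i.succ) (s := fun i => s i.succ)
      (fun a b hab => hs (Fin.succ_le_succ_iff.2 hab)) fun i => hs01 _
    have hω : ∀ i : Fin m, omega u i.succ = omega (fun i => u i.succ) i := by
      intro i
      simp only [omega, Fin.sum_Ioi_succ]
    rw [Fin.sum_univ_succ, Fin.sum_univ_succ, Real.exp_add, h]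
    simp only [hω]
    rcases hs01 0 with h0 | h0
    · simp [h0]
    · have h1 : ∀ i : Fin m, s i.succ = 1 := fun i => by
        rcases hs01 i.succ with hi | hi
        · have := hs (Fin.zero_le i.succ)
          rw [h0, hi] at this
          norm_num at this
        · exact hi
      simp only [h1, mul_one] at h ⊢
      rw [← h, omega, Fin.sum_Ioi_zero, h0]
      have h2 : ∑ i, omega (fun i => u i.succ) i = Real.exp (∑ i : Fin m, u i.succ) - 1 := by
        rw [h, add_sub_cancel_left]
      rw [h2, mul_one, mul_one]
      ring

lemma omegaForm_one (u : Fin m → ℝ) : omegaForm (u, 1) = Real.exp (∑ ℓ, u ℓ) := by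
  have := exp_sum_mul_eq u (s := 1) monotone_const fun _ => Or.inr rfl
  simpa [omegaForm] using this.symm

lemma logForm_one (u : Fin m → ℝ) : logForm (u, 1) = ∑ ℓ, u ℓ := by
  rw [logForm, omegaForm_one, Real.log_exp]

lemma fderiv_omegaForm_snd (z : (Fin m → ℝ) × (Fin m → ℝ)) (v : Fin m → ℝ) :
    fderiv ℝ omegaForm z (0, v) = ∑ ℓ, omega z.1 ℓ * v ℓ := by
  have h1 : HasFDerivAt (omegaForm (m := m)) (fderiv ℝ omegaForm z) (z.1, z.2) :=
    (contDiff_omegaForm.contDiffAt.differentiableAt (by simp)).hasFDerivAt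
  have h2 := (h1.comp (f := fun p => (z.1, p)) z.2 (hasFDerivAt_prodMk_right z.1 z.2))
  have h3 := h2.hasLineDerivAt v
  have h4 : HasLineDerivAt ℝ (omegaForm ∘ fun p => (z.1, p)) (∑ ℓ, omega z.1 ℓ * v ℓ) z.2 v := by
    unfold HasLineDerivAt
    have : (fun s : ℝ => (omegaForm ∘ fun p => (z.1, p)) (z.2 + s • v)) = fun s =>
        omegaForm z + s * ∑ ℓ, omega z.1 ℓ * v ℓ := by
      ext s
      simp only [Function.comp, omegaForm, Pi.add_apply, Pi.smul_apply, smul_eq_mul, mul_add,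
        Finset.sum_add_distrib, Finset.mul_sum, ← add_assoc]
      congr 1
      exact Finset.sum_congr rfl fun ℓ _ => by ring
    rw [this]
    simpa using ((hasDerivAt_id (0 : ℝ)).mul_const (∑ ℓ, omega z.1 ℓ * v ℓ)).const_add
      (omegaForm z)
  simpa using h3.unique h4

lemma fderiv_logForm_snd {z : (Fin m → ℝ) × (Fin m → ℝ)} (hz : z ∈ posSet m) (v : Fin m → ℝ) :
    fderiv ℝ logForm z (0, v) = (∑ ℓ, omega z.1 ℓ * v ℓ) / omegaForm z := by
  have h : HasFDerivAt (omegaForm (m := m)) (fderiv ℝ omegaForm z) z :=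
    (contDiff_omegaForm.contDiffAt.differentiableAt (by simp)).hasFDerivAt
  have h2 : fderiv ℝ logForm z = _ := (h.log (ne_of_gt hz)).fderiv
  rw [h2, _root_.smul_apply, fderiv_omegaForm_snd, smul_eq_mul, div_eq_inv_mul]

/-! ### Generating function of the counts in terms of success probabilities -/

/-- The probabilities that the independent moduli lie below the radii. -/
noncomputable def diskProb (α : ℝ) (t : Fin m → ℝ) (n k : ℕ) : Fin m → ℝ :=
  fun ℓ => ∫ w, diskInd (radius (t ℓ) n) w ∂(radialLaw α k)

lemma diskProb_eq_pVec (hα : 0 < α) (ht : ∀ ℓ, 0 ≤ t ℓ) {n : ℕ} (hn : ∀ ℓ, t ℓ ≤ n) (k : ℕ) :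
    diskProb α t n k = pVec α t n k :=
  funext fun ℓ => integral_diskInd_radius hα k (ht ℓ) (hn ℓ)

lemma diskProb_mem_Icc (hα : 0 < α) (n k : ℕ) : diskProb α t n k ∈ Set.Icc (0 : Fin m → ℝ) 1 := by
  have := isProbabilityMeasure_radialLaw hα k
  refine ⟨fun ℓ => integral_nonneg fun w => diskInd_nonneg _ _, fun ℓ => ?_⟩
  calc _ ≤ ∫ w, (1 : ℝ) ∂(radialLaw α k) :=
        integral_mono (integrable_diskInd hα k _) (integrable_const _)
          fun w => diskInd_le_one _ _
    _ = 1 := by simp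

lemma diskInd_mono {y y' : ℝ} (h : y ≤ y') (w : ℂ) : diskInd y w ≤ diskInd y' w := by
  unfold diskInd
  split_ifs with h1 h2
  · exact le_rfl
  · exact absurd (h1.trans_le h) h2
  · exact zero_le_one
  · exact le_rfl

lemma diskInd_eq_zero_or (y : ℝ) (w : ℂ) : diskInd y w = 0 ∨ diskInd y w = 1 := by
  unfold diskInd
  split_ifs <;> simp

lemma radius_anti {s s' : ℝ} (h : s ≤ s') (n : ℕ) : radius s' n ≤ radius s n :=
  Real.sqrt_le_sqrt (by gcongr)

lemma exp_sum_diskInd (ht : Antitone t) (n : ℕ) (u : Fin m → ℝ) (w : ℂ) :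
    Real.exp (∑ ℓ, u ℓ * diskInd (radius (t ℓ) n) w) =
      1 + ∑ ℓ, omega u ℓ * diskInd (radius (t ℓ) n) w :=
  exp_sum_mul_eq u (fun _ _ hab => diskInd_mono (radius_anti (ht hab) n) w)
    fun _ => diskInd_eq_zero_or _ _

lemma integral_exp_sum_diskInd (hα : 0 < α) (ht : Antitone t) (n k : ℕ) (u : Fin m → ℝ) :
    ∫ w, Real.exp (∑ ℓ, u ℓ * diskInd (radius (t ℓ) n) w) ∂(radialLaw α k) =
      omegaForm (u, diskProb α t n k) := by
  have := isProbabilityMeasure_radialLaw hα k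
  simp_rw [exp_sum_diskInd ht]
  have hi : ∀ ℓ ∈ Finset.univ, Integrable
      (fun w => omega u ℓ * diskInd (radius (t ℓ) n) w) (radialLaw α k) :=
    fun ℓ _ => (integrable_diskInd hα k _).const_mul _
  rw [integral_add (integrable_const _) (integrable_finsetSum _ hi), integral_finsetSum _ hi]
  simp [omegaForm, diskProb, integral_const_mul]

/-- The value is the expectation of an exponential, so it is positive for every `u`. For an
arbitrary point of the cube positivity is only used for `u` near `0`, through `paramSet`. -/
lemma diskProb_mem_posSet (hα : 0 < α) (ht : Antitone t) (n k : ℕ) (u : Fin m → ℝ) :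
    (u, diskProb α t n k) ∈ posSet m := by
  have := isProbabilityMeasure_radialLaw hα k
  rw [posSet, Set.mem_ofPred_eq, ← integral_exp_sum_diskInd hα ht]
  refine integral_exp_pos ?_
  simp_rw [exp_sum_diskInd ht]
  exact (integrable_const _).add (integrable_finsetSum _
    fun ℓ _ => (integrable_diskInd hα k _).const_mul _)

lemma logMGF_eq (hα : 0 < α) (ht : Antitone t) (n : ℕ) (u : Fin m → ℝ) :
    logMGF (law α n) (fun ℓ => count (radius (t ℓ) n)) u =
      ∑ k : Fin n, logForm (u, diskProb α t n k) := by
  have := fun k : Fin n => isProbabilityMeasure_radialLaw hα k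
  have h1 : ∫ z, Real.exp (∑ ℓ, u ℓ * count (radius (t ℓ) n) z) ∂(law α n) =
      ∏ k : Fin n, omegaForm (u, diskProb α t n k) := by
    have h := integral_comp_countVec_law hα (fun ℓ => radius (t ℓ) n) n
      (F := fun x : EuclideanSpace ℝ (Fin m) => Real.exp (∑ ℓ, u ℓ * x ℓ))
      (Continuous.stronglyMeasurable (by fun_prop))
    have h2 : ∀ z : Fin n → ℂ, Real.exp (∑ ℓ, u ℓ * countVec (fun ℓ => radius (t ℓ) n) z ℓ) =
        ∏ k, Real.exp (∑ ℓ, u ℓ * diskInd (radius (t ℓ) n) (z k)) := by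
      intro z
      rw [← Real.exp_sum, Finset.sum_comm]
      simp [countVec, count_eq_sum, Finset.mul_sum]
    refine h.trans ?_
    simp_rw [h2]
    rw [indepLaw, integral_fintype_prod_eq_prod
      (fun (_ : Fin n) (w : ℂ) => Real.exp (∑ ℓ, u ℓ * diskInd (radius (t ℓ) n) w))]
    exact Finset.prod_congr rfl fun k _ => integral_exp_sum_diskInd hα ht n k u
  rw [logMGF, h1, Real.log_prod fun (k : Fin n) _ => (diskProb_mem_posSet hα ht n k u).ne']
  rfl

lemma contDiff_logMGF (hα : 0 < α) (ht : Antitone t) (n : ℕ) :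
    ContDiff ℝ ∞ (logMGF (law α n) fun ℓ => count (radius (t ℓ) n)) := by
  rw [funext (logMGF_eq hα ht n)]
  refine ContDiff.sum fun k _ => contDiffOn_univ.1 ?_
  exact contDiffOn_logForm.comp (contDiff_prodMk_left _).contDiffOn
    fun u _ => diskProb_mem_posSet hα ht n k u

/-- The neighbourhood of the origin on which the cumulant expansion is smooth. -/
def paramSet (m : ℕ) : Set (Fin m → ℝ) := sliceSet (posSet m) (Set.Icc 0 1)

lemma isOpen_paramSet : IsOpen (paramSet m) := isOpen_sliceSet isOpen_posSet isCompact_Icc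

lemma zero_mem_paramSet : (0 : Fin m → ℝ) ∈ paramSet m := fun p _ => zero_mem_posSet p

/-! ### Cumulant symbols and the two expansion coefficients -/

lemma contDiffOn_mixedPartialFst_logForm (j : Fin m → ℕ) :
    ContDiffOn ℝ ∞ (mixedPartialFst j logForm) (posSet m) :=
  (mixedPartial_eq isOpen_posSet isOpen_paramSet
    -- Only the smoothness half is used here; the operator, evaluation at `p = 0`, is an arbitrary
    -- choice.
    (paramOperator_eval isOpen_posSet (p := (0 : Fin m → ℝ)) (by simp)) j contDiffOn_logForm
    (g := fun u => logForm (u, 0)) (fun _ _ => rfl)).1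

lemma contDiff_cumulantSymbol (j : Fin m → ℕ) :
    ContDiff ℝ ∞ fun p : Fin m → ℝ => mixedPartialFst j logForm (0, p) :=
  contDiffOn_univ.1 ((contDiffOn_mixedPartialFst_logForm j).comp
    (contDiff_prodMk_right 0).contDiffOn fun p _ => zero_mem_posSet p)

lemma jointCumulant_eq (hα : 0 < α) (ht : Antitone t) (j : Fin m → ℕ) (n : ℕ) :
    jointCumulant (law α n) (fun ℓ => count (radius (t ℓ) n)) j =
      ∑ k : Fin n, mixedPartialFst j logForm (0, diskProb α t n k) :=
  (mixedPartial_eq isOpen_posSet isOpen_paramSet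
    (ParamOperator.sum Finset.univ isOpen_paramSet fun (k : Fin n) _ =>
      paramOperator_eval isOpen_posSet (diskProb_mem_Icc (t := t) hα n k)) j contDiffOn_logForm
    fun u _ => logMGF_eq hα ht n u).2 zero_mem_paramSet

lemma continuousOn_qVec_Ioc (hα : 0 < α) (ht : ∀ ℓ, 0 ≤ t ℓ) :
    ContinuousOn (qVec α t) (Set.Ioc 0 1) :=
  (continuousOn_qVec hα ht).mono fun _ hx => hx.1.le

lemma paramOperator_integral_qVec (hα : 0 < α) (ht : ∀ ℓ, 0 ≤ t ℓ) {w : ℝ → ℝ}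
    (hw : IntegrableOn w (Set.Ioc 0 1)) :
    ParamOperator (posSet m) (paramSet m) fun F u =>
      ∫ x in Set.Ioc (0 : ℝ) 1, w x • F (u, qVec α t x) :=
  paramOperator_integral isOpen_posSet isCompact_Icc (continuousOn_qVec_Ioc hα ht)
    (fun _ hx => qVec_mem_Icc hα ht hx.1.le) hw

lemma C₁_eq (u : Fin m → ℝ) :
    C₁ α t u = ∫ x in Set.Ioc (0 : ℝ) 1, (1 : ℝ) • logForm (u, qVec α t x) := by
  rw [C₁, intervalIntegral.integral_of_le zero_le_one]
  simp [logForm, omegaForm, H, qVec]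

lemma integral_fderiv_corrVec (hα : 0 < α) (ht : ∀ ℓ, 0 ≤ t ℓ)
    {F : (Fin m → ℝ) × (Fin m → ℝ) → ℝ} (hF : ContDiffOn ℝ ∞ F (posSet m)) {u : Fin m → ℝ}
    (hu : u ∈ paramSet m) :
    ∫ x in (0 : ℝ)..1, fderiv ℝ F (u, qVec α t x) (0, corrVec α t x) =
      ∑ ℓ, ∫ x in Set.Ioc (0 : ℝ) 1,
        corr α (t ℓ) x • fderiv ℝ F (u, qVec α t x) (0, Pi.single ℓ 1) := by
  simp_rw [← intervalIntegral.integral_of_le (zero_le_one (α := ℝ))]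
  rw [← intervalIntegral.integral_finsetSum]
  · refine intervalIntegral.integral_congr fun x _ => ?_
    have := clm_eq_sum ((fderiv ℝ F (u, qVec α t x)).comp (ContinuousLinearMap.inr ℝ _ _))
      (corrVec α t x)
    simpa [corrVec] using this
  · intro ℓ _
    refine (intervalIntegrable_corr hα (t ℓ)).mul_continuousOn ?_
    rw [Set.uIcc_of_le zero_le_one]
    have hc := (ContDiffOn.fderiv_apply_const isOpen_posSet hF (0, Pi.single ℓ 1)).continuousOn
    refine hc.comp (f := fun x => (u, qVec α t x)) (continuousOn_const.prodMk
      ((continuousOn_qVec hα ht).mono fun x hx => hx.1)) fun x hx => hu _ (qVec_mem_Icc hα ht hx.1)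

/-- The second order coefficient as an operator applied to the symbol. -/
noncomputable def secondOrder (α : ℝ) (t : Fin m → ℝ) (F : (Fin m → ℝ) × (Fin m → ℝ) → ℝ)
    (u : Fin m → ℝ) : ℝ :=
  (∑ ℓ, ∫ x in Set.Ioc (0 : ℝ) 1,
      corr α (t ℓ) x • fderiv ℝ F (u, qVec α t x) (0, Pi.single ℓ 1)) +
    1 / 2 * (F (u, qVec α t 1) + -1 * F (u, 1))

lemma paramOperator_secondOrder (hα : 0 < α) (ht : ∀ ℓ, 0 ≤ t ℓ) :
    ParamOperator (posSet m) (paramSet m) (secondOrder α t) := by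
  have h1 := ParamOperator.sum Finset.univ isOpen_paramSet fun (ℓ : Fin m) _ =>
    (paramOperator_integral_qVec (t := t) hα ht
      ((intervalIntegrable_iff_integrableOn_Ioc_of_le zero_le_one).1
        (intervalIntegrable_corr hα (t ℓ)))).comp_fderiv isOpen_posSet (0, Pi.single ℓ 1)
  have h2 : ParamOperator (posSet m) (paramSet m) fun F u => F (u, qVec α t 1) :=
    paramOperator_eval isOpen_posSet (qVec_mem_Icc hα ht zero_le_one)
  have h3 : ParamOperator (posSet m) (paramSet m) fun F u => F (u, 1) :=
    paramOperator_eval isOpen_posSet (by simp)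
  exact h1.add_const_mul isOpen_paramSet (h2.add_const_mul isOpen_paramSet h3 (-1)) (1 / 2)

/-- The integrand `G` is the `p`-derivative of `logForm` along `corrVec`, and `∑ u_j` is the value
of `logForm` at `p = 1`, that is, at `x = 0`. -/
lemma C₂_eq (hα : 0 < α) (ht : ∀ ℓ, 0 ≤ t ℓ) {u : Fin m → ℝ} (hu : u ∈ paramSet m) :
    C₂ α t u = secondOrder α t logForm u := by
  rw [C₂, secondOrder, ← integral_fderiv_corrVec hα ht contDiffOn_logForm hu, logForm_one]
  have h : ∫ x in (0 : ℝ)..1, G α t u x =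
      ∫ x in (0 : ℝ)..1, fderiv ℝ logForm (u, qVec α t x) (0, corrVec α t x) := by
    refine intervalIntegral.integral_congr fun x hx => ?_
    rw [Set.uIcc_of_le zero_le_one] at hx
    show G α t u x = fderiv ℝ logForm (u, qVec α t x) (0, corrVec α t x)
    rw [fderiv_logForm_snd (hu _ (qVec_mem_Icc hα ht hx.1)), G, Finset.mul_sum,
      Finset.sum_div]
    refine Finset.sum_congr rfl fun ℓ _ => ?_
    simp only [corrVec, corr, omegaForm, H, qVec]
    ring
  have h1 : Real.log (H α t u 1) = logForm (u, qVec α t 1) := rfl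
  rw [h, h1]
  ring

lemma contDiffOn_C₁ (hα : 0 < α) (ht : ∀ ℓ, 0 ≤ t ℓ) : ContDiffOn ℝ ∞ (C₁ α t) (paramSet m) := by
  rw [funext C₁_eq]
  exact (paramOperator_integral_qVec hα ht (by simp)).smooth _ contDiffOn_logForm

lemma contDiffOn_C₂ (hα : 0 < α) (ht : ∀ ℓ, 0 ≤ t ℓ) : ContDiffOn ℝ ∞ (C₂ α t) (paramSet m) :=
  ((paramOperator_secondOrder hα ht).smooth _ contDiffOn_logForm).congr fun _ => C₂_eq hα ht

lemma mixedPartial_C₁ (hα : 0 < α) (ht : ∀ ℓ, 0 ≤ t ℓ) (j : Fin m → ℕ) :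
    mixedPartial j (C₁ α t) 0 = ∫ x in (0 : ℝ)..1, mixedPartialFst j logForm (0, qVec α t x) := by
  have h := (mixedPartial_eq isOpen_posSet isOpen_paramSet
    (paramOperator_integral_qVec (w := fun _ => 1) hα ht (by simp)) j contDiffOn_logForm
    fun u _ => C₁_eq u).2 zero_mem_paramSet
  rw [h, intervalIntegral.integral_of_le zero_le_one]
  simp

lemma mixedPartial_C₂ (hα : 0 < α) (ht : ∀ ℓ, 0 ≤ t ℓ) (j : Fin m → ℕ) :
    mixedPartial j (C₂ α t) 0 =
      (∫ x in (0 : ℝ)..1, fderiv ℝ (fun p => mixedPartialFst j logForm (0, p)) (qVec α t x)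
        (corrVec α t x)) +
      (mixedPartialFst j logForm (0, qVec α t 1) - mixedPartialFst j logForm (0, 1)) / 2 := by
  have h := (mixedPartial_eq isOpen_posSet isOpen_paramSet
    (paramOperator_secondOrder hα ht) j contDiffOn_logForm
    fun u => C₂_eq hα ht).2 zero_mem_paramSet
  have hF := contDiffOn_mixedPartialFst_logForm j
  rw [h, secondOrder, ← integral_fderiv_corrVec hα ht hF zero_mem_paramSet]
  have h2 : ∀ x, fderiv ℝ (fun p => mixedPartialFst j logForm (0, p)) (qVec α t x)
        (corrVec α t x) =
      fderiv ℝ (mixedPartialFst j logForm) (0, qVec α t x) (0, corrVec α t x) := by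
    intro x
    have h1 : HasFDerivAt (mixedPartialFst j logForm)
        (fderiv ℝ (mixedPartialFst j logForm) (0, qVec α t x)) (0, qVec α t x) :=
      ((hF.contDiffAt (isOpen_posSet.mem_nhds (zero_mem_posSet _))).differentiableAt
        (by simp)).hasFDerivAt
    have h3 := (h1.comp (f := fun p => ((0 : Fin m → ℝ), p)) (qVec α t x)
      (hasFDerivAt_prodMk_right 0 (qVec α t x))).fderiv
    simp only [Function.comp_def] at h3
    rw [h3]
    simp
  simp_rw [h2]
  ring

theorem isBigO_jointCumulant (hα : 0 < α) (hta : Antitone t) (ht : ∀ ℓ, 0 ≤ t ℓ) (j : Fin m → ℕ) :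
    (fun n : ℕ => jointCumulant (law α n) (fun ℓ => count (radius (t ℓ) n)) j
        - (mixedPartial j (C₁ α t) 0 * n + mixedPartial j (C₂ α t) 0))
      =O[atTop] errorRate α := by
  have hA := isBigO_sum_comp_pVec hα ht
    ((contDiff_cumulantSymbol j).of_le (m := 2) (ENat.LEInfty.out))
  refine hA.congr' ?_ EventuallyEq.rfl
  -- For `0 < n < t ℓ` the radius is the square root of a negative number, hence `0`, and the
  -- formula `pVec` is only claimed once `t ℓ ≤ n`.
  have hev : ∀ᶠ n : ℕ in atTop, ∀ ℓ, t ℓ ≤ n :=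
    eventually_all.2 fun ℓ => tendsto_natCast_atTop_atTop.eventually_ge_atTop _
  filter_upwards [hev] with n hn
  rw [jointCumulant_eq hα hta, mixedPartial_C₁ hα ht, mixedPartial_C₂ hα ht, Finset.sum_range]
  simp_rw [diskProb_eq_pVec hα ht hn]

end Cumulants

/-! ### Means, variances and covariances -/

section Moments

variable {m : ℕ} {α : ℝ} {t : Fin m → ℝ}

lemma memLp_diskInd (hα : 0 < α) (k : ℕ) (r : ℝ) : MemLp (diskInd r) 2 (radialLaw α k) := by
  have := isProbabilityMeasure_radialLaw hα k
  refine MemLp.of_bound (measurable_diskInd r).aestronglyMeasurable 1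
    (Eventually.of_forall fun w => ?_)
  rw [Real.norm_of_nonneg (diskInd_nonneg r w)]
  exact diskInd_le_one r w

/-- For nested disks the product of the indicators is the smaller indicator. -/
lemma covariance_diskInd (hα : 0 < α) (k : ℕ) {r r' : ℝ} (h : r ≤ r') :
    cov[diskInd r, diskInd r'; radialLaw α k] =
      (∫ w, diskInd r w ∂(radialLaw α k)) * (1 - ∫ w, diskInd r' w ∂(radialLaw α k)) := by
  have := isProbabilityMeasure_radialLaw hα k
  rw [covariance_eq_sub (memLp_diskInd hα k r) (memLp_diskInd hα k r')]
  have : ∀ w, (diskInd r * diskInd r') w = diskInd r w := fun w => by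
    have h1 := diskInd_mono h w
    have h2 := diskInd_le_one r' w
    rw [Pi.mul_apply]
    rcases diskInd_eq_zero_or r w with h0 | h0
    · rw [h0, zero_mul]
    · rw [h0] at h1 ⊢
      linarith
  simp_rw [this]
  ring

lemma covariance_diskInd_eval (hα : 0 < α) {n : ℕ} (i j : Fin n) (r r' : ℝ) :
    cov[fun z => diskInd r (z i), fun z => diskInd r' (z j); indepLaw α n] =
      if i = j then cov[diskInd r, diskInd r'; radialLaw α i] else 0 := by
  have := fun k : Fin n => isProbabilityMeasure_radialLaw hα k
  have hmp := fun i => measurePreserving_eval (fun k : Fin n => radialLaw α k) i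
  split_ifs with hij
  · subst hij
    conv_rhs => rw [← (hmp i).map_eq]
    exact (covariance_map_fun (measurable_diskInd r).aestronglyMeasurable
      (measurable_diskInd r').aestronglyMeasurable (hmp i).measurable.aemeasurable).symm
  · have hind := (iIndepFun_pi (μ := fun k : Fin n => radialLaw α k) (X := fun _ w => w)
      fun _ => aemeasurable_id').indepFun hij
    exact (hind.comp (measurable_diskInd r) (measurable_diskInd r')).covariance_eq_zero
      ((memLp_diskInd hα i r).comp_measurePreserving (hmp i))
      ((memLp_diskInd hα j r').comp_measurePreserving (hmp j))

lemma integral_count_law (hα : 0 < α) (n : ℕ) (ℓ : Fin m) :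
    ∫ z, count (radius (t ℓ) n) z ∂(law α n) = ∑ k : Fin n, diskProb α t n k ℓ := by
  have := fun k : Fin n => isProbabilityMeasure_radialLaw hα k
  have h := integral_comp_countVec_law hα (fun ℓ => radius (t ℓ) n) n
    (F := fun x : EuclideanSpace ℝ (Fin m) => x ℓ) (Continuous.stronglyMeasurable (by fun_prop))
  refine h.trans ?_
  simp only [countVec, count_eq_sum]
  rw [indepLaw, integral_finsetSum]
  · exact Finset.sum_congr rfl fun k _ =>
      integral_comp_eval (μ := fun k : Fin n => radialLaw α k)
        (measurable_diskInd _).aestronglyMeasurable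
  · intro k _
    exact integrable_comp_eval (μ := fun k : Fin n => radialLaw α k) (integrable_diskInd hα k _)

lemma covariance_count_law (hα : 0 < α) (n : ℕ) (ℓ k : Fin m) :
    cov[count (radius (t ℓ) n), count (radius (t k) n); law α n] =
      ∑ i : Fin n, cov[diskInd (radius (t ℓ) n), diskInd (radius (t k) n); radialLaw α i] := by
  have := fun k : Fin n => isProbabilityMeasure_radialLaw hα k
  have hmp := fun i => measurePreserving_eval (fun k : Fin n => radialLaw α k) i
  have hc : ∀ i : Fin m, Continuous fun x : EuclideanSpace ℝ (Fin m) => x i := by fun_prop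
  have h := fun P : Measure (Fin n → ℂ) =>
    covariance_map_fun (μ := P) (Z := countVec fun ℓ => radius (t ℓ) n)
    (hc ℓ).aestronglyMeasurable (hc k).aestronglyMeasurable (measurable_countVec _).aemeasurable
  refine (h (law α n)).symm.trans ?_
  rw [map_countVec_law hα, h (indepLaw α n)]
  simp only [countVec, count_eq_sum]
  have := isProbabilityMeasure_indepLaw hα n
  have hm : ∀ r, ∀ i : Fin n, MemLp (fun z : Fin n → ℂ => diskInd r (z i)) 2 (indepLaw α n) :=
    fun r i => (memLp_diskInd hα i r).comp_measurePreserving (hmp i)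
  rw [covariance_fun_sum_fun_sum (hm _) (hm _)]
  simp_rw [covariance_diskInd_eval hα]
  simp

lemma covariance_count_law_of_le (hα : 0 < α) (hta : Antitone t) (n : ℕ) {ℓ k : Fin m}
    (h : ℓ ≤ k) :
    cov[count (radius (t ℓ) n), count (radius (t k) n); law α n] =
      ∑ i : Fin n, diskProb α t n i ℓ * (1 - diskProb α t n i k) := by
  rw [covariance_count_law hα]
  exact Finset.sum_congr rfl fun i _ => covariance_diskInd hα i (radius_anti (hta h) n)

lemma eventually_forall_le (t : Fin m → ℝ) : ∀ᶠ n : ℕ in atTop, ∀ ℓ, t ℓ ≤ n :=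
  eventually_all.2 fun _ => tendsto_natCast_atTop_atTop.eventually_ge_atTop _

theorem isBigO_mean (hα : 0 < α) (ht : ∀ ℓ, 0 ≤ t ℓ) (ℓ : Fin m) :
    (fun n : ℕ => (∫ z, count (radius (t ℓ) n) z ∂(law α n)) - (b₁ α (t ℓ) * n + c₁ α (t ℓ)))
      =O[atTop] errorRate α := by
  refine (isBigO_sum_pVec hα ht ℓ).congr' ?_ EventuallyEq.rfl
  filter_upwards [eventually_forall_le t] with n hn
  rw [integral_count_law hα, Finset.sum_range]
  simp_rw [diskProb_eq_pVec hα ht hn]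

lemma fderiv_mul_one_sub_apply (ℓ k : Fin m) (p v : Fin m → ℝ) :
    fderiv ℝ (fun p : Fin m → ℝ => p ℓ * (1 - p k)) p v = v ℓ * (1 - p k) - p ℓ * v k := by
  have h := (hasFDerivAt_apply (𝕜 := ℝ) ℓ p).mul ((hasFDerivAt_apply (𝕜 := ℝ) k p).const_sub 1)
  have h2 : fderiv ℝ (fun p : Fin m → ℝ => p ℓ * (1 - p k)) p = _ := h.fderiv
  rw [h2]
  simp
  ring

theorem isBigO_covariance (hα : 0 < α) (hta : Antitone t) (ht : ∀ ℓ, 0 ≤ t ℓ) {ℓ k : Fin m}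
    (h : ℓ ≤ k) :
    (fun n : ℕ => cov[count (radius (t ℓ) n), count (radius (t k) n); law α n]
        - (b₁₁ α (t ℓ) (t k) * n + c₁₁ α (t ℓ) (t k))) =O[atTop] errorRate α := by
  -- By independence the covariance is the sum of this polynomial symbol over the moduli; the
  -- boundary value `K 1` is `0`.
  have hA := isBigO_sum_comp_pVec hα ht (K := fun p => p ℓ * (1 - p k)) (by fun_prop)
  have hc : c₁₁ α (t ℓ) (t k) =
      (∫ x in (0 : ℝ)..1, fderiv ℝ (fun p : Fin m → ℝ => p ℓ * (1 - p k)) (qVec α t x)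
        (corrVec α t x)) + (qVec α t 1 ℓ * (1 - qVec α t 1 k) -
          (1 : Fin m → ℝ) ℓ * (1 - (1 : Fin m → ℝ) k)) / 2 := by
    have : ∀ x, fderiv ℝ (fun p : Fin m → ℝ => p ℓ * (1 - p k)) (qVec α t x) (corrVec α t x) =
        ((α - 1 + t k * x) * t k ^ α * Real.exp (-(t k * x)) * Q α (t ℓ * x)
        - (α - 1 + t ℓ * x) * t ℓ ^ α * Real.exp (-(t ℓ * x)) * (1 - Q α (t k * x)))
        * (x ^ (α - 1) / (2 * Real.Gamma α)) := fun x => by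
      rw [fderiv_mul_one_sub_apply]
      simp only [corrVec, corr, qVec]
      have := (Real.Gamma_pos_of_pos hα).ne'
      field_simp
      ring
    simp_rw [this]
    simp only [c₁₁, qVec, mul_one, Pi.one_apply]
    ring
  refine hA.congr' ?_ EventuallyEq.rfl
  filter_upwards [eventually_forall_le t] with n hn
  rw [covariance_count_law_of_le hα hta n h, Finset.sum_range, hc]
  simp_rw [diskProb_eq_pVec hα ht hn]
  rfl

theorem isBigO_variance (hα : 0 < α) (hta : Antitone t) (ht : ∀ ℓ, 0 ≤ t ℓ) (ℓ : Fin m) :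
    (fun n : ℕ => Var[count (radius (t ℓ) n); law α n]
        - (b₁₁ α (t ℓ) (t ℓ) * n + c₁₁ α (t ℓ) (t ℓ))) =O[atTop] errorRate α := by
  simp_rw [← covariance_self (measurable_count _).aemeasurable]
  exact isBigO_covariance hα hta ht le_rfl

end Moments

/-! ### Characteristic functions of sums of bounded variables -/

lemma norm_prod_sub_prod_le {ι : Type*} (s : Finset ι) {a b : ι → ℂ} (ha : ∀ i ∈ s, ‖a i‖ ≤ 1)
    (hb : ∀ i ∈ s, ‖b i‖ ≤ 1) : ‖∏ i ∈ s, a i - ∏ i ∈ s, b i‖ ≤ ∑ i ∈ s, ‖a i - b i‖ := by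
  classical
  induction s using Finset.induction with
  | empty => simp
  | insert i s hi ih =>
    have ih' := ih (fun j hj => ha j (Finset.mem_insert_of_mem hj))
      fun j hj => hb j (Finset.mem_insert_of_mem hj)
    have hP : ‖∏ j ∈ s, a j‖ ≤ 1 := by
      rw [norm_prod]
      exact Finset.prod_le_one (fun _ _ => norm_nonneg _)
        fun j hj => ha j (Finset.mem_insert_of_mem hj)
    rw [Finset.prod_insert hi, Finset.prod_insert hi, Finset.sum_insert hi]
    calc _ = ‖(a i - b i) * ∏ j ∈ s, a j + b i * (∏ j ∈ s, a j - ∏ j ∈ s, b j)‖ := by ring_nf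
      _ ≤ ‖a i - b i‖ * ‖∏ j ∈ s, a j‖ + ‖b i‖ * ‖∏ j ∈ s, a j - ∏ j ∈ s, b j‖ := by
        refine (norm_add_le _ _).trans ?_
        rw [norm_mul, norm_mul]
      _ ≤ ‖a i - b i‖ * 1 + 1 * ∑ j ∈ s, ‖a j - b j‖ := by
        gcongr
        exact hb i (Finset.mem_insert_self i s)
      _ = _ := by ring

/-- Taylor's formula to third order, with the linear term removed by centring, gives `1 - s² V / 2`;
replacing this by the exponential costs order `s⁴ A⁴`. The restriction `s ≤ 1` bounds the
exponential factors and allows `s⁴ ≤ s³`. -/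
lemma norm_charFun_centered_sub_le {Ω : Type*} [MeasurableSpace Ω] {μ : Measure Ω}
    [IsProbabilityMeasure μ] {Y : Ω → ℝ} (hY : Measurable Y) {A : ℝ} (hA : 0 ≤ A)
    (hYA : ∀ x, |Y x| ≤ A) (hY0 : ∫ x, Y x ∂μ = 0) {s : ℝ} (hs0 : 0 ≤ s) (hs : s ≤ 1) :
    ‖∫ x, Complex.exp ((s * Y x : ℝ) * Complex.I) ∂μ
        - (Real.exp (-(s ^ 2 * (∫ x, Y x ^ 2 ∂μ) / 2)) : ℝ)‖ ≤
      (A ^ 3 * Real.exp A + Real.exp (A ^ 2) * A ^ 4) * s ^ 3 := by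
  set V := ∫ x, Y x ^ 2 ∂μ with hV
  have hV0 : 0 ≤ V := integral_nonneg fun x => sq_nonneg _
  have hYi : Integrable Y μ := (memLp_one_iff_integrable).1
    (MemLp.of_bound hY.aestronglyMeasurable A (Eventually.of_forall hYA))
  have hY2 : Integrable (fun x => Y x ^ 2) μ := (memLp_one_iff_integrable).1
    (MemLp.of_bound (hY.pow_const 2).aestronglyMeasurable (A ^ 2) (Eventually.of_forall fun x => by
      rw [Real.norm_eq_abs, abs_pow]
      exact pow_le_pow_left₀ (abs_nonneg _) (hYA x) 2))
  have hVA : V ≤ A ^ 2 := by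
    calc V ≤ ∫ x, A ^ 2 ∂μ := by
          refine integral_mono hY2 (integrable_const _) fun x => ?_
          show Y x ^ 2 ≤ A ^ 2
          rw [← sq_abs]
          exact pow_le_pow_left₀ (abs_nonneg _) (hYA x) 2
      _ = A ^ 2 := by simp
  have hE : Integrable (fun x => Complex.exp ((s * Y x : ℝ) * Complex.I)) μ :=
    (memLp_one_iff_integrable).1 (MemLp.of_bound (by fun_prop) 1
      (Eventually.of_forall fun x => (Complex.norm_exp_ofReal_mul_I _).le))
  have hS : Integrable (fun x => s ^ 2 * Y x ^ 2 / 2) μ := (hY2.const_mul (s ^ 2)).div_const 2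
  have hR : Integrable (fun x => ((1 - s ^ 2 * Y x ^ 2 / 2 : ℝ) : ℂ)) μ :=
    ((integrable_const (1 : ℝ)).sub hS).ofReal
  have hI : Integrable (fun x => (s * Y x : ℝ) * Complex.I) μ :=
    (hYi.const_mul s).ofReal.mul_const _
  have hRI : Integrable (fun x => (1 - s ^ 2 * Y x ^ 2 / 2 : ℝ) + (s * Y x : ℝ) * Complex.I) μ :=
    hR.add hI
  have hpoly : ∫ x, ((1 - s ^ 2 * Y x ^ 2 / 2 : ℝ) + (s * Y x : ℝ) * Complex.I : ℂ) ∂μ =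
      (1 - s ^ 2 * V / 2 : ℝ) := by
    rw [integral_add hR hI, integral_mul_const,
      integral_complex_ofReal, integral_complex_ofReal, integral_const_mul, hY0,
      integral_sub (integrable_const _) hS, integral_div, integral_const_mul]
    simp [hV]
  have h1 : ‖∫ x, Complex.exp ((s * Y x : ℝ) * Complex.I) ∂μ - (1 - s ^ 2 * V / 2 : ℝ)‖ ≤
      A ^ 3 * Real.exp A * s ^ 3 := by
    rw [← hpoly, ← integral_sub hE hRI]
    have hb : ∀ x, ‖Complex.exp ((s * Y x : ℝ) * Complex.I) -
        ((1 - s ^ 2 * Y x ^ 2 / 2 : ℝ) + (s * Y x : ℝ) * Complex.I)‖ ≤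
        A ^ 3 * Real.exp A * s ^ 3 := by
      intro x
      have h := Complex.norm_exp_sub_sum_le_norm_mul_exp ((s * Y x : ℝ) * Complex.I) 3
      have hn : ‖((s * Y x : ℝ) * Complex.I : ℂ)‖ = s * |Y x| := by
        rw [norm_mul, Complex.norm_I, mul_one, Complex.norm_real, Real.norm_eq_abs, abs_mul,
          abs_of_nonneg hs0]
      have hsum : ∑ k ∈ Finset.range 3, ((s * Y x : ℝ) * Complex.I : ℂ) ^ k / (k.factorial : ℂ) =
          (1 - s ^ 2 * Y x ^ 2 / 2 : ℝ) + (s * Y x : ℝ) * Complex.I := by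
        simp only [Finset.sum_range_succ, Finset.sum_range_zero, Nat.factorial]
        push_cast
        linear_combination ((s : ℂ) ^ 2 * (Y x : ℂ) ^ 2 / 2) * Complex.I_sq
      rw [hsum, hn] at h
      refine h.trans ?_
      have hsY : s * |Y x| ≤ A := by
        calc s * |Y x| ≤ 1 * A := by
              gcongr
              exact hYA x
          _ = A := one_mul A
      calc (s * |Y x|) ^ 3 * Real.exp (s * |Y x|) ≤ (s * A) ^ 3 * Real.exp A := by
            gcongr
            exact hYA x
        _ = _ := by ring
    refine (norm_integral_le_of_norm_le_const (Eventually.of_forall hb)).trans ?_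
    simp
  have h2 : ‖((1 - s ^ 2 * V / 2 : ℝ) : ℂ) - (Real.exp (-(s ^ 2 * V / 2)) : ℝ)‖ ≤
      Real.exp (A ^ 2) * A ^ 4 * s ^ 3 := by
    rw [← Complex.ofReal_sub, Complex.norm_real, Real.norm_eq_abs, abs_sub_comm]
    have hv : |(-(s ^ 2 * V / 2))| ≤ A ^ 2 := by
      rw [abs_neg, abs_of_nonneg (by positivity)]
      have : s ^ 2 ≤ 1 := pow_le_one₀ hs0 hs
      nlinarith
    have h := abs_exp_sub_one_sub_le hv
    have he : Real.exp (-(s ^ 2 * V / 2)) - (1 - s ^ 2 * V / 2) =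
        Real.exp (-(s ^ 2 * V / 2)) - 1 - -(s ^ 2 * V / 2) := by ring
    rw [he]
    refine h.trans ?_
    rw [mul_assoc]
    gcongr
    calc (-(s ^ 2 * V / 2)) ^ 2 = s ^ 3 * s * (V / 2) ^ 2 := by ring
      _ ≤ s ^ 3 * 1 * (A ^ 2) ^ 2 := by
        gcongr
        linarith
      _ = A ^ 4 * s ^ 3 := by ring
  calc _ ≤ _ := norm_sub_le_norm_sub_add_norm_sub _ ((1 - s ^ 2 * V / 2 : ℝ) : ℂ) _
    _ ≤ _ := add_le_add h1 h2
    _ = _ := by ring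

/-! ### Leading order consequences -/

section Leading

variable {m : ℕ} {α : ℝ} {t : Fin m → ℝ}

lemma isBigO_errorRate_one (hα : 0 < α) : errorRate α =O[atTop] fun _ => (1 : ℝ) := by
  refine IsBigO.of_bound 1 ?_
  filter_upwards [eventually_ge_atTop 1] with n hn
  have h1 : (1 : ℝ) ≤ n := by exact_mod_cast hn
  rw [errorRate, Real.norm_of_nonneg (by positivity), norm_one, mul_one]
  refine Real.rpow_le_one_of_one_le_of_nonpos h1 (neg_nonpos.2 ?_)
  have : 0 < min α 1 := lt_min hα one_pos
  positivity

lemma isBigO_sub_mul {f : ℕ → ℝ} {b c : ℝ} (hα : 0 < α)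
    (h : (fun n : ℕ => f n - (b * n + c)) =O[atTop] errorRate α) :
    (fun n : ℕ => f n - b * n) =O[atTop] fun _ => (1 : ℝ) := by
  have h1 := (h.trans (isBigO_errorRate_one hα)).add
    (isBigO_refl (fun _ : ℕ => (1 : ℝ)) atTop |>.const_mul_left c)
  refine h1.congr_left fun n => ?_
  ring

lemma tendsto_sub_mul_div_sqrt {f : ℕ → ℝ} {b c : ℝ} (hα : 0 < α)
    (h : (fun n : ℕ => f n - (b * n + c)) =O[atTop] errorRate α) :
    Tendsto (fun n : ℕ => (f n - b * n) / √n) atTop (nhds 0) := by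
  have h0 : Tendsto (fun n : ℕ => √(n : ℝ)) atTop atTop :=
    Real.tendsto_sqrt_atTop.comp tendsto_natCast_atTop_atTop
  refine ((isBigO_sub_mul hα h).trans_isLittleO ?_).tendsto_div_nhds_zero
  exact (isLittleO_const_left).2 (Or.inr (tendsto_norm_atTop_atTop.comp h0))

lemma tendsto_div_natCast {f : ℕ → ℝ} {b c : ℝ} (hα : 0 < α)
    (h : (fun n : ℕ => f n - (b * n + c)) =O[atTop] errorRate α) :
    Tendsto (fun n : ℕ => f n / n) atTop (nhds b) := by
  have h1 := ((isBigO_sub_mul hα h).trans_isLittleO ((isLittleO_const_left).2 (Or.inr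
    (tendsto_norm_atTop_atTop.comp tendsto_natCast_atTop_atTop)))).tendsto_div_nhds_zero
  refine (h1.add_const b).congr' ?_ |>.trans (by rw [zero_add])
  filter_upwards [eventually_ge_atTop 1] with n hn
  have : (n : ℝ) ≠ 0 := by positivity
  field_simp
  ring

end Leading

/-! ### The central limit theorem -/

lemma b₁₁_self_pos {α s : ℝ} (hα : 0 < α) (hs : 0 < s) : 0 < b₁₁ α s s := by
  have hc := continuousOn_Q_mul hα hs.le
  refine intervalIntegral.intervalIntegral_pos_of_pos_on
    (ContinuousOn.intervalIntegrable ?_) (fun x hx => ?_) one_pos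
  · rw [Set.uIcc_of_le zero_le_one]
    have := hc.mono (Set.Icc_subset_Ici_self : Set.Icc (0 : ℝ) 1 ⊆ Set.Ici 0)
    exact this.mul (continuousOn_const.sub this)
  · have h := mul_pos hs hx.1
    exact mul_pos (Q_pos hα h.le) (sub_pos.2 (Q_lt_one hα h))

section CLT

variable {m : ℕ} {α : ℝ} {t : Fin m → ℝ}

/-- The quadratic form of the limiting covariances of the counts. -/
noncomputable def covForm (α : ℝ) (t a : Fin m → ℝ) : ℝ :=
  ∑ ℓ, ∑ k, a ℓ * (a k * b₁₁ α (t (min ℓ k)) (t (max ℓ k)))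

/-- A linear combination of disk indicators. -/
noncomputable def diskSum (t a : Fin m → ℝ) (n : ℕ) (w : ℂ) : ℝ :=
  ∑ ℓ, a ℓ * diskInd (radius (t ℓ) n) w

lemma measurable_diskSum (t a : Fin m → ℝ) (n : ℕ) : Measurable (diskSum t a n) := by
  have := fun ℓ => measurable_diskInd (radius (t ℓ) n)
  unfold diskSum
  fun_prop

lemma abs_diskSum_le (t a : Fin m → ℝ) (n : ℕ) (w : ℂ) : |diskSum t a n w| ≤ ∑ ℓ, |a ℓ| := by
  refine (Finset.abs_sum_le_sum_abs _ _).trans (Finset.sum_le_sum fun ℓ _ => ?_)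
  rw [abs_mul, abs_of_nonneg (diskInd_nonneg _ _)]
  exact mul_le_of_le_one_right (abs_nonneg _) (diskInd_le_one _ _)

lemma sum_mul_count (t a : Fin m → ℝ) (n : ℕ) (z : Fin n → ℂ) :
    ∑ ℓ, a ℓ * count (radius (t ℓ) n) z = ∑ j, diskSum t a n (z j) := by
  simp only [count_eq_sum, diskSum, Finset.mul_sum]
  exact Finset.sum_comm

lemma sum_integral_diskSum (hα : 0 < α) (a : Fin m → ℝ) (n : ℕ) :
    ∑ k : Fin n, ∫ w, diskSum t a n w ∂(radialLaw α k) =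
      ∑ ℓ, a ℓ * ∫ z, count (radius (t ℓ) n) z ∂(law α n) := by
  simp_rw [integral_count_law hα, Finset.mul_sum]
  rw [Finset.sum_comm]
  refine Finset.sum_congr rfl fun k _ => ?_
  unfold diskSum
  rw [integral_finsetSum _ fun ℓ _ => (integrable_diskInd hα k _).const_mul _]
  exact Finset.sum_congr rfl fun ℓ _ => integral_const_mul _ _

lemma sum_variance_diskSum (hα : 0 < α) (a : Fin m → ℝ) (n : ℕ) :
    ∑ k : Fin n, Var[diskSum t a n; radialLaw α k] =
      ∑ ℓ, ∑ j, a ℓ * (a j * cov[count (radius (t ℓ) n), count (radius (t j) n); law α n]) := by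
  have := fun k : Fin n => isProbabilityMeasure_radialLaw hα k
  have h : ∀ k : Fin n, Var[diskSum t a n; radialLaw α k] = ∑ ℓ, ∑ j, a ℓ * (a j *
      cov[diskInd (radius (t ℓ) n), diskInd (radius (t j) n); radialLaw α k]) := by
    intro k
    rw [← covariance_self (measurable_diskSum t a n).aemeasurable]
    unfold diskSum
    have hm : ∀ ℓ, MemLp (fun w => a ℓ * diskInd (radius (t ℓ) n) w) 2 (radialLaw α k) :=
      fun ℓ => (memLp_diskInd hα k _).const_mul _
    rw [covariance_fun_sum_fun_sum hm hm]
    simp_rw [covariance_const_mul_left, covariance_const_mul_right]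
  simp_rw [h, covariance_count_law hα, Finset.mul_sum]
  rw [Finset.sum_comm]
  exact Finset.sum_congr rfl fun ℓ _ => Finset.sum_comm

lemma tendsto_covariance_div (hα : 0 < α) (hta : Antitone t) (ht : ∀ ℓ, 0 ≤ t ℓ) (ℓ k : Fin m) :
    Tendsto (fun n : ℕ => cov[count (radius (t ℓ) n), count (radius (t k) n); law α n] / n)
      atTop (nhds (b₁₁ α (t (min ℓ k)) (t (max ℓ k)))) := by
  rcases le_total ℓ k with h | h
  · rw [min_eq_left h, max_eq_right h]
    exact tendsto_div_natCast hα (isBigO_covariance hα hta ht h)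
  · rw [min_eq_right h, max_eq_left h]
    simp_rw [covariance_comm (count (radius (t ℓ) _))]
    exact tendsto_div_natCast hα (isBigO_covariance hα hta ht h)

lemma tendsto_sum_variance_div (hα : 0 < α) (hta : Antitone t) (ht : ∀ ℓ, 0 ≤ t ℓ)
    (a : Fin m → ℝ) :
    Tendsto (fun n : ℕ => (∑ k : Fin n, Var[diskSum t a n; radialLaw α k]) / n) atTop
      (nhds (covForm α t a)) := by
  simp_rw [sum_variance_diskSum hα, Finset.sum_div, mul_div_assoc]
  exact tendsto_finsetSum _ fun ℓ _ => tendsto_finsetSum _ fun k _ =>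
    ((tendsto_covariance_div hα hta ht ℓ k).const_mul _).const_mul _

/-- Positivity comes from the probability rather than from the integrals: the form is a limit of
normalised variances. -/
lemma covForm_nonneg (hα : 0 < α) (hta : Antitone t) (ht : ∀ ℓ, 0 ≤ t ℓ) (a : Fin m → ℝ) :
    0 ≤ covForm α t a :=
  ge_of_tendsto' (tendsto_sum_variance_div hα hta ht a) fun n =>
    div_nonneg (Finset.sum_nonneg fun _ _ => variance_nonneg _ _) n.cast_nonneg

lemma dotProduct_limitCov (ht : ∀ ℓ, 0 ≤ b₁₁ α (t ℓ) (t ℓ)) (x : Fin m → ℝ) :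
    x ⬝ᵥ (limitCov α t).mulVec x = covForm α t fun ℓ => x ℓ / √(b₁₁ α (t ℓ) (t ℓ)) := by
  simp only [dotProduct, Matrix.mulVec, covForm, Finset.mul_sum, limitCov, Matrix.of_apply]
  refine Finset.sum_congr rfl fun ℓ _ => Finset.sum_congr rfl fun k _ => ?_
  rw [Real.sqrt_mul (ht ℓ)]
  ring

lemma posSemidef_limitCov (hα : 0 < α) (hta : Antitone t) (ht : ∀ ℓ, 0 < t ℓ) :
    (limitCov α t).PosSemidef := by
  refine Matrix.PosSemidef.of_dotProduct_mulVec_nonneg ?_ fun x => ?_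
  · ext ℓ k
    simp only [Matrix.conjTranspose_apply, limitCov, Matrix.of_apply, star_trivial]
    rw [min_comm, max_comm, mul_comm]
  · rw [star_trivial, dotProduct_limitCov fun ℓ => (b₁₁_self_pos hα (ht ℓ)).le]
    exact covForm_nonneg hα hta (fun ℓ => (ht ℓ).le) _

/-- The characteristic function of the centred sum over independent moduli. -/
lemma integral_exp_linear_count (hα : 0 < α) (a : Fin m → ℝ) (n : ℕ) (s c : ℝ) :
    ∫ z, Complex.exp ((s * (∑ ℓ, a ℓ * count (radius (t ℓ) n) z - c) : ℝ) * Complex.I)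
        ∂(law α n) =
      Complex.exp ((s * (∑ k : Fin n, ∫ w, diskSum t a n w ∂(radialLaw α k) - c) : ℝ)
        * Complex.I) *
      ∏ k : Fin n, ∫ w, Complex.exp ((s * (diskSum t a n w -
        ∫ w, diskSum t a n w ∂(radialLaw α k)) : ℝ) * Complex.I) ∂(radialLaw α k) := by
  have := fun k : Fin n => isProbabilityMeasure_radialLaw hα k
  have h := integral_comp_countVec_law hα (fun ℓ => radius (t ℓ) n) n
    (F := fun x : EuclideanSpace ℝ (Fin m) =>
      Complex.exp ((s * (∑ ℓ, a ℓ * x ℓ - c) : ℝ) * Complex.I))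
    (Continuous.stronglyMeasurable (by fun_prop))
  refine h.trans ?_
  rw [← integral_fintype_prod_eq_prod (fun (k : Fin n) (w : ℂ) => Complex.exp
    ((s * (diskSum t a n w - ∫ w, diskSum t a n w ∂(radialLaw α k)) : ℝ) * Complex.I)),
    ← integral_const_mul, indepLaw]
  refine integral_congr_ae (Eventually.of_forall fun z => ?_)
  simp only [countVec]
  rw [sum_mul_count, ← Complex.exp_sum, ← Complex.exp_add, ← Finset.sum_mul, ← add_mul,
    ← Complex.ofReal_sum, ← Complex.ofReal_add, ← Finset.mul_sum, Finset.sum_sub_distrib]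
  congr 3
  ring

/-- After centring, the characteristic function is a phase times a product over moduli. The phase
tends to `1` because the means differ from `b₁ n` by `O(1)`. Replacing each of the `n` factors by
its Gaussian counterpart costs `O(n^(-3/2))`, hence `O(n^(-1/2))` in total, and the Gaussian
exponents add up to half the normalised variance. -/
lemma tendsto_integral_exp_linear_count (hα : 0 < α) (hta : Antitone t) (ht : ∀ ℓ, 0 ≤ t ℓ)
    (a : Fin m → ℝ) :
    Tendsto (fun n : ℕ => ∫ z, Complex.exp (((√n)⁻¹ * (∑ ℓ, a ℓ * count (radius (t ℓ) n) z
        - (∑ ℓ, a ℓ * b₁ α (t ℓ)) * n) : ℝ) * Complex.I) ∂(law α n)) atTop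
      (nhds (Complex.exp (-(covForm α t a / 2) : ℝ))) := by
  have hδ : Tendsto (fun n : ℕ => (√n)⁻¹ * (∑ k : Fin n, ∫ w, diskSum t a n w ∂(radialLaw α k)
      - (∑ ℓ, a ℓ * b₁ α (t ℓ)) * n)) atTop (nhds 0) := by
    have h1 := tendsto_finsetSum Finset.univ fun ℓ _ =>
      (tendsto_sub_mul_div_sqrt hα (isBigO_mean hα ht ℓ)).const_mul (a ℓ)
    simp only [mul_zero, Finset.sum_const_zero] at h1
    refine h1.congr fun n => ?_
    rw [sum_integral_diskSum hα, Finset.sum_mul, ← Finset.sum_sub_distrib, Finset.mul_sum]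
    exact Finset.sum_congr rfl fun ℓ _ => by ring
  set B : ℝ := ∑ ℓ, |a ℓ| with hB
  have hB0 : 0 ≤ B := Finset.sum_nonneg fun _ _ => abs_nonneg _
  set C : ℝ := (2 * B) ^ 3 * Real.exp (2 * B) + Real.exp ((2 * B) ^ 2) * (2 * B) ^ 4 with hC
  set φ : ℕ → ℕ → ℂ := fun n k => ∫ w, Complex.exp (((√n)⁻¹ * (diskSum t a n w -
        ∫ w, diskSum t a n w ∂(radialLaw α k)) : ℝ) * Complex.I) ∂(radialLaw α k) with hφ
  set ψ : ℕ → ℕ → ℂ := fun n k =>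
    (Real.exp (-(((√n)⁻¹) ^ 2 * Var[diskSum t a n; radialLaw α k] / 2)) : ℝ) with hψ
  have hφψ : ∀ n : ℕ, 1 ≤ n → ∀ k, ‖φ n k - ψ n k‖ ≤ C * ((√n)⁻¹) ^ 3 := by
    intro n hn k
    have := isProbabilityMeasure_radialLaw hα k
    have hi : Integrable (diskSum t a n) (radialLaw α k) := (memLp_one_iff_integrable).1
      (MemLp.of_bound (measurable_diskSum t a n).aestronglyMeasurable B
        (Eventually.of_forall (abs_diskSum_le t a n)))
    have hmean : |∫ w, diskSum t a n w ∂(radialLaw α k)| ≤ B := by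
      have := norm_integral_le_of_norm_le_const (μ := radialLaw α k) (f := diskSum t a n) (C := B)
        (Eventually.of_forall (abs_diskSum_le t a n))
      simpa using this
    have hn1 : (1 : ℝ) ≤ √n := Real.one_le_sqrt.2 (by exact_mod_cast hn)
    have h := norm_charFun_centered_sub_le (μ := radialLaw α k)
      (Y := fun w => diskSum t a n w - ∫ w, diskSum t a n w ∂(radialLaw α k))
      ((measurable_diskSum t a n).sub_const _) (A := 2 * B) (by positivity)
      (fun w => (abs_sub _ _).trans (by linarith [abs_diskSum_le t a n w]))
      (by rw [integral_sub hi (integrable_const _)]; simp)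
      (s := (√n)⁻¹) (by positivity) (inv_le_one_of_one_le₀ hn1)
    rw [← variance_eq_integral (measurable_diskSum t a n).aemeasurable] at h
    exact h
  have hdiff : Tendsto (fun n : ℕ => ∏ k : Fin n, φ n k - ∏ k : Fin n, ψ n k) atTop (nhds 0) := by
    have h0 : Tendsto (fun n : ℕ => C * (√(n : ℝ))⁻¹) atTop (nhds 0) := by
      have := (Real.tendsto_sqrt_atTop.comp tendsto_natCast_atTop_atTop).inv_tendsto_atTop
      simpa using (this.const_mul C)
    refine squeeze_zero_norm' ?_ h0
    filter_upwards [eventually_ge_atTop 1] with n hn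
    have := fun k : Fin n => isProbabilityMeasure_radialLaw hα k
    refine (norm_prod_sub_prod_le Finset.univ (fun k _ => ?_) fun k _ => ?_).trans ?_
    · refine (norm_integral_le_of_norm_le_const (C := 1) (Eventually.of_forall fun w =>
        (Complex.norm_exp_ofReal_mul_I _).le)).trans ?_
      simp
    · simp only [hψ]
      rw [Complex.norm_real, Real.norm_of_nonneg (Real.exp_pos _).le, Real.exp_le_one_iff,
        neg_nonpos]
      have := variance_nonneg (diskSum t a n) (radialLaw α k)
      positivity
    · calc ∑ k : Fin n, ‖φ n k - ψ n k‖ ≤ ∑ _k : Fin n, C * ((√n)⁻¹) ^ 3 :=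
            Finset.sum_le_sum fun k _ => hφψ n hn k
        _ = C * (√(n : ℝ))⁻¹ := by
          have h1 : (0 : ℝ) < √n := Real.sqrt_pos.2 (by positivity)
          have h2 : (√(n : ℝ)) ^ 2 = n := Real.sq_sqrt n.cast_nonneg
          rw [Finset.sum_const, Finset.card_univ, Fintype.card_fin, nsmul_eq_mul]
          nth_rewrite 1 [← h2]
          field_simp
  have hψprod : Tendsto (fun n : ℕ => ∏ k : Fin n, ψ n k) atTop
      (nhds (Complex.exp (-(covForm α t a / 2) : ℝ))) := by
    have h1 : Tendsto (fun n : ℕ => Real.exp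
        (-((∑ k : Fin n, Var[diskSum t a n; radialLaw α k]) / n / 2))) atTop
        (nhds (Real.exp (-(covForm α t a / 2)))) :=
      (Real.continuous_exp.tendsto _).comp
        ((tendsto_sum_variance_div hα hta ht a).div_const 2).neg
    have h2 := (Complex.continuous_ofReal.tendsto _).comp h1
    rw [Complex.ofReal_exp] at h2
    refine h2.congr fun n => ?_
    simp only [hψ, Function.comp]
    rw [← Complex.ofReal_prod, ← Real.exp_sum, Finset.sum_neg_distrib, ← Finset.sum_div,
      ← Finset.mul_sum, inv_pow, Real.sq_sqrt n.cast_nonneg, div_eq_inv_mul _ (n : ℝ)]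
  have hphase : Tendsto (fun n : ℕ => Complex.exp (((√n)⁻¹ *
      (∑ k : Fin n, ∫ w, diskSum t a n w ∂(radialLaw α k)
      - (∑ ℓ, a ℓ * b₁ α (t ℓ)) * n) : ℝ) * Complex.I)) atTop (nhds 1) := by
    have hc : Continuous fun x : ℝ => Complex.exp (x * Complex.I) := by fun_prop
    have h0 : Complex.exp ((0 : ℝ) * Complex.I) = 1 := by simp
    rw [← h0]
    exact (hc.tendsto 0).comp hδ
  have := hphase.mul (hdiff.add hψprod)
  rw [one_mul, zero_add] at this
  refine this.congr fun n => ?_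
  rw [sub_add_cancel, integral_exp_linear_count hα]

/-- Lévy's continuity theorem: at each frequency `ξ` the characteristic function is that of the
linear combination with coefficients `ξ_ℓ / √b₁₁(t_ℓ, t_ℓ)`. -/
theorem tendstoInDistribution_counts (hα : 0 < α) (hta : Antitone t) (ht : ∀ ℓ, 0 < t ℓ) :
    haveI : ∀ n, IsProbabilityMeasure (law α n) := isProbabilityMeasure_law hα
    TendstoInDistribution
      (fun (n : ℕ) (z : Fin n → ℂ) =>
        (WithLp.toLp 2 fun ℓ => (count (radius (t ℓ) n) z - b₁ α (t ℓ) * n)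
          / √(b₁₁ α (t ℓ) (t ℓ) * n) : EuclideanSpace ℝ (Fin m)))
      atTop id (law α) (multivariateGaussian 0 (limitCov α t)) := by
  have : ∀ n, IsProbabilityMeasure (law α n) := isProbabilityMeasure_law hα
  have hb := fun ℓ => b₁₁_self_pos hα (ht ℓ)
  have hmeas : ∀ n, Measurable fun z : Fin n → ℂ =>
      (WithLp.toLp 2 fun ℓ => (count (radius (t ℓ) n) z - b₁ α (t ℓ) * n)
          / √(b₁₁ α (t ℓ) (t ℓ) * n) : EuclideanSpace ℝ (Fin m)) := fun n =>
    (WithLp.measurable_toLp 2 _).comp (measurable_pi_lambda _ fun ℓ =>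
      ((measurable_count _).sub_const _).div_const _)
  refine ⟨fun n => (hmeas n).aemeasurable, aemeasurable_id, ?_⟩
  refine (ProbabilityMeasure.tendsto_iff_tendsto_charFun (E := EuclideanSpace ℝ (Fin m))).2
    fun ξ => ?_
  simp only [ProbabilityMeasure.coe_mk]
  rw [Measure.map_id, charFun_multivariateGaussian (posSemidef_limitCov hα hta ht),
    dotProduct_limitCov fun ℓ => (hb ℓ).le]
  have h := tendsto_integral_exp_linear_count hα hta (fun ℓ => (ht ℓ).le)
    fun ℓ => ξ ℓ / √(b₁₁ α (t ℓ) (t ℓ))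
  have hlim : Complex.exp ((inner ℝ ξ (0 : EuclideanSpace ℝ (Fin m)) : ℝ) * Complex.I -
      (covForm α t fun ℓ => ξ ℓ / √(b₁₁ α (t ℓ) (t ℓ)) : ℝ) / 2) =
      Complex.exp (-((covForm α t fun ℓ => ξ ℓ / √(b₁₁ α (t ℓ) (t ℓ))) / 2) : ℝ) := by
    rw [inner_zero_right]
    push_cast
    ring_nf
  rw [hlim]
  -- The two expressions agree for every `n`, including `n = 0`, where both `(√0)⁻¹` and division by
  -- `√0` give `0`.
  refine h.congr fun n => ?_
  rw [charFun_apply, integral_map (hmeas n).aemeasurable (by fun_prop)]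
  refine integral_congr_ae (Eventually.of_forall fun z => ?_)
  simp only [PiLp.inner_apply]
  congr 3
  rw [Finset.sum_mul, ← Finset.sum_sub_distrib, Finset.mul_sum]
  refine Finset.sum_congr rfl fun ℓ _ => ?_
  rw [Real.sqrt_mul (hb ℓ).le]
  simp
  ring

end CLT

end HardEdge

/-! ### Assembly of the two parts of the theorem -/

open HardEdge
theorem corollary1p3 (m : ℕ) (hm : 0 < m) (α : ℝ) (hα : 0 < α) (t : Fin m → ℝ)
    (ht : StrictAnti t) (ht₀ : ∀ ℓ, 0 ≤ t ℓ) :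
    -- the functions being differentiated are smooth near the origin
    (ContDiffAt ℝ ∞ (C₁ α t) 0 ∧ ContDiffAt ℝ ∞ (C₂ α t) 0 ∧
      ∀ n : ℕ, ContDiffAt ℝ ∞ (logMGF (law α n) fun ℓ => count (radius (t ℓ) n)) 0) ∧
    -- (a) joint cumulants
    (∀ j : Fin m → ℕ, 1 ≤ ∑ ℓ, j ℓ →
      (fun n : ℕ => jointCumulant (law α n) (fun ℓ => count (radius (t ℓ) n)) j
          - (mixedPartial j (C₁ α t) 0 * n + mixedPartial j (C₂ α t) 0))
        =O[atTop] errorRate α) ∧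
    -- (a) mean, variance, covariance
    (∀ ℓ, (fun n : ℕ => (∫ z, count (radius (t ℓ) n) z ∂(law α n))
          - (b₁ α (t ℓ) * n + c₁ α (t ℓ)))
        =O[atTop] errorRate α) ∧
    (∀ ℓ, (fun n : ℕ => Var[count (radius (t ℓ) n); law α n]
          - (b₁₁ α (t ℓ) (t ℓ) * n + c₁₁ α (t ℓ) (t ℓ)))
        =O[atTop] errorRate α) ∧
    (∀ ℓ k, ℓ < k →
      (fun n : ℕ => cov[count (radius (t ℓ) n), count (radius (t k) n); law α n]
          - (b₁₁ α (t ℓ) (t k) * n + c₁₁ α (t ℓ) (t k)))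
        =O[atTop] errorRate α) ∧
    (∀ ℓ, 0 < t ℓ → b₁ α (t ℓ) = Q α (t ℓ) + α * ((1 - Q (α + 1) (t ℓ)) / t ℓ)) ∧
    -- (b) central limit theorem
    ((∀ ℓ, 0 < t ℓ) →
      (∀ ℓ, 0 < b₁₁ α (t ℓ) (t ℓ)) ∧ (limitCov α t).PosSemidef ∧
      haveI : ∀ n, IsProbabilityMeasure (law α n) := isProbabilityMeasure_law hα
      TendstoInDistribution
        (fun (n : ℕ) (z : Fin n → ℂ) =>
          (WithLp.toLp 2 fun ℓ => (count (radius (t ℓ) n) z - b₁ α (t ℓ) * n)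
            / √(b₁₁ α (t ℓ) (t ℓ) * n) : EuclideanSpace ℝ (Fin m)))
        atTop id (law α) (multivariateGaussian 0 (limitCov α t))) := by
  have hta : Antitone t := ht.antitone
  refine ⟨⟨?_, ?_, fun n => (contDiff_logMGF hα hta n).contDiffAt⟩,
    fun j _ => isBigO_jointCumulant hα hta ht₀ j, isBigO_mean hα ht₀,
    isBigO_variance hα hta ht₀, fun ℓ k h => isBigO_covariance hα hta ht₀ h.le,
    fun ℓ h => b₁_eq hα h, fun h => ⟨fun ℓ => b₁₁_self_pos hα (h ℓ),
      posSemidef_limitCov hα hta h, tendstoInDistribution_counts hα hta h⟩⟩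
  · exact (contDiffOn_C₁ hα ht₀).contDiffAt (isOpen_paramSet.mem_nhds zero_mem_paramSet)
  · exact (contDiffOn_C₂ hα ht₀).contDiffAt (isOpen_paramSet.mem_nhds zero_mem_paramSet)
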